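/- **Theorem (symmetric Pearcey asymptotics).** Let $0<q<1$, $\alpha=\frac{2q}{1-q}$, $c_\alpha=(1+\alpha)^{-2}(\alpha(2+\alpha))^{1/2}$ and $\phi(x)=\bigl(1+\alpha(1-x)+\tfrac{\alpha^2}{2}(1-x)\bigr)^{-1}$. For $k\ge 1$ put $r_k=\lfloor\frac{k+1}{2}\rfloor$, $a_k=-\frac12$ if $k$ is odd and $a_k=\frac12$ if $k$ is even, so that $k=2r_k+a_k-\frac12$. Let $J_{s,\pm1/2}$ be the Jacobi polynomials determined by $$J_{s,1/2}\Bigl(\tfrac{z+z^{-1}}{2}\Bigr)=\frac{z^{s+1}-z^{-(s+1)}}{z-z^{-1}},\qquad J_{s,-1/2}\Bigl(\tfrac{z+z^{-1}}{2}\Bigr)=\frac{z^{s+1/2}+z^{-(s+1/2)}}{z^{1/2}+z^{-1/2}} .$$ For integers $T,s,t\ge 0$ and $k,m\ge1$ let $$\begin{aligned}K_T((s,k),(t,m))&=\frac{2^{a_k+1/2}}{\pi}\frac1{2\pi i}\int_{-1}^1\oint\frac{\phi(x)^T}{\phi(u)^T}J_{s,a_k}(x)J_{t,a_m}(u)\frac{(1-x)^{r_k}}{(1-u)^{r_m}}\frac{(1-x)^{a_k}(1+x)^{1/2}}{x-u}\,du\,dx\\&\quad+1_{k\ge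 m}\frac{2^{a_k+1/2}}{\pi}\int_{-1}^1J_{s,a_k}(x)J_{t,a_m}(x)(1-x)^{r_k-r_m+a_k}(1+x)^{1/2}\,dx,\end{aligned}$$ where $u$ runs over a positively oriented simple loop around $[-1,1]$. For $\nu_1,\nu_2>0$ and $\eta_1,\eta_2\in\mathbb R$ let $\mathcal K$ be the symmetric Pearcey kernel $$\begin{aligned}\mathcal K((\nu_1,\eta_1),(\nu_2,\eta_2))&=\frac{\sqrt2}{2\pi^2i}\int_{-i\infty}^{i\infty}\int_0^\infty\exp\Bigl(\frac{u^2-x^2}{8}+\frac{\eta_2u-\eta_1x}{2}\Bigr)\sin(\nu_1\sqrt{2x})\sin(\nu_2\sqrt{2u})\frac{dx\,du}{\sqrt u\,(u-x)}\\&\quad+\frac{1_{\eta_2<\eta_1}}{\sqrt{\pi(\eta_1-\eta_2)}}\Bigl(\exp\Bigl(\frac{(\nu_1-\nu_2)^2}{\eta_2-\eta_1}\Bigr)-\exp\Bigl(\frac{(\nu_1+\nu_2)^2}{\eta_2-\eta_1}\Bigr)\Bigr).\end{aligned}$$ Let the integers $s_1,s_2\ge0$, $k_1,k_2\ge1$,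 $T\ge0$ depend on $N\in\mathbb N$, and write $r_j=r_{k_j}$, $a_j=a_{k_j}$. Suppose that, as $N\to\infty$, for $j=1,2$, $$\frac{s_j}{N^{1/4}}\to\nu_jc_\alpha^{1/2},\qquad \frac TN\to1,\qquad \frac{r_j-(1-(1+\alpha)^{-2})T}{\sqrt N}\to c_\alpha\eta_j .$$ (i) If $(\nu_1,\eta_1)\ne(\nu_2,\eta_2)$, or if for all sufficiently large $N$ either $k_1<k_2$, or $k_1=k_2$ and $s_1\neq s_2$, then, as $N\to\infty$, $$2^{r_2-r_1}(-1)^{s_1-s_2}2^{a_2-a_1}N^{1/4}c_\alpha^{1/2}\,K_T((s_1,k_1),(s_2,k_2))\to\mathcal K((\nu_1,\eta_1),(\nu_2,\eta_2)).$$ (ii) If $(s_1,k_1)=(s_2,k_2)$ for all sufficiently large $N$, then the same convergence holds with $K_T-1$ in place of $K_T$. -/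

import Mathlib

open Filter Topology MeasureTheory Set

noncomputable section

namespace SympPearcey

/-- `r_k = ⌊(k+1)/2⌋`, the number of particles on level `k`. -/
def rIdx (k : ℕ) : ℕ := (k + 1) / 2

/-- `a_k = -1/2` for odd `k` and `a_k = 1/2` for even `k`. -/
def aIdx (k : ℕ) : ℝ := if Odd k then -1 / 2 else 1 / 2

/-- The relation `k = 2 r_k + a_k - 1/2`. -/
theorem level_eq (k : ℕ) : (k : ℝ) = 2 * (rIdx k : ℝ) + aIdx k - 1 / 2 := by
  unfold rIdx aIdx
  rcases Nat.even_or_odd' k with ⟨m, rfl | rfl⟩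
  · have h : (2 * m + 1) / 2 = m := by omega
    have h2 : ¬ Odd (2 * m) := by simp
    rw [h, if_neg h2]; push_cast; ring
  · have h : (2 * m + 1 + 1) / 2 = m + 1 := by omega
    have h2 : Odd (2 * m + 1) := ⟨m, rfl⟩
    rw [h, if_pos h2]; push_cast; ring

/-- The Jacobi polynomial `J_{s,1/2}` (Chebyshev polynomial of the second kind),
see `jacobiHalf_eval` for its defining property. -/
def jacobiHalf (s : ℕ) : Polynomial ℂ := Polynomial.Chebyshev.U ℂ (s : ℤ)

/-- The Jacobi polynomial `J_{s,-1/2}` (`U_s - U_{s-1}` with `U_{-1} = 0`),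
see `jacobiNegHalf_eval` for its defining property. -/
def jacobiNegHalf (s : ℕ) : Polynomial ℂ :=
  Polynomial.Chebyshev.U ℂ (s : ℤ) - Polynomial.Chebyshev.U ℂ ((s : ℤ) - 1)

theorem chebU_eval_aux (z : ℂ) (hz : z ≠ 0) (s : ℕ) :
    (Polynomial.Chebyshev.U ℂ ((s : ℤ) - 1)).eval ((z + z⁻¹) / 2) * (z - z⁻¹)
        = z ^ s - z⁻¹ ^ s ∧
      (Polynomial.Chebyshev.U ℂ (s : ℤ)).eval ((z + z⁻¹) / 2) * (z - z⁻¹)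
        = z ^ (s + 1) - z⁻¹ ^ (s + 1) := by
  induction s with
  | zero => simp
  | succ n ih =>
    obtain ⟨h1, h2⟩ := ih
    have hzz : z * z⁻¹ = 1 := mul_inv_cancel₀ hz
    refine ⟨by simpa using h2, ?_⟩
    have := Polynomial.Chebyshev.U_add_one ℂ (n : ℤ)
    push_cast
    rw [this]
    simp only [Polynomial.eval_sub, Polynomial.eval_mul, Polynomial.eval_ofNat,
      Polynomial.eval_X]
    linear_combination (z + z⁻¹) * h2 - h1 + (z ^ n - z⁻¹ ^ n) * hzz

/-- `J_{s,1/2}((z+z⁻¹)/2) = (z^{s+1} - z^{-(s+1)}) / (z - z⁻¹)`. -/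
theorem jacobiHalf_eval (s : ℕ) (z : ℂ) (hz : z ≠ 0) (hz2 : z - z⁻¹ ≠ 0) :
    (jacobiHalf s).eval ((z + z⁻¹) / 2) = (z ^ (s + 1) - z⁻¹ ^ (s + 1)) / (z - z⁻¹) := by
  rw [eq_div_iff hz2]
  exact (chebU_eval_aux z hz s).2

/-- `J_{s,-1/2}((z+z⁻¹)/2) = (z^{s+1/2} + z^{-(s+1/2)}) / (z^{1/2} + z^{-1/2})`, where
`w = z^{1/2}`. -/
theorem jacobiNegHalf_eval (s : ℕ) (w : ℂ) (hw : w ≠ 0) (hw2 : w ^ 2 - (w ^ 2)⁻¹ ≠ 0) :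
    (jacobiNegHalf s).eval ((w ^ 2 + (w ^ 2)⁻¹) / 2)
      = (w ^ (2 * s + 1) + w⁻¹ ^ (2 * s + 1)) / (w + w⁻¹) := by
  have hww : w * w⁻¹ = 1 := mul_inv_cancel₀ hw
  have hfac : w ^ 2 - (w ^ 2)⁻¹ = (w - w⁻¹) * (w + w⁻¹) := by
    rw [← inv_pow]; ring
  have hp : w + w⁻¹ ≠ 0 := fun h => hw2 (by rw [hfac, h, mul_zero])
  obtain ⟨h1, h2⟩ := chebU_eval_aux (w ^ 2) (pow_ne_zero 2 hw) s
  rw [eq_div_iff hp]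
  apply mul_right_cancel₀ hw2
  unfold jacobiNegHalf
  rw [Polynomial.eval_sub]
  rw [← inv_pow] at *
  have e1 : (w ^ 2) ^ (s + 1) = w ^ (2 * s + 1) * w := by rw [← pow_mul]; ring
  have e2 : (w⁻¹ ^ 2) ^ (s + 1) = w⁻¹ ^ (2 * s + 1) * w⁻¹ := by rw [← pow_mul]; ring
  have e3 : (w ^ 2) ^ s = w ^ (2 * s + 1) * w⁻¹ := by
    rw [← pow_mul, pow_succ]; rw [mul_assoc, hww, mul_one]
  have e4 : (w⁻¹ ^ 2) ^ s = w⁻¹ ^ (2 * s + 1) * w := by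
    rw [← pow_mul, pow_succ, mul_assoc, mul_comm w⁻¹ w, hww, mul_one]
  rw [e1, e2] at h2
  rw [e3, e4] at h1
  linear_combination (w + w⁻¹) * (h2 - h1)

/-- `J_{s,a_k}`. -/
def jacobiJ (s k : ℕ) : Polynomial ℂ := if Odd k then jacobiNegHalf s else jacobiHalf s

/-- `α = 2q/(1-q)`. -/
def alpha (q : ℝ) : ℝ := 2 * q / (1 - q)

/-- `φ(x) = 1 / (1 + α(1-x) + (α²/2)(1-x))`. -/
def phi (q : ℝ) (x : ℂ) : ℂ :=
  1 / (1 + (alpha q : ℂ) * (1 - x) + (alpha q : ℂ) ^ 2 / 2 * (1 - x))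

/-- The correlation kernel `K_T((s,k),(t,m))`. The variable `u` runs over the positively
oriented circle of centre `1` and radius `3`, which encloses the interval `[-1,1]`; since the
integrand is holomorphic in `u` off `[-1,1]`, every other positively oriented simple loop around
`[-1,1]` gives the same value. -/
def corrKernel (q : ℝ) (T s k t m : ℕ) : ℂ :=
  (((2 : ℝ) ^ (aIdx k + 1 / 2) / Real.pi : ℝ) : ℂ) * (1 / (2 * (Real.pi : ℂ) * Complex.I)) *
      (∫ x in (-1 : ℝ)..1, ∮ u in C(1, 3),
        phi q (x : ℂ) ^ T / phi q u ^ T *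
          (jacobiJ s k).eval (x : ℂ) * (jacobiJ t m).eval u *
          ((1 - (x : ℂ)) ^ rIdx k / (1 - u) ^ rIdx m) *
          ((((1 - x) ^ aIdx k * (1 + x) ^ (1 / 2 : ℝ) : ℝ) : ℂ) / ((x : ℂ) - u)))
  + (if m ≤ k then
      (((2 : ℝ) ^ (aIdx k + 1 / 2) / Real.pi : ℝ) : ℂ) *
        ∫ x in (-1 : ℝ)..1, (jacobiJ s k).eval (x : ℂ) * (jacobiJ t m).eval (x : ℂ) *
          (((1 - x) ^ ((rIdx k : ℝ) - (rIdx m : ℝ) + aIdx k) * (1 + x) ^ (1 / 2 : ℝ) : ℝ) : ℂ)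
    else 0)

/-- The symmetric Pearcey kernel `𝒦((ν₁,η₁),(ν₂,η₂))`. The variable `u = i y` runs along the
imaginary axis from `-i∞` to `i∞` (so `du = i dy`). The value of `sin (ν₂ √(2u)) / √u` does not
depend on the branch of the root, as long as `√(2u) = √2 √u`. -/
def pearceyKernel (ν₁ η₁ ν₂ η₂ : ℝ) : ℂ :=
  (Real.sqrt 2 : ℂ) / (2 * (Real.pi : ℂ) ^ 2 * Complex.I) *
      (∫ y : ℝ, (∫ x in Ioi (0 : ℝ),
        Complex.exp (((Complex.I * y) ^ 2 - (x : ℂ) ^ 2) / 8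
            + ((η₂ : ℂ) * (Complex.I * y) - (η₁ : ℂ) * x) / 2) *
          Complex.sin ((ν₁ : ℂ) * (Real.sqrt (2 * x) : ℂ)) *
          Complex.sin ((ν₂ : ℂ) * ((Real.sqrt 2 : ℂ) * (Complex.I * y) ^ (1 / 2 : ℂ))) /
          ((Complex.I * y) ^ (1 / 2 : ℂ) * (Complex.I * y - x))) * Complex.I)
  + (if η₂ < η₁ then
      ((1 / Real.sqrt (Real.pi * (η₁ - η₂)) *
        (Real.exp ((ν₁ - ν₂) ^ 2 / (η₂ - η₁)) - Real.exp ((ν₁ + ν₂) ^ 2 / (η₂ - η₁))) : ℝ) : ℂ)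
    else 0)

/-- `c_α = (1+α)^{-2} (α(2+α))^{1/2}`. -/
def cAlpha (q : ℝ) : ℝ := ((1 + alpha q) ^ 2)⁻¹ * Real.sqrt (alpha q * (2 + alpha q))

/-- The conjugating and rescaling factor
`2^{r₂-r₁} (-1)^{s₁-s₂} 2^{a₂-a₁} N^{1/4} c_α^{1/2}`, where `r_j`, `a_j` belong to level `k_j`. -/
def scaling (q : ℝ) (N s₁ k₁ s₂ k₂ : ℕ) : ℝ :=
  (2 : ℝ) ^ ((rIdx k₂ : ℤ) - (rIdx k₁ : ℤ)) * (-1 : ℝ) ^ ((s₁ : ℤ) - (s₂ : ℤ)) *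
    (2 : ℝ) ^ (aIdx k₂ - aIdx k₁) * (N : ℝ) ^ (1 / 4 : ℝ) * cAlpha q ^ (1 / 2 : ℝ)

end SympPearcey

end

/-! The kernel is a double contour integral plus a single integral over `[-1,1]`; in the limit these
give, separately, the two lines of the Pearcey kernel.

Double integral. With `1 - u = 2z` and `κ = 1 - (1+α)⁻²` one has `1/φ(u) = (1+α)²(1 + κ(z-1))`, so
the large exponents in `u` enter through `(1 + κ(z-1))^T / z^{r₂}`. Its logarithm is critical at `z
= 1`, that is `u = -1`, exactly when `r₂ = κT`, and then has second derivative `κ(1-κ)T = c_α² T`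
there. This dictates the scale `L = N^{1/4} c_α^{1/2}` and the variables `x = -1 + X/L²`, `u = 1 -
2e^{-iy/(2L²)} ≈ -1 + iy/L²`. Second order expansion (`tendsto_phase`) gives the exponential in the
limit kernel, and `U_n(cos δ) = sin((n+1)δ)/sin δ` with `δ` of order `1/L` gives the sines
(`tendsto_jacobiScaled_edge`).

To pass to the limit under the integral, the contour is moved to the circle `|u - 1| = 2`. On this
circle and on `[-1,1]` the modulus of the phase has Gaussian bounds in `y` and `X`, uniform in `N`
(`rpow_mul_inv_pow_le`, `norm_one_add_mul_exp_sub_one_pow_le`), which beat the growth `exp(M√(2X))`,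
`exp(M√(2|y|))` of the polynomials. The two paths meet at `-1`, where `1/(x-u)` is singular; but
`|x-u|` is at least a multiple of the geometric mean of the distances of `x` and `u` from `-1`,
measured by `X` and `|y|`. The weight `(1+x)^{1/2}` therefore leaves only the integrable singularity
`|y|^{-1/2}` (`norm_sqrt_div_le`). Dominated convergence applies: `EdgeRegime.tendsto_integral`.

Single integral. The substitution `x = -cos δ` turns it into `(2/π) ∫ sin(Aδ) sin(Bδ)
cos(δ/2)^{k₁-k₂} dδ` over `[0,π]`, with `A ≈ s₁`, `B ≈ s₂` and `k₁ - k₂ ≈ 2(η₁-η₂)L²`. If `η₁ > η₂`,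
Laplace's method gives the Gaussian term. If `η₁ = η₂` the cosine power no longer localises at scale
`1/L`, and smallness comes from oscillation when `ν₁ ≠ ν₂`, or from exact orthogonality on a common
level. If `η₁ < η₂` the term is eventually absent. In part (ii) it equals the scaling factor itself
and cancels the subtracted `1`. -/

noncomputable section

namespace SympPearcey

/-! ### Chebyshev polynomials near the edge: uniform bounds and Hilb asymptotics. -/

/-- The Jacobi polynomial with the conjugating factor `2^a (-1)^t`. -/
def jacobiScaled (k t : ℕ) (u : ℂ) : ℂ :=
  (((2 : ℝ) ^ aIdx k : ℝ) : ℂ) * (-1) ^ t * (jacobiJ t k).eval u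

theorem neg_one_pow_mul_chebU_neg (t : ℕ) (x : ℂ) :
    (-1) ^ t * (Polynomial.Chebyshev.U ℂ (t : ℤ)).eval (-x)
      = (Polynomial.Chebyshev.U ℂ (t : ℤ)).eval x := by
  rw [Polynomial.Chebyshev.U_eval_neg, ← mul_assoc]
  have : ((-1 : ℂ) ^ t) * (((t : ℤ).negOnePow : ℤˣ) : ℤ) = 1 := by
    rw [Int.negOnePow_def]
    rw [zpow_natCast, Units.val_pow_eq_pow_val]
    push_cast
    rw [← mul_pow]; simp
  rw [this, one_mul]

theorem neg_one_pow_mul_chebU_sub_neg (t : ℕ) (x : ℂ) :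
    (-1) ^ t * ((Polynomial.Chebyshev.U ℂ (t : ℤ)).eval (-x)
        - (Polynomial.Chebyshev.U ℂ ((t : ℤ) - 1)).eval (-x))
      = (Polynomial.Chebyshev.U ℂ (t : ℤ)).eval x
        + (Polynomial.Chebyshev.U ℂ ((t : ℤ) - 1)).eval x := by
  rw [mul_sub, neg_one_pow_mul_chebU_neg]
  rcases t with _ | t
  · simp
  · have := neg_one_pow_mul_chebU_neg t x
    push_cast
    rw [add_sub_cancel_right, pow_succ]
    linear_combination this

/-- Parity and the sign `(-1)^t` move the edge from `-1` to `1`. The difference defining the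
odd-level polynomial becomes a sum, so that with the weights `2^{±1/2}` odd and even levels acquire
the same edge limit. -/
theorem jacobiScaled_neg_odd {k : ℕ} (hk : Odd k) (t : ℕ) (x : ℂ) :
    jacobiScaled k t (-x) = (((2 : ℝ) ^ (-1 / 2 : ℝ) : ℝ) : ℂ) *
      ((Polynomial.Chebyshev.U ℂ (t : ℤ)).eval x
        + (Polynomial.Chebyshev.U ℂ ((t : ℤ) - 1)).eval x) := by
  rw [← neg_one_pow_mul_chebU_sub_neg]
  simp only [jacobiScaled, jacobiJ, aIdx, if_pos hk, jacobiNegHalf, Polynomial.eval_sub]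
  ring

theorem jacobiScaled_neg_even {k : ℕ} (hk : ¬ Odd k) (t : ℕ) (x : ℂ) :
    jacobiScaled k t (-x) = (((2 : ℝ) ^ (1 / 2 : ℝ) : ℝ) : ℂ) *
      (Polynomial.Chebyshev.U ℂ (t : ℤ)).eval x := by
  rw [← neg_one_pow_mul_chebU_neg]
  simp only [jacobiScaled, jacobiJ, aIdx, if_neg hk, jacobiHalf]
  ring

theorem norm_complex_cos_le (z : ℂ) : ‖Complex.cos z‖ ≤ Real.exp |z.im| := by
  rw [Complex.cos]
  have h1 : ‖Complex.exp (z * Complex.I)‖ ≤ Real.exp |z.im| := by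
    rw [Complex.norm_exp]; simp [neg_le_abs]
  have h2 : ‖Complex.exp (-z * Complex.I)‖ ≤ Real.exp |z.im| := by
    rw [Complex.norm_exp]; simp [le_abs_self]
  rw [norm_div, Complex.norm_ofNat]
  have := norm_add_le (Complex.exp (z * Complex.I)) (Complex.exp (-z * Complex.I))
  linarith

/-- Induction through `U_{t+1} = X U_t + T_{t+1}` avoids dividing by `sin δ`, so the bound holds for
every complex `δ`. -/
theorem norm_chebU_cos_le (δ : ℂ) (t : ℕ) :
    ‖(Polynomial.Chebyshev.U ℂ (t : ℤ)).eval (Complex.cos δ)‖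
      ≤ (t + 1) * Real.exp (t * |δ.im|) := by
  induction t with
  | zero => simp
  | succ n ih =>
    push_cast
    rw [Polynomial.Chebyshev.U_eq_X_mul_U_add_T]
    simp only [Polynomial.eval_add, Polynomial.eval_mul, Polynomial.eval_X]
    rw [Polynomial.Chebyshev.T_complex_cos]
    have h1 := norm_complex_cos_le δ
    have h2 := norm_complex_cos_le (((n + 1 : ℤ) : ℂ) * δ)
    have h3 : |((((n + 1 : ℤ) : ℂ) * δ)).im| = (n + 1) * |δ.im| := by
      have : ((((n + 1 : ℤ) : ℂ) * δ)).im = (n + 1) * δ.im := by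
        simp
      rw [this, abs_mul, abs_of_nonneg (by positivity : (0 : ℝ) ≤ (n : ℝ) + 1)]
    rw [h3] at h2
    refine (norm_add_le _ _).trans ?_
    rw [norm_mul]
    calc _ ≤ Real.exp |δ.im| * ((n + 1) * Real.exp (n * |δ.im|))
          + Real.exp ((n + 1) * |δ.im|) := by gcongr
      _ = _ := by
        have : Real.exp ((n + 1) * |δ.im|) = Real.exp |δ.im| * Real.exp (n * |δ.im|) := by
          rw [← Real.exp_add]; ring_nf
        rw [this]; ring

/-- `|sin z|² = sin²(Re z) + sinh²(Im z)`, and `|sinh|` dominates the identity. -/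
theorem sq_im_le_norm_sin_sq (z : ℂ) : z.im ^ 2 ≤ ‖Complex.sin z‖ ^ 2 := by
  have h1 : ‖Complex.sin z‖ ^ 2 = Real.sin z.re ^ 2 + Real.sinh z.im ^ 2 := by
    rw [← Complex.normSq_eq_norm_sq, Complex.sin_eq, Complex.normSq_apply]
    have e1 : (Complex.sin z.re * Complex.cosh z.im + Complex.cos z.re * Complex.sinh z.im * Complex.I).re
      = Real.sin z.re * Real.cosh z.im := by
      rw [← Complex.ofReal_sin, ← Complex.ofReal_cosh, ← Complex.ofReal_cos, ← Complex.ofReal_sinh]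
      simp [-Complex.ofReal_sin, -Complex.ofReal_cosh, -Complex.ofReal_cos, -Complex.ofReal_sinh]
    have e2 : (Complex.sin z.re * Complex.cosh z.im + Complex.cos z.re * Complex.sinh z.im * Complex.I).im
      = Real.cos z.re * Real.sinh z.im := by
      rw [← Complex.ofReal_sin, ← Complex.ofReal_cosh, ← Complex.ofReal_cos, ← Complex.ofReal_sinh]
      simp [-Complex.ofReal_sin, -Complex.ofReal_cosh, -Complex.ofReal_cos, -Complex.ofReal_sinh]
    rw [e1, e2]
    have := Real.cosh_sq z.im
    have := Real.sin_sq_add_cos_sq z.re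
    linear_combination (Real.sin z.re) ^ 2 * (Real.cosh_sq z.im) + Real.sinh z.im ^ 2 * this
  rw [h1]
  have : z.im ^ 2 ≤ Real.sinh z.im ^ 2 := by
    rw [sq_le_sq]
    rcases le_total 0 z.im with h | h
    · rw [abs_of_nonneg h, abs_of_nonneg (Real.sinh_nonneg_iff.2 h)]
      exact Real.self_le_sinh_iff.2 h
    · rw [abs_of_nonpos h, abs_of_nonpos (Real.sinh_nonpos_iff.2 h)]
      linarith [Real.sinh_le_self_iff.2 h]
  nlinarith [sq_nonneg (Real.sin z.re)]

theorem one_sub_cos_eq (δ : ℂ) : 1 - Complex.cos δ = 2 * Complex.sin (δ / 2) ^ 2 := by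
  have := Complex.cos_two_mul' (δ / 2)
  have h2 := Complex.sin_sq_add_cos_sq (δ / 2)
  rw [mul_div_cancel₀ _ two_ne_zero] at this
  linear_combination -this - h2

theorem abs_im_le_of_cos_eq {δ ζ : ℂ} (h : Complex.cos δ = 1 - ζ) :
    |δ.im| ≤ Real.sqrt (2 * ‖ζ‖) := by
  apply Real.le_sqrt_of_sq_le
  have h1 := one_sub_cos_eq δ
  rw [h, sub_sub_cancel] at h1
  have h2 := sq_im_le_norm_sin_sq (δ / 2)
  rw [h1, norm_mul, norm_pow, Complex.norm_ofNat, sq_abs]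
  have h3 : (δ / 2).im = δ.im / 2 := by simp
  rw [h3] at h2
  nlinarith

theorem norm_chebU_one_sub_le (ζ : ℂ) (t : ℕ) :
    ‖(Polynomial.Chebyshev.U ℂ (t : ℤ)).eval (1 - ζ)‖
      ≤ (t + 1) * Real.exp (t * Real.sqrt (2 * ‖ζ‖)) := by
  obtain ⟨δ, hδ⟩ := Complex.cos_surjective (1 - ζ)
  rw [← hδ]
  refine (norm_chebU_cos_le δ t).trans ?_
  have := abs_im_le_of_cos_eq hδ
  gcongr

theorem norm_jacobiScaled_le (k t : ℕ) (ζ : ℂ) :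
    ‖jacobiScaled k t (-1 + ζ)‖ ≤ 4 * (t + 1) * Real.exp (t * Real.sqrt (2 * ‖ζ‖)) := by
  have h0 := norm_chebU_one_sub_le ζ t
  have h1 : ‖(Polynomial.Chebyshev.U ℂ ((t : ℤ) - 1)).eval (1 - ζ)‖
      ≤ (t + 1) * Real.exp (t * Real.sqrt (2 * ‖ζ‖)) := by
    rcases t with _ | t
    · simp
    · push_cast
      rw [add_sub_cancel_right]
      refine (norm_chebU_one_sub_le ζ t).trans ?_
      gcongr <;> linarith
  have hc1 : (2 : ℝ) ^ (-1 / 2 : ℝ) ≤ 2 := by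
    calc (2 : ℝ) ^ (-1 / 2 : ℝ) ≤ 2 ^ (1 : ℝ) :=
          Real.rpow_le_rpow_of_exponent_le (by norm_num) (by norm_num)
      _ = 2 := by simp
  have hc2 : (2 : ℝ) ^ (1 / 2 : ℝ) ≤ 2 := by
    calc (2 : ℝ) ^ (1 / 2 : ℝ) ≤ 2 ^ (1 : ℝ) :=
          Real.rpow_le_rpow_of_exponent_le (by norm_num) (by norm_num)
      _ = 2 := by simp
  have e : -1 + ζ = -(1 - ζ) := by ring
  rw [e]
  set B := (t + 1) * Real.exp (t * Real.sqrt (2 * ‖ζ‖)) with hB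
  have hB0 : 0 ≤ B := by positivity
  by_cases hk : Odd k
  · rw [jacobiScaled_neg_odd hk, norm_mul, Complex.norm_real, Real.norm_of_nonneg (by positivity)]
    calc _ ≤ 2 * (B + B) := by
          gcongr
          exact (norm_add_le _ _).trans (add_le_add h0 h1)
      _ = _ := by rw [hB]; ring
  · rw [jacobiScaled_neg_even hk, norm_mul, Complex.norm_real, Real.norm_of_nonneg (by positivity)]
    calc _ ≤ 2 * B := by gcongr
      _ ≤ 4 * B := by linarith
      _ = _ := by rw [hB]; ring

/-- A local solution `δ` of `cos δ = 1 - 2 σ²`. -/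
theorem exists_local_arcsin : ∃ g : ℂ → ℂ, (∀ᶠ z in 𝓝 0, Complex.sin (g z) = z) ∧
    HasDerivAt g 1 0 ∧ g 0 = 0 := by
  have h : HasStrictDerivAt Complex.sin (Complex.cos 0) 0 := Complex.hasStrictDerivAt_sin 0
  rw [Complex.cos_zero] at h
  refine ⟨h.localInverse Complex.sin 1 0 one_ne_zero, ?_, ?_, ?_⟩
  · have := h.eventually_right_inverse (one_ne_zero)
    rwa [Complex.sin_zero] at this
  · have := (h.to_localInverse (one_ne_zero)).hasDerivAt
    rwa [Complex.sin_zero, inv_one] at this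
  · have := (h.hasStrictFDerivAt_equiv one_ne_zero).localInverse_apply_image
    rwa [Complex.sin_zero] at this

/-- Hilb-type asymptotics of the Chebyshev polynomials at the edge. -/
theorem tendsto_chebU_edge {ι : Type*} {l : Filter ι} {L : ι → ℝ} {n : ι → ℤ} {ζ : ι → ℂ}
    {ν : ℝ} {w : ℂ} (hw : w ≠ 0) (hL : Tendsto L l atTop)
    (hn : Tendsto (fun i => (n i : ℝ) / L i) l (𝓝 ν))
    (hζ : Tendsto (fun i => ((L i : ℂ) ^ 2) * ζ i) l (𝓝 (w ^ 2))) :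
    Tendsto (fun i => (Polynomial.Chebyshev.U ℂ (n i)).eval (1 - ζ i) / (L i : ℂ)) l
      (𝓝 (Complex.sin (ν * (Real.sqrt 2 * w)) / (Real.sqrt 2 * w))) := by
  obtain ⟨g, hg1, hg2, hg0⟩ := exists_local_arcsin
  have hLpos : ∀ᶠ i in l, 0 < L i := hL.eventually_gt_atTop 0
  set a : ℂ := Real.sqrt 2 * w with ha
  have hs2 : ((Real.sqrt 2 : ℝ) : ℂ) ^ 2 = 2 := by
    rw [← Complex.ofReal_pow, Real.sq_sqrt (by norm_num)]; norm_num
  have ha2 : a ^ 2 = 2 * w ^ 2 := by rw [ha, mul_pow, hs2]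
  have ha0 : a ≠ 0 := by
    intro h; rw [h] at ha2; simp at ha2; exact hw ha2
  -- a square root of `ζ / 2`
  set q : ι → ℂ := fun i => (((L i : ℂ) ^ 2) * ζ i / w ^ 2) ^ (1 / 2 : ℂ) with hq
  have hq1 : Tendsto q l (𝓝 1) := by
    have h1 : Tendsto (fun i => ((L i : ℂ) ^ 2) * ζ i / w ^ 2) l (𝓝 1) := by
      have := hζ.div_const (w ^ 2)
      rwa [div_self (pow_ne_zero 2 hw)] at this
    have h2 : ContinuousAt (fun z : ℂ => z ^ (1 / 2 : ℂ)) 1 :=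
      continuousAt_cpow_const (by simp [Complex.one_mem_slitPlane])
    have := h2.tendsto.comp h1
    rw [Complex.one_cpow] at this
    exact this
  have hq2 : ∀ i, q i ^ 2 = ((L i : ℂ) ^ 2) * ζ i / w ^ 2 := by
    intro i
    rw [hq]; simp only
    rw [← Complex.cpow_nat_mul]; simp
  -- `σ` plays the role of `sin(δ/2)`, so `2σ²` must be `ζ`. Since `q → 1`, the principal root is
  -- taken away from its cut and `σ` follows the branch selected by `w`.
  set σ : ι → ℂ := fun i => a / (2 * L i) * q i with hσ
  have hσ2 : ∀ᶠ i in l, 2 * σ i ^ 2 = ζ i := by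
    filter_upwards [hLpos] with i hi
    have : (L i : ℂ) ≠ 0 := by exact_mod_cast hi.ne'
    rw [hσ]; simp only
    rw [mul_pow, hq2, div_pow, ha2]
    field_simp
  have hLinv : Tendsto (fun i => ((L i : ℂ))⁻¹) l (𝓝 0) := by
    have := (Complex.continuous_ofReal.tendsto 0).comp (tendsto_inv_atTop_zero.comp hL)
    simpa [Function.comp_def] using this
  have hLσ : Tendsto (fun i => (L i : ℂ) * σ i) l (𝓝 (a / 2)) := by
    have h1 : Tendsto (fun i => a / 2 * q i) l (𝓝 (a / 2)) := by
      simpa using hq1.const_mul (a / 2)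
    refine h1.congr' ?_
    filter_upwards [hLpos] with i hi
    have : (L i : ℂ) ≠ 0 := by exact_mod_cast hi.ne'
    rw [hσ]; simp only
    field_simp
  have hσ0 : Tendsto σ l (𝓝 0) := by
    have := hLinv.mul hLσ
    rw [zero_mul] at this
    refine this.congr' ?_
    filter_upwards [hLpos] with i hi
    have : (L i : ℂ) ≠ 0 := by exact_mod_cast hi.ne'
    field_simp
  have hσne : ∀ᶠ i in l, σ i ≠ 0 := by
    filter_upwards [hLσ.eventually_ne (div_ne_zero ha0 two_ne_zero)] with i hi h
    apply hi; rw [h, mul_zero]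
  -- derivative at zero as a limit of quotients
  have quot : ∀ {f : ℂ → ℂ}, HasDerivAt f 1 0 → f 0 = 0 → ∀ {b : ι → ℂ}, Tendsto b l (𝓝 0) →
      (∀ᶠ i in l, b i ≠ 0) → Tendsto (fun i => f (b i) / b i) l (𝓝 1) := by
    intro f hf hf0 b hb hbne
    have h1 := hasDerivAt_iff_tendsto_slope.1 hf
    have h2 : Tendsto b l (𝓝[≠] 0) := tendsto_nhdsWithin_iff.2 ⟨hb, hbne⟩
    refine (h1.comp h2).congr ?_
    intro i
    simp [slope_def_field, hf0]
  have hgσ := quot hg2 hg0 hσ0 hσne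
  set δ : ι → ℂ := fun i => 2 * g (σ i) with hδ
  have hLδ : Tendsto (fun i => (L i : ℂ) * δ i) l (𝓝 a) := by
    have h1 := (hLσ.mul hgσ).const_mul 2
    rw [mul_one, mul_div_cancel₀ _ two_ne_zero] at h1
    refine h1.congr' ?_
    filter_upwards [hσne] with i hi
    rw [hδ]; simp only
    field_simp
  have hδ0 : Tendsto δ l (𝓝 0) := by
    have := hLinv.mul hLδ
    rw [zero_mul] at this
    refine this.congr' ?_
    filter_upwards [hLpos] with i hi
    have : (L i : ℂ) ≠ 0 := by exact_mod_cast hi.ne'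
    field_simp
  have hδne : ∀ᶠ i in l, δ i ≠ 0 := by
    filter_upwards [hLδ.eventually_ne ha0] with i hi h
    apply hi; rw [h, mul_zero]
  have hsin : HasDerivAt Complex.sin 1 0 := by simpa using Complex.hasDerivAt_sin 0
  have hsδ := quot hsin Complex.sin_zero hδ0 hδne
  have hLs : Tendsto (fun i => (L i : ℂ) * Complex.sin (δ i)) l (𝓝 a) := by
    have := hLδ.mul hsδ
    rw [mul_one] at this
    refine this.congr' ?_
    filter_upwards [hδne] with i hi
    field_simp
  have hcos : ∀ᶠ i in l, Complex.cos (δ i) = 1 - ζ i := by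
    filter_upwards [hσ2, hσ0.eventually hg1] with i h1 h2
    have := one_sub_cos_eq (δ i)
    rw [hδ] at this; simp only at this
    rw [mul_div_cancel_left₀ _ two_ne_zero, h2, h1] at this
    rw [hδ]; simp only
    linear_combination -this
  have hnC : Tendsto (fun i => ((n i : ℂ)) / (L i : ℂ)) l (𝓝 (ν : ℂ)) := by
    have := (Complex.continuous_ofReal.tendsto ν).comp hn
    simpa [Function.comp_def] using this
  have harg : Tendsto (fun i => ((n i : ℂ) + 1) * δ i) l (𝓝 (ν * a)) := by
    have h1 := (hnC.add hLinv).mul hLδ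
    rw [add_zero] at h1
    refine h1.congr' ?_
    filter_upwards [hLpos] with i hi
    have : (L i : ℂ) ≠ 0 := by exact_mod_cast hi.ne'
    field_simp
  have hfin := ((Complex.continuous_sin.tendsto _).comp harg).div hLs ha0
  refine hfin.congr' ?_
  filter_upwards [hcos, hLs.eventually_ne ha0] with i h1 h2
  have h3 := Polynomial.Chebyshev.U_complex_cos (δ i) (n i)
  have h4 : Complex.sin (δ i) ≠ 0 := fun h => h2 (by rw [h, mul_zero])
  have h5 : (L i : ℂ) ≠ 0 := fun h => h2 (by rw [h, zero_mul])
  simp only [Function.comp, Pi.div_apply]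
  rw [← h1, ← h3]
  field_simp

theorem tendsto_jacobiScaled_edge {ι : Type*} {l : Filter ι} {L : ι → ℝ} {k t : ι → ℕ}
    {ζ : ι → ℂ} {ν : ℝ} {w : ℂ} (hw : w ≠ 0) (hL : Tendsto L l atTop)
    (hn : Tendsto (fun i => (t i : ℝ) / L i) l (𝓝 ν))
    (hζ : Tendsto (fun i => ((L i : ℂ) ^ 2) * ζ i) l (𝓝 (w ^ 2))) :
    Tendsto (fun i => jacobiScaled (k i) (t i) (-1 + ζ i) / (L i : ℂ)) l
      (𝓝 (Complex.sin (ν * (Real.sqrt 2 * w)) / w)) := by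
  have h1 := tendsto_chebU_edge (n := fun i => (t i : ℤ)) hw hL (by simpa using hn) hζ
  have hn2 : Tendsto (fun i => (((t i : ℤ) - 1 : ℤ) : ℝ) / L i) l (𝓝 ν) := by
    have := hn.sub (tendsto_inv_atTop_zero.comp hL)
    rw [sub_zero] at this
    refine this.congr fun i => ?_
    simp only [Function.comp]
    push_cast
    ring
  have h2 := tendsto_chebU_edge (n := fun i => (t i : ℤ) - 1) hw hL hn2 hζ
  set S := Complex.sin (ν * (Real.sqrt 2 * w)) / (Real.sqrt 2 * w) with hS
  have hs0 : ((Real.sqrt 2 : ℝ) : ℂ) ≠ 0 := by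
    simp
  have hsq : ((Real.sqrt 2 : ℝ) : ℂ) * ((Real.sqrt 2 : ℝ) : ℂ) = 2 := by
    rw [← Complex.ofReal_mul, Real.mul_self_sqrt (by norm_num)]; norm_num
  have hSw : Complex.sin (ν * (Real.sqrt 2 * w)) / w = Real.sqrt 2 * S := by
    rw [hS]; field_simp
  rw [hSw]
  have hc2 : (2 : ℝ) ^ (1 / 2 : ℝ) = Real.sqrt 2 := (Real.sqrt_eq_rpow 2).symm
  have hc1 : (2 : ℝ) ^ (-1 / 2 : ℝ) = (Real.sqrt 2)⁻¹ := by
    rw [← hc2, ← Real.rpow_neg (by norm_num)]; norm_num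
  have hodd : Tendsto (fun i => (((2 : ℝ) ^ (-1 / 2 : ℝ) : ℝ) : ℂ) *
      ((Polynomial.Chebyshev.U ℂ (t i : ℤ)).eval (1 - ζ i) / (L i : ℂ)
        + (Polynomial.Chebyshev.U ℂ ((t i : ℤ) - 1)).eval (1 - ζ i) / (L i : ℂ))) l
      (𝓝 (Real.sqrt 2 * S)) := by
    have := (h1.add h2).const_mul (((2 : ℝ) ^ (-1 / 2 : ℝ) : ℝ) : ℂ)
    convert this using 2
    rw [hc1]; push_cast
    field_simp
    linear_combination S * hsq
  have heven : Tendsto (fun i => (((2 : ℝ) ^ (1 / 2 : ℝ) : ℝ) : ℂ) *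
      ((Polynomial.Chebyshev.U ℂ (t i : ℤ)).eval (1 - ζ i) / (L i : ℂ))) l
      (𝓝 (Real.sqrt 2 * S)) := by
    rw [hc2]
    exact h1.const_mul _
  classical
  -- The parity of `k i` may vary with `i`; this is harmless because both branches have the same
  -- limit.
  have := Tendsto.if' (p := fun i => Odd (k i)) hodd heven
  refine this.congr fun i => ?_
  have e : -1 + ζ i = -(1 - ζ i) := by ring
  rw [e]
  split_ifs with h
  · rw [jacobiScaled_neg_odd h]; ring
  · rw [jacobiScaled_neg_even h]; ring

/-! ### The phase: Gaussian bounds on both paths and the expansion at the critical point. -/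

theorem mul_log_one_sub_sub_log_le {κ p : ℝ} (hκ0 : 0 ≤ κ) (hκ1 : κ ≤ 1) (hp0 : 0 ≤ p)
    (hp1 : p < 1) :
    κ * Real.log (1 - p) - Real.log (1 - κ * p) ≤ -(κ * (1 - κ) * p ^ 2 / 2) := by
  have h1 := (Real.hasSum_pow_div_log_of_abs_lt_one
    (x := p) (by rw [abs_of_nonneg hp0]; exact hp1)).mul_left κ
  have hκp : κ * p < 1 := by nlinarith
  have h2 := Real.hasSum_pow_div_log_of_abs_lt_one
    (x := κ * p) (by rw [abs_of_nonneg (by positivity)]; exact hκp)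
  have h3 := h1.sub h2
  -- In the power series every term `(κ - κ^{j+1}) p^{j+1}/(j+1)` is nonnegative, so the quadratic
  -- one, which has index `1`, is a lower bound for the sum.
  have h4 := le_hasSum h3 1 (fun j _ => by
    rw [mul_pow, ← mul_div_assoc, ← sub_div]
    apply div_nonneg _ (by positivity)
    have : κ ^ (j + 1) ≤ κ := by
      rw [pow_succ]
      exact mul_le_of_le_one_left hκ0 (pow_le_one₀ hκ0 hκ1)
    nlinarith [pow_nonneg hp0 (j + 1)])
  norm_num at h4
  nlinarith

/-- Gaussian bound for the real phase. -/
theorem rpow_mul_inv_pow_le {κ p ρ : ℝ} (hκ0 : 0 < κ) (hκ1 : κ < 1) (hp0 : 0 ≤ p)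
    (hp1 : p < 1) (hρ : 0 ≤ ρ) (T : ℕ) :
    (1 - p) ^ ρ / (1 - κ * p) ^ T
      ≤ Real.exp (-(ρ * (1 - κ) * p ^ 2 / 2) + |ρ - κ * T| * p / (1 - κ)) := by
  have hκp : κ * p < 1 := by nlinarith
  have h1 : 0 < 1 - p := by linarith
  have h2 : 0 < 1 - κ * p := by linarith
  have hk : 0 < 1 - κ := by linarith
  have e : (1 - p) ^ ρ / (1 - κ * p) ^ T
      = Real.exp (ρ * Real.log (1 - p) - T * Real.log (1 - κ * p)) := by
    rw [Real.exp_sub, Real.rpow_def_of_pos h1, mul_comm ρ, ← Real.log_pow,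
      Real.exp_log (by positivity)]
  rw [e]
  apply Real.exp_le_exp.2
  have hA := mul_log_one_sub_sub_log_le hκ0.le hκ1.le hp0 hp1
  have hlog : |Real.log (1 - κ * p)| ≤ κ * p / (1 - κ) := by
    have h3 : Real.log (1 - κ * p) ≤ 0 := Real.log_nonpos h2.le (by nlinarith)
    rw [abs_of_nonpos h3]
    have h4 := Real.one_sub_inv_le_log_of_pos h2
    have h5 : (1 - κ * p)⁻¹ - 1 ≤ κ * p / (1 - κ) := by
      rw [inv_eq_one_div, div_sub_one h2.ne', div_le_div_iff₀ h2 hk]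
      have : κ * p * (1 - κ) ≤ κ * p * (1 - κ * p) := by
        apply mul_le_mul_of_nonneg_left _ (by positivity)
        nlinarith
      linarith
    linarith
  -- The critical value `ρ = κT` is split off: the first part carries the quadratic decay, the
  -- second is linear in the deviation `ρ - κT`.
  have e2 : ρ * Real.log (1 - p) - T * Real.log (1 - κ * p)
      = ρ / κ * (κ * Real.log (1 - p) - Real.log (1 - κ * p))
        + (ρ - κ * T) / κ * Real.log (1 - κ * p) := by
    field_simp; ring
  rw [e2]
  have h6 : ρ / κ * (κ * Real.log (1 - p) - Real.log (1 - κ * p))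
      ≤ -(ρ * (1 - κ) * p ^ 2 / 2) := by
    calc _ ≤ ρ / κ * (-(κ * (1 - κ) * p ^ 2 / 2)) := by gcongr
      _ = _ := by field_simp
  have h7 : (ρ - κ * T) / κ * Real.log (1 - κ * p) ≤ |ρ - κ * T| * p / (1 - κ) := by
    calc _ ≤ |(ρ - κ * T) / κ * Real.log (1 - κ * p)| := le_abs_self _
      _ = |ρ - κ * T| / κ * |Real.log (1 - κ * p)| := by
        rw [abs_mul, abs_div, abs_of_pos hκ0]
      _ ≤ |ρ - κ * T| / κ * (κ * p / (1 - κ)) := by gcongr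
      _ = _ := by field_simp
  linarith

/-- Gaussian bound for the phase on the circle. -/
theorem norm_one_add_mul_exp_sub_one_pow_le {κ ψ : ℝ} (hκ0 : 0 ≤ κ) (hκ1 : κ ≤ 1)
    (hψ : |ψ| ≤ Real.pi) (T : ℕ) :
    ‖(1 + (κ : ℂ) * (Complex.exp (ψ * Complex.I) - 1)) ^ T‖
      ≤ Real.exp (-(2 * κ * (1 - κ) * T * ψ ^ 2 / Real.pi ^ 2)) := by
  set v : ℂ := 1 + (κ : ℂ) * (Complex.exp (ψ * Complex.I) - 1) with hv
  have h1 : ‖v‖ ^ 2 = 1 - 2 * κ * (1 - κ) * (1 - Real.cos ψ) := by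
    rw [← Complex.normSq_eq_norm_sq, Complex.normSq_apply]
    have e1 : v.re = 1 + κ * (Real.cos ψ - 1) := by
      rw [hv, Complex.exp_mul_I, ← Complex.ofReal_cos, ← Complex.ofReal_sin]
      simp [-Complex.ofReal_cos, -Complex.ofReal_sin]
    have e2 : v.im = κ * Real.sin ψ := by
      rw [hv, Complex.exp_mul_I, ← Complex.ofReal_cos, ← Complex.ofReal_sin]
      simp [-Complex.ofReal_cos, -Complex.ofReal_sin]
    rw [e1, e2]
    linear_combination κ ^ 2 * Real.sin_sq_add_cos_sq ψ
  have h2 := Real.cos_le_one_sub_mul_cos_sq hψ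
  have hκκ : 0 ≤ κ * (1 - κ) := mul_nonneg hκ0 (by linarith)
  have h3 : ‖v‖ ≤ Real.exp (-(2 * κ * (1 - κ) * ψ ^ 2 / Real.pi ^ 2)) := by
    apply le_of_sq_le_sq _ (Real.exp_pos _).le
    rw [h1, ← Real.exp_nat_mul]
    have h4 := Real.add_one_le_exp (((2 : ℕ) : ℝ) * -(2 * κ * (1 - κ) * ψ ^ 2 / Real.pi ^ 2))
    have h5 : 2 * κ * (1 - κ) * (2 / Real.pi ^ 2 * ψ ^ 2)
      ≤ 2 * κ * (1 - κ) * (1 - Real.cos ψ) := by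
      apply mul_le_mul_of_nonneg_left _ (by linarith)
      linarith
    refine le_trans ?_ h4
    push_cast
    have : 2 * -(2 * κ * (1 - κ) * ψ ^ 2 / Real.pi ^ 2)
      = -(2 * κ * (1 - κ) * (2 / Real.pi ^ 2 * ψ ^ 2)) := by ring
    rw [this]; linarith
  rw [norm_pow]
  calc ‖v‖ ^ T ≤ (Real.exp (-(2 * κ * (1 - κ) * ψ ^ 2 / Real.pi ^ 2))) ^ T := by gcongr
    _ = _ := by rw [← Real.exp_nat_mul]; ring_nf

/-- Lower bound for the distance between the circle and the interval. -/
theorem sqrt_le_norm_exp_sub {p ψ : ℝ} (hp0 : 0 ≤ p) (hp1 : p ≤ 1) (hψ : |ψ| ≤ Real.pi) :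
    Real.sqrt (p * |ψ| / 8) ≤ ‖Complex.exp (ψ * Complex.I) - (1 - p)‖ := by
  apply Real.sqrt_le_iff.2 ⟨norm_nonneg _, ?_⟩
  have h1 : ‖Complex.exp (ψ * Complex.I) - (1 - p)‖ ^ 2 = p ^ 2 + 2 * (1 - p) * (1 - Real.cos ψ) := by
    rw [← Complex.normSq_eq_norm_sq, Complex.normSq_apply]
    have e1 : (Complex.exp (ψ * Complex.I) - (1 - p)).re = Real.cos ψ - (1 - p) := by
      rw [Complex.exp_mul_I, ← Complex.ofReal_cos, ← Complex.ofReal_sin]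
      simp [-Complex.ofReal_cos, -Complex.ofReal_sin]
    have e2 : (Complex.exp (ψ * Complex.I) - (1 - p)).im = Real.sin ψ := by
      rw [Complex.exp_mul_I, ← Complex.ofReal_cos, ← Complex.ofReal_sin]
      simp [-Complex.ofReal_cos, -Complex.ofReal_sin]
    rw [e1, e2]
    linear_combination Real.sin_sq_add_cos_sq ψ
  rw [h1]
  have h2 := Real.cos_le_one_sub_mul_cos_sq hψ
  have hpi : Real.pi ^ 2 ≤ 10 := by nlinarith [Real.pi_lt_d2, Real.pi_pos]
  have hψ4 : |ψ| ≤ 4 := hψ.trans Real.pi_le_four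
  have h3 : ψ ^ 2 / 5 ≤ 1 - Real.cos ψ := by
    have : ψ ^ 2 / 5 ≤ 2 / Real.pi ^ 2 * ψ ^ 2 := by
      rw [div_mul_eq_mul_div, div_le_div_iff₀ (by norm_num) (by positivity)]
      nlinarith [sq_nonneg ψ]
    linarith
  have h4 : 2 * (1 - p) * (ψ ^ 2 / 5) ≤ 2 * (1 - p) * (1 - Real.cos ψ) := by
    apply mul_le_mul_of_nonneg_left h3; linarith
  have h5 : |ψ| ^ 2 = ψ ^ 2 := sq_abs ψ
  have h6 := abs_nonneg ψ
  -- For `p ≤ 1/2` the square is at least `p² + ψ²/5`, and the arithmetic-geometric mean inequality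
  -- suffices. For `p ≥ 1/2` already `p² ≥ p/2 ≥ p|ψ|/8`, as `|ψ| ≤ 4`.
  rcases le_total p (1 / 2) with h | h
  · nlinarith [sq_nonneg (p - |ψ| / 4), mul_nonneg (by linarith : (0 : ℝ) ≤ 1 / 2 - p) (sq_nonneg ψ)]
  · nlinarith [mul_nonneg hp0 (by linarith : (0:ℝ) ≤ 4 - |ψ|), mul_nonneg (by linarith : (0:ℝ) ≤ 1 - p) (sq_nonneg ψ)]

theorem tendsto_log_remainder :
    Tendsto (fun z : ℂ => (Complex.log (1 + z) - z + z ^ 2 / 2) / z ^ 2) (𝓝 0) (𝓝 0) := by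
  have h1 := Complex.log_sub_logTaylor_isBigO 2
  have h2 : (fun z : ℂ => z ^ (2 + 1)) =o[𝓝 0] fun z : ℂ => z ^ 2 :=
    Asymptotics.isLittleO_pow_pow (by norm_num)
  have h3 := (h1.trans_isLittleO h2).tendsto_div_nhds_zero
  refine h3.congr fun z => ?_
  simp [Complex.logTaylor_succ, Complex.logTaylor_zero]
  ring

/-- Second order expansion of the phase at the critical point. -/
theorem tendsto_phase {ι : Type*} {l : Filter ι} {L T ρ : ι → ℝ} {z : ι → ℂ} {κ η : ℝ} {Z : ℂ}
    (hκ : κ * (1 - κ) ≠ 0) (hL : Tendsto L l atTop)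
    (hT : Tendsto (fun i => κ * (1 - κ) * T i / L i ^ 4) l (𝓝 1))
    (hρ : Tendsto (fun i => (ρ i - κ * T i) / L i ^ 2) l (𝓝 η))
    (hz : Tendsto (fun i => (L i : ℂ) ^ 2 * z i) l (𝓝 Z)) :
    Tendsto (fun i => (T i : ℂ) * Complex.log (1 + κ * z i) - (ρ i : ℂ) * Complex.log (1 + z i)) l
      (𝓝 (Z ^ 2 / 2 - η * Z)) := by
  have hLpos : ∀ᶠ i in l, 0 < L i := hL.eventually_gt_atTop 0
  have hLinv : Tendsto (fun i => ((L i : ℂ) ^ 2)⁻¹) l (𝓝 0) := by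
    have := (Complex.continuous_ofReal.tendsto 0).comp (tendsto_inv_atTop_zero.comp hL)
    have := this.pow 2
    simpa [Function.comp_def] using this
  have hz0 : Tendsto z l (𝓝 0) := by
    have := hLinv.mul hz
    rw [zero_mul] at this
    refine this.congr' ?_
    filter_upwards [hLpos] with i hi
    have : (L i : ℂ) ≠ 0 := by exact_mod_cast hi.ne'
    field_simp
  have hκz0 : Tendsto (fun i => (κ : ℂ) * z i) l (𝓝 0) := by
    simpa using hz0.const_mul (κ : ℂ)
  have hTC : Tendsto (fun i => (κ * (1 - κ) * T i / L i ^ 4 : ℂ)) l (𝓝 1) := by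
    have := (Complex.continuous_ofReal.tendsto 1).comp hT
    simpa [Function.comp_def] using this
  have hρC : Tendsto (fun i => ((ρ i - κ * T i) / L i ^ 2 : ℂ)) l (𝓝 η) := by
    have := (Complex.continuous_ofReal.tendsto η).comp hρ
    simpa [Function.comp_def] using this
  set R : ℂ → ℂ := fun z => (Complex.log (1 + z) - z + z ^ 2 / 2) / z ^ 2 with hR
  have hlog : ∀ z, Complex.log (1 + z) = z - z ^ 2 / 2 + z ^ 2 * R z := by
    intro z
    rw [hR]; simp only
    by_cases h : z = 0
    · simp [h]
    · field_simp; ring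
  have hR1 := tendsto_log_remainder.comp hz0
  have hR2 := tendsto_log_remainder.comp hκz0
  have hκC : (κ : ℂ) * (1 - κ) ≠ 0 := by exact_mod_cast hκ
  have hκ0 : (κ : ℂ) ≠ 0 := left_ne_zero_of_mul hκC
  have hκ1 : (1 - κ : ℂ) ≠ 0 := right_ne_zero_of_mul hκC
  -- `Tz` and `ρz` may diverge separately, so the terms are regrouped first. The linear part is
  -- `-(ρ-κT)z`; the quadratic part is `(ρ-κ²T)z²/2` with `ρ-κ²T = κ(1-κ)T + (ρ-κT)`, whose second
  -- summand gains a factor `z → 0`. The remainders are bounded quantities times `R → 0`.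
  have key := (((((hTC.mul (hz.pow 2)).mul hR2).const_mul ((κ : ℂ) / (1 - κ))).sub
    ((((hTC.mul (hz.pow 2)).mul hR1).const_mul ((1 : ℂ) / (1 - κ))).add
      (((hρC.mul hz).mul hz0).mul hR1))).sub (hρC.mul hz)).add
      ((((hρC.mul hz).mul hz0).add (hTC.mul (hz.pow 2))).div_const 2)
  refine (key.congr' ?_).trans (le_of_eq ?_)
  · filter_upwards [hLpos] with i hi
    have : (L i : ℂ) ≠ 0 := by exact_mod_cast hi.ne'
    rw [hlog (z i), hlog (κ * z i)]
    simp only [Function.comp]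
    change _ = (T i : ℂ) * (κ * z i - (κ * z i) ^ 2 / 2 + (κ * z i) ^ 2 * R (κ * z i))
      - (ρ i : ℂ) * (z i - (z i) ^ 2 / 2 + (z i) ^ 2 * R (z i))
    change (κ : ℂ) / (1 - κ) * (κ * (1 - κ) * T i / L i ^ 4 * (L i ^ 2 * z i) ^ 2 * R (κ * z i))
      - (1 / (1 - κ) * (κ * (1 - κ) * T i / L i ^ 4 * (L i ^ 2 * z i) ^ 2 * R (z i))
      + (ρ i - κ * T i) / L i ^ 2 * (L i ^ 2 * z i) * z i * R (z i))
      - (ρ i - κ * T i) / L i ^ 2 * (L i ^ 2 * z i)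
      + ((ρ i - κ * T i) / L i ^ 2 * (L i ^ 2 * z i) * z i
      + κ * (1 - κ) * T i / L i ^ 4 * (L i ^ 2 * z i) ^ 2) / 2 = _
    field_simp
    ring
  · congr 1
    ring

theorem neg_mul_sq_add_mul_le {δ M : ℝ} (hδ : 0 < δ) (X : ℝ) :
    -(δ * X ^ 2) + M * X ≤ -(δ / 2 * X ^ 2) + M ^ 2 / (2 * δ) := by
  have : M ^ 2 / (2 * δ) = -(δ / 2 * X ^ 2) + M * X + (δ * X - M) ^ 2 / (2 * δ) := by
    field_simp; ring
  have h2 : 0 ≤ (δ * X - M) ^ 2 / (2 * δ) := by positivity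
  linarith

theorem integrable_abs_rpow_mul_exp {δ : ℝ} (hδ : 0 < δ) :
    Integrable fun y : ℝ => |y| ^ (-1 / 2 : ℝ) * Real.exp (-δ * y ^ 2) := by
  have h1 := integrable_rpow_mul_exp_neg_mul_sq hδ (s := -1 / 2) (by norm_num)
  have h2 := h1.add h1.comp_neg
  refine h2.congr (Eventually.of_forall fun y => ?_)
  -- A real power of a negative base carries the factor `cos(-π/2) = 0`, so the function and its
  -- reflection live on opposite half-lines and add up to the even function.
  have hcos : Real.cos (-1 / 2 * Real.pi) = 0 := by
    rw [show -1 / 2 * Real.pi = -(Real.pi / 2) by ring, Real.cos_neg, Real.cos_pi_div_two]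
  simp only [Pi.add_apply, neg_sq]
  rw [← add_mul]
  congr 1
  rcases lt_trichotomy y 0 with h | h | h
  · rw [Real.rpow_def_of_neg h, hcos, abs_of_neg h, mul_zero, zero_add]
  · subst h; norm_num
  · rw [Real.rpow_def_of_neg (x := -y) (by linarith), hcos, abs_of_pos h, mul_zero, add_zero]

/-! ### The single integral in trigonometric form. -/

/-- The frequency of the sine in the trigonometric form of the Jacobi polynomials. -/
def sineFreq (k s : ℕ) : ℝ := s + if Odd k then 1 / 2 else 1

/-- On odd levels, sum-to-product cancels the `cos(δ/2)` in `sin δ`; on even levels it stays in the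
denominator. The exponent `-(a_k + 1/2)`, equal to `0` or `-1`, records this. -/
theorem jacobiScaled_neg_cos (k s : ℕ) {δ : ℝ} (h0 : 0 < δ) (h1 : δ < Real.pi) :
    jacobiScaled k s (-((Real.cos δ : ℝ) : ℂ)) =
      (((Real.sqrt 2)⁻¹ * Real.sin (sineFreq k s * δ) *
        Real.cos (δ / 2) ^ (-(aIdx k + 1 / 2)) / Real.sin (δ / 2) : ℝ) : ℂ) := by
  have hS : 0 < Real.sin (δ / 2) := Real.sin_pos_of_pos_of_lt_pi (by linarith) (by linarith)
  have hC : 0 < Real.cos (δ / 2) :=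
    Real.cos_pos_of_mem_Ioo ⟨by linarith, by linarith⟩
  have hsin : Real.sin δ = 2 * Real.sin (δ / 2) * Real.cos (δ / 2) := by
    rw [← Real.sin_two_mul]; congr 1; ring
  have hsinC : (Real.sin δ : ℂ) = 2 * Real.sin (δ / 2) * Real.cos (δ / 2) := by
    rw [hsin]; push_cast; ring
  have hSC : ((Real.sin (δ / 2) : ℝ) : ℂ) ≠ 0 := by exact_mod_cast hS.ne'
  have hCC : ((Real.cos (δ / 2) : ℝ) : ℂ) ≠ 0 := by exact_mod_cast hC.ne'
  have hs0 : ((Real.sqrt 2 : ℝ) : ℂ) ≠ 0 := by simp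
  have hsq : ((Real.sqrt 2 : ℝ) : ℂ) ^ 2 = 2 := by
    rw [← Complex.ofReal_pow, Real.sq_sqrt (by norm_num)]; norm_num
  have hc2 : (2 : ℝ) ^ (1 / 2 : ℝ) = Real.sqrt 2 := (Real.sqrt_eq_rpow 2).symm
  have hc1 : (2 : ℝ) ^ (-1 / 2 : ℝ) = (Real.sqrt 2)⁻¹ := by
    rw [← hc2, ← Real.rpow_neg (by norm_num)]; norm_num
  have hU := Polynomial.Chebyshev.U_complex_cos (δ : ℂ) (s : ℤ)
  have hU' := Polynomial.Chebyshev.U_complex_cos (δ : ℂ) ((s : ℤ) - 1)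
  rw [← Complex.ofReal_cos, ← Complex.ofReal_sin, hsinC] at hU hU'
  by_cases hk : Odd k
  · rw [jacobiScaled_neg_odd hk, hc1]
    simp only [sineFreq, aIdx, if_pos hk]
    have e0 : -(-1 / 2 + 1 / 2 : ℝ) = 0 := by norm_num
    rw [e0, Real.rpow_zero]
    have hsum : Real.sin ((s + 1) * δ) + Real.sin (s * δ)
        = 2 * Real.sin ((s + 1 / 2) * δ) * Real.cos (δ / 2) := by
      have e1 : (s + 1) * δ = (s + 1 / 2) * δ + δ / 2 := by ring
      have e2 : (s : ℝ) * δ = (s + 1 / 2) * δ - δ / 2 := by ring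
      rw [e1, e2, Real.sin_add, Real.sin_sub]; ring
    have hsumC : Complex.sin ((((s : ℤ) : ℂ) + 1) * δ) + Complex.sin (((((s : ℤ) - 1 : ℤ) : ℂ) + 1) * δ)
        = 2 * (Real.sin ((s + 1 / 2) * δ) : ℂ) * (Real.cos (δ / 2) : ℂ) := by
      rw [← Complex.ofReal_ofNat, ← Complex.ofReal_mul, ← Complex.ofReal_mul, ← hsum]
      push_cast
      simp
    rw [← hU, ← hU'] at hsumC
    clear hsum
    generalize Real.sin ((s + 1 / 2) * δ) = W at *
    push_cast [-Complex.ofReal_sin, -Complex.ofReal_cos] at hsumC ⊢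
    field_simp
    apply mul_right_cancel₀ hCC
    linear_combination (1 / 2) * hsumC
  · rw [jacobiScaled_neg_even hk, hc2]
    simp only [sineFreq, aIdx, if_neg hk]
    have e0 : -(1 / 2 + 1 / 2 : ℝ) = -1 := by norm_num
    rw [e0, Real.rpow_neg_one]
    have hsC : Complex.sin ((((s : ℤ) : ℂ) + 1) * δ) = (Real.sin ((s + 1) * δ) : ℂ) := by
      push_cast; ring_nf
    rw [hsC] at hU
    push_cast [-Complex.ofReal_sin, -Complex.ofReal_cos] at hU ⊢
    rw [← hU]
    field_simp
    linear_combination (Polynomial.eval ((Real.cos δ : ℝ) : ℂ) (Polynomial.Chebyshev.U ℂ (s : ℤ))) * hsq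

theorem image_neg_cos_Ioo : (fun δ => -Real.cos δ) '' Ioo 0 Real.pi = Ioo (-1) 1 := by
  ext x
  constructor
  · rintro ⟨δ, ⟨h0, h1⟩, rfl⟩
    have h2 := Real.strictAntiOn_cos ⟨le_rfl, Real.pi_pos.le⟩ ⟨h0.le, h1.le⟩ h0
    have h3 := Real.strictAntiOn_cos ⟨h0.le, h1.le⟩ ⟨Real.pi_pos.le, le_rfl⟩ h1
    rw [Real.cos_zero] at h2
    rw [Real.cos_pi] at h3
    exact ⟨by linarith, by linarith⟩
  · rintro ⟨h0, h1⟩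
    refine ⟨Real.arccos (-x), ⟨Real.arccos_pos.2 (by linarith), ?_⟩, ?_⟩
    · exact (Real.arccos_lt_pi).2 (by linarith)
    · simp only
      rw [Real.cos_arccos (by linarith) (by linarith), neg_neg]

/-- Here `S = sin(δ/2)` and `C = cos(δ/2)`. All powers of `S` cancel, the constants collapse to
`2/π`, and by `level_eq` the exponents of `C` from the Jacobian, weight and polynomials add up to `k
- m`. -/
theorem weight_identity {k m : ℕ} (hkm : m ≤ k) {S C : ℝ} (hS : 0 < S) (hC : 0 < C) (s₁ s₂ : ℝ) :
    (2 : ℝ) ^ ((rIdx m : ℤ) - (rIdx k : ℤ)) * (2 : ℝ) ^ (aIdx m - aIdx k) *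
      ((2 : ℝ) ^ (aIdx k + 1 / 2) / Real.pi) * ((2 * S * C) *
      (((2 : ℝ) ^ (-aIdx k - aIdx m) * (((Real.sqrt 2)⁻¹ * s₁ *
        C ^ (-(aIdx k + 1 / 2)) / S) * ((Real.sqrt 2)⁻¹ * s₂ *
        C ^ (-(aIdx m + 1 / 2)) / S))) *
      ((2 * C ^ 2) ^ ((rIdx k : ℝ) - (rIdx m : ℝ) + aIdx k) * (2 * S ^ 2) ^ (1 / 2 : ℝ))))
      = 2 / Real.pi * (s₁ * s₂ * C ^ (k - m)) := by
  have e1 : (2 * S ^ 2) ^ (1 / 2 : ℝ) = (2 : ℝ) ^ (1 / 2 : ℝ) * S := by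
    rw [Real.mul_rpow (by norm_num) (by positivity), ← Real.sqrt_eq_rpow (S ^ 2),
      Real.sqrt_sq hS.le]
  have e2 : (2 * C ^ 2) ^ ((rIdx k : ℝ) - (rIdx m : ℝ) + aIdx k)
      = (2 : ℝ) ^ ((rIdx k : ℝ) - (rIdx m : ℝ) + aIdx k)
        * C ^ (2 * ((rIdx k : ℝ) - (rIdx m : ℝ) + aIdx k)) := by
    rw [Real.mul_rpow (by norm_num) (by positivity), ← Real.rpow_natCast C 2,
      ← Real.rpow_mul hC.le]
    norm_num
  have e3 : C ^ (k - m) = C ^ (2 * ((rIdx k : ℝ) - (rIdx m : ℝ) + aIdx k)) *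
      C ^ (-(aIdx k + 1 / 2)) * C ^ (-(aIdx m + 1 / 2)) * C := by
    rw [← Real.rpow_natCast C (k - m), Nat.cast_sub hkm, ← Real.rpow_add hC,
      ← Real.rpow_add hC, ← Real.rpow_add_one hC.ne']
    congr 1
    linear_combination level_eq k - level_eq m
  have e4 : (2 : ℝ) ^ ((rIdx m : ℤ) - (rIdx k : ℤ)) = (2 : ℝ) ^ ((rIdx m : ℝ) - (rIdx k : ℝ)) := by
    rw [← Real.rpow_intCast]; push_cast; rfl
  have e5 : (2 : ℝ) ^ ((rIdx m : ℝ) - (rIdx k : ℝ)) * (2 : ℝ) ^ (aIdx m - aIdx k) *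
      (2 : ℝ) ^ (aIdx k + 1 / 2) * (2 : ℝ) ^ (-aIdx k - aIdx m) *
      (2 : ℝ) ^ ((rIdx k : ℝ) - (rIdx m : ℝ) + aIdx k) * (2 : ℝ) ^ (1 / 2 : ℝ) = 2 := by
    rw [← Real.rpow_add (by norm_num), ← Real.rpow_add (by norm_num),
      ← Real.rpow_add (by norm_num), ← Real.rpow_add (by norm_num),
      ← Real.rpow_add (by norm_num)]
    rw [show (rIdx m : ℝ) - rIdx k + (aIdx m - aIdx k) + (aIdx k + 1 / 2) + (-aIdx k - aIdx m)
      + (rIdx k - rIdx m + aIdx k) + 1 / 2 = 1 by ring, Real.rpow_one]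
  have e6 : (Real.sqrt 2)⁻¹ * (Real.sqrt 2)⁻¹ = 1 / 2 := by
    rw [← mul_inv, Real.mul_self_sqrt (by norm_num)]; norm_num
  rw [e1, e2, e3, e4]
  generalize C ^ (2 * ((rIdx k : ℝ) - (rIdx m : ℝ) + aIdx k)) = c1 at *
  generalize C ^ (-(aIdx k + 1 / 2)) = c2 at *
  generalize C ^ (-(aIdx m + 1 / 2)) = c3 at *
  generalize (2 : ℝ) ^ ((rIdx m : ℝ) - (rIdx k : ℝ)) = d1 at *
  generalize (2 : ℝ) ^ (aIdx m - aIdx k) = d2 at *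
  generalize (2 : ℝ) ^ (aIdx k + 1 / 2) = d3 at *
  generalize (2 : ℝ) ^ (-aIdx k - aIdx m) = d4 at *
  generalize (2 : ℝ) ^ ((rIdx k : ℝ) - (rIdx m : ℝ) + aIdx k) = d5 at *
  generalize (2 : ℝ) ^ (1 / 2 : ℝ) = d6 at *
  generalize (Real.sqrt 2)⁻¹ = q at *
  have : d1 * d2 * (d3 / Real.pi) * (2 * S * C * (d4 * (q * s₁ * c2 / S * (q * s₂ * c3 / S)) *
      (d5 * c1 * (d6 * S)))) = (d1 * d2 * d3 * d4 * d5 * d6) * (q * q) *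
        (2 * C * s₁ * s₂ * c1 * c2 * c3) / Real.pi := by
    have hi : S⁻¹ * S = 1 := inv_mul_cancel₀ hS.ne'
    simp only [div_eq_mul_inv]
    linear_combination (2 * d1 * d2 * d3 * d4 * d5 * d6 * C * q * q * s₁ * s₂ * c1 * c2 * c3 *
      Real.pi⁻¹ * (S⁻¹ * S + 1)) * hi
  rw [this, e5, e6]; ring

/-- Trigonometric form of the single integral in the correlation kernel. -/
theorem integral_jacobi_eq_trig {k m : ℕ} (hkm : m ≤ k) (s t : ℕ) :
    (((2 : ℝ) ^ ((rIdx m : ℤ) - (rIdx k : ℤ)) * (-1 : ℝ) ^ ((s : ℤ) - (t : ℤ)) *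
      (2 : ℝ) ^ (aIdx m - aIdx k) : ℝ) : ℂ) *
      ((((2 : ℝ) ^ (aIdx k + 1 / 2) / Real.pi : ℝ) : ℂ) *
        ∫ x in (-1 : ℝ)..1, (jacobiJ s k).eval (x : ℂ) * (jacobiJ t m).eval (x : ℂ) *
          (((1 - x) ^ ((rIdx k : ℝ) - (rIdx m : ℝ) + aIdx k) * (1 + x) ^ (1 / 2 : ℝ) : ℝ) : ℂ))
    = ((2 / Real.pi * ∫ δ in (0 : ℝ)..Real.pi, Real.sin (sineFreq k s * δ) *
        Real.sin (sineFreq m t * δ) * Real.cos (δ / 2) ^ (k - m) : ℝ) : ℂ) := by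
  have hpi : (Real.pi : ℂ) ≠ 0 := by exact_mod_cast Real.pi_ne_zero
  rw [intervalIntegral.integral_of_le (by norm_num), integral_Ioc_eq_integral_Ioo,
    ← image_neg_cos_Ioo, integral_image_eq_integral_abs_deriv_smul (f' := Real.sin) measurableSet_Ioo
      (fun x _ => by
        have := (Real.hasDerivAt_cos x).neg.hasDerivWithinAt (s := Ioo 0 Real.pi)
        rwa [neg_neg] at this)
      (fun x hx y hy h => Real.injOn_cos ⟨hx.1.le, hx.2.le⟩ ⟨hy.1.le, hy.2.le⟩ (neg_injective h)),
    intervalIntegral.integral_of_le Real.pi_pos.le, integral_Ioc_eq_integral_Ioo,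
    Complex.ofReal_mul (2 / Real.pi), ← integral_complex_ofReal, ← mul_assoc, ← integral_const_mul,
    ← integral_const_mul]
  refine setIntegral_congr_fun measurableSet_Ioo fun δ hδ => ?_
  obtain ⟨h0, h1⟩ := hδ
  have hS : 0 < Real.sin (δ / 2) := Real.sin_pos_of_pos_of_lt_pi (by linarith) (by linarith)
  have hC : 0 < Real.cos (δ / 2) :=
    Real.cos_pos_of_mem_Ioo ⟨by linarith, by linarith⟩
  have hsin : Real.sin δ = 2 * Real.sin (δ / 2) * Real.cos (δ / 2) := by
    rw [← Real.sin_two_mul]; congr 1; ring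
  have hcos : Real.cos δ = 2 * Real.cos (δ / 2) ^ 2 - 1 := by
    rw [← Real.cos_two_mul]; congr 1; ring
  have hx1 : 1 - -Real.cos δ = 2 * Real.cos (δ / 2) ^ 2 := by rw [hcos]; ring
  have hx2 : 1 + -Real.cos δ = 2 * Real.sin (δ / 2) ^ 2 := by
    rw [hcos, Real.sin_sq]; ring
  have hsinpos : 0 < Real.sin δ := Real.sin_pos_of_pos_of_lt_pi h0 h1
  have hJ1 := jacobiScaled_neg_cos k s h0 h1
  have hJ2 := jacobiScaled_neg_cos m t h0 h1
  set S := Real.sin (δ / 2)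
  set C := Real.cos (δ / 2)
  simp only [Complex.real_smul]
  rw [abs_of_pos hsinpos, hx1, hx2, hsin]
  simp only [jacobiScaled] at hJ1 hJ2
  rw [Complex.ofReal_neg]
  set j1 := (jacobiJ s k).eval (-((Real.cos δ : ℝ) : ℂ))
  set j2 := (jacobiJ t m).eval (-((Real.cos δ : ℝ) : ℂ))
  have hsgn : ((-1 : ℝ) ^ ((s : ℤ) - (t : ℤ))) = (-1) ^ s * (-1) ^ t := by
    rw [zpow_sub₀ (by norm_num), zpow_natCast, zpow_natCast, div_eq_mul_inv, ← inv_pow]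
    norm_num
  have hprod : j1 * j2 * (-1) ^ s * (-1) ^ t
      = (((2 : ℝ) ^ (-aIdx k - aIdx m) * (((Real.sqrt 2)⁻¹ * Real.sin (sineFreq k s * δ) *
        C ^ (-(aIdx k + 1 / 2)) / S) * ((Real.sqrt 2)⁻¹ * Real.sin (sineFreq m t * δ) *
        C ^ (-(aIdx m + 1 / 2)) / S)) : ℝ) : ℂ) := by
    rw [Complex.ofReal_mul, Complex.ofReal_mul, ← hJ1, ← hJ2]
    have h2 : ((2 : ℝ) ^ (-aIdx k - aIdx m)) * (2 : ℝ) ^ aIdx k * (2 : ℝ) ^ aIdx m = 1 := by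
      rw [← Real.rpow_add (by norm_num), ← Real.rpow_add (by norm_num)]
      rw [show -aIdx k - aIdx m + aIdx k + aIdx m = 0 by ring, Real.rpow_zero]
    have h2C : (((2 : ℝ) ^ (-aIdx k - aIdx m) : ℝ) : ℂ) * (((2 : ℝ) ^ aIdx k : ℝ) : ℂ)
      * (((2 : ℝ) ^ aIdx m : ℝ) : ℂ) = 1 := by exact_mod_cast h2
    linear_combination (-(j1 * j2 * (-1) ^ s * (-1) ^ t)) * h2C
  have hmain := weight_identity hkm hS hC (Real.sin (sineFreq k s * δ)) (Real.sin (sineFreq m t * δ))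
  rw [hsgn]
  clear_value j1 j2 S C
  clear hJ1 hJ2 hsgn hx1 hx2 hsin hcos
  generalize (2 * C ^ 2) ^ ((rIdx k : ℝ) - (rIdx m : ℝ) + aIdx k) * (2 * S ^ 2) ^ (1 / 2 : ℝ)
    = Q at *
  generalize (2 : ℝ) ^ (-aIdx k - aIdx m) * ((Real.sqrt 2)⁻¹ * Real.sin (sineFreq k s * δ) *
        C ^ (-(aIdx k + 1 / 2)) / S * ((Real.sqrt 2)⁻¹ * Real.sin (sineFreq m t * δ) *
        C ^ (-(aIdx m + 1 / 2)) / S)) = P at *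
  generalize Real.sin (sineFreq k s * δ) * Real.sin (sineFreq m t * δ) * C ^ (k - m) = R at *
  generalize (2 : ℝ) ^ ((rIdx m : ℤ) - (rIdx k : ℤ)) = d₁ at *
  generalize (2 : ℝ) ^ (aIdx m - aIdx k) = d₂ at *
  generalize (2 : ℝ) ^ (aIdx k + 1 / 2) / Real.pi = d₃ at *
  generalize 2 / Real.pi = d₄ at *
  have hmainC : (d₁ : ℂ) * d₂ * d₃ * (2 * S * C * (P * Q)) = d₄ * R := by exact_mod_cast hmain
  push_cast
  linear_combination hmainC + (d₁ : ℂ) * d₂ * d₃ * (2 * S * C * Q) * hprod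

theorem integral_cos_mul_pi_eq_zero {j : ℤ} (hj : j ≠ 0) :
    ∫ δ in (0 : ℝ)..Real.pi, Real.cos (j * δ) = 0 := by
  have hj' : (j : ℝ) ≠ 0 := by exact_mod_cast hj
  rw [intervalIntegral.integral_comp_mul_left _ hj', integral_cos, mul_zero, Real.sin_zero,
    Real.sin_int_mul_pi, sub_zero, smul_zero]

theorem sin_mul_sin_eq (a b : ℝ) :
    Real.sin a * Real.sin b = (Real.cos (a - b) - Real.cos (a + b)) / 2 := by
  rw [Real.cos_sub, Real.cos_add]; ring

/-- Orthonormality on one level. The half-integer offsets cancel in the difference of frequencies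
and add to `1` or `2` in the sum, so both are integers and the sum is never zero. -/
theorem integral_sin_mul_sin_eq {k s t : ℕ} :
    2 / Real.pi * (∫ δ in (0 : ℝ)..Real.pi, Real.sin (sineFreq k s * δ) *
        Real.sin (sineFreq k t * δ) * Real.cos (δ / 2) ^ (k - k)) = if s = t then 1 else 0 := by
  have h1 : ∀ δ : ℝ, Real.sin (sineFreq k s * δ) *
        Real.sin (sineFreq k t * δ) * Real.cos (δ / 2) ^ (k - k)
      = (Real.cos (((s - t : ℤ) : ℝ) * δ) -
        Real.cos (((s + t + (if Odd k then 1 else 2) : ℤ) : ℝ) * δ)) / 2 := by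
    intro δ
    rw [Nat.sub_self, pow_zero, mul_one, sin_mul_sin_eq]
    congr 3
    · unfold sineFreq; push_cast; ring
    · unfold sineFreq; push_cast; split_ifs <;> ring
  simp_rw [h1]
  rw [intervalIntegral.integral_div, intervalIntegral.integral_sub
    (Continuous.intervalIntegrable (by fun_prop) _ _)
    (Continuous.intervalIntegrable (by fun_prop) _ _),
    integral_cos_mul_pi_eq_zero (j := s + t + (if Odd k then 1 else 2))
      (by split_ifs <;> omega)]
  split_ifs with h
  · subst h
    simp
  · rw [integral_cos_mul_pi_eq_zero (by omega)]; simp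

/-! ### Integrals of powers of the cosine: oscillation bounds and Laplace's method. -/

theorem cos_le_exp_neg {z : ℝ} (hz : |z| ≤ Real.pi) :
    Real.cos z ≤ Real.exp (-(2 / Real.pi ^ 2 * z ^ 2)) := by
  have h1 := Real.cos_le_one_sub_mul_cos_sq hz
  have h2 := Real.add_one_le_exp (-(2 / Real.pi ^ 2 * z ^ 2))
  linarith

theorem cos_half_pow_le {δ : ℝ} (h0 : 0 ≤ δ) (h1 : δ ≤ Real.pi) (n : ℕ) :
    Real.cos (δ / 2) ^ n ≤ Real.exp (-(n / (2 * Real.pi ^ 2)) * δ ^ 2) := by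
  have hc : 0 ≤ Real.cos (δ / 2) := Real.cos_nonneg_of_mem_Icc ⟨by linarith, by linarith⟩
  calc Real.cos (δ / 2) ^ n ≤ Real.exp (-(2 / Real.pi ^ 2 * (δ / 2) ^ 2)) ^ n := by
        gcongr
        exact cos_le_exp_neg (by rw [abs_of_nonneg (by linarith)]; linarith)
    _ = _ := by
        rw [← Real.exp_nat_mul]; congr 1; field_simp

theorem integral_cos_half_pow_le {n : ℕ} (hn : 1 ≤ n) :
    ∫ δ in (0 : ℝ)..Real.pi, Real.cos (δ / 2) ^ n ≤ Real.sqrt (2 * Real.pi ^ 3) / Real.sqrt n := by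
  have hn0 : (0 : ℝ) < n := by exact_mod_cast hn
  have hb : 0 < (n : ℝ) / (2 * Real.pi ^ 2) := by positivity
  have hint := integrable_exp_neg_mul_sq hb
  calc ∫ δ in (0 : ℝ)..Real.pi, Real.cos (δ / 2) ^ n
      ≤ ∫ δ in (0 : ℝ)..Real.pi, Real.exp (-(n / (2 * Real.pi ^ 2)) * δ ^ 2) := by
        apply intervalIntegral.integral_mono_on Real.pi_pos.le
          (Continuous.intervalIntegrable (by fun_prop) _ _)
          (Continuous.intervalIntegrable (by fun_prop) _ _)
        intro δ hδ
        exact cos_half_pow_le hδ.1 hδ.2 n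
    _ ≤ ∫ δ : ℝ, Real.exp (-(n / (2 * Real.pi ^ 2)) * δ ^ 2) := by
        rw [intervalIntegral.integral_of_le Real.pi_pos.le]
        exact setIntegral_le_integral hint (Eventually.of_forall fun _ => (Real.exp_pos _).le)
    _ = _ := by
        rw [integral_gaussian, ← Real.sqrt_div (by positivity)]
        congr 1
        field_simp

/-- Two integrations by parts. -/
theorem abs_integral_cos_mul_cos_pow_le {n : ℕ} (hn : 1 ≤ n) {j : ℝ} (hj : j ≠ 0) :
    |∫ δ in (0 : ℝ)..Real.pi, Real.cos (j * δ) * Real.cos (δ / 2) ^ n|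
      ≤ (1 / 2 + n / 2 * ∫ δ in (0 : ℝ)..Real.pi, Real.cos (δ / 2) ^ n) / j ^ 2 := by
  set g1 : ℝ → ℝ := fun δ => -(n / 2) * Real.cos (δ / 2) ^ (n - 1) * Real.sin (δ / 2) with hg1
  -- The derivative of `g1` is `g2a - g2b`, a difference of two functions nonnegative on `[0,π]`.
  -- For `n = 1` the exponent `n - 2` truncates to `0`, but the coefficient `n - 1` vanishes.
  set g2a : ℝ → ℝ := fun δ => n * ((n - 1 : ℕ) : ℝ) / 4 * Real.cos (δ / 2) ^ (n - 2) * Real.sin (δ / 2) ^ 2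
    with hg2a
  set g2b : ℝ → ℝ := fun δ => n / 4 * Real.cos (δ / 2) ^ n with hg2b
  have hcosd : ∀ δ : ℝ, HasDerivAt (fun δ => Real.cos (δ / 2)) (-Real.sin (δ / 2) * (1 / 2)) δ :=
    fun δ => ((hasDerivAt_id' δ).div_const 2).cos
  have hsind : ∀ δ : ℝ, HasDerivAt (fun δ => Real.sin (δ / 2)) (Real.cos (δ / 2) * (1 / 2)) δ :=
    fun δ => ((hasDerivAt_id' δ).div_const 2).sin
  have hcj : ∀ δ : ℝ, HasDerivAt (fun δ => Real.cos (j * δ)) (-Real.sin (j * δ) * (j * 1)) δ :=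
    fun δ => ((hasDerivAt_id' δ).const_mul j).cos
  have hsj : ∀ δ : ℝ, HasDerivAt (fun δ => Real.sin (j * δ)) (Real.cos (j * δ) * (j * 1)) δ :=
    fun δ => ((hasDerivAt_id' δ).const_mul j).sin
  have hd0 : ∀ δ : ℝ, HasDerivAt (fun δ => Real.cos (δ / 2) ^ n) (g1 δ) δ := by
    intro δ
    refine ((hcosd δ).pow n).congr_deriv ?_
    rw [hg1]; simp only; ring
  have hpow : ∀ δ : ℝ, Real.cos (δ / 2) ^ (n - 1) * Real.cos (δ / 2) = Real.cos (δ / 2) ^ n := by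
    intro δ; rw [← pow_succ]; congr 1; omega
  have hd1 : ∀ δ : ℝ, HasDerivAt g1 (g2a δ - g2b δ) δ := by
    intro δ
    refine ((((hcosd δ).pow (n - 1)).const_mul (-(n / 2 : ℝ))).mul (hsind δ)).congr_deriv ?_
    rw [hg2a, hg2b]; simp only [Nat.sub_sub, Pi.pow_apply]
    rw [← hpow]
    ring
  have hcont1 : Continuous g1 := by fun_prop
  have hconta : Continuous g2a := by fun_prop
  have hcontb : Continuous g2b := by fun_prop
  have hII : ∀ {f : ℝ → ℝ}, Continuous f → IntervalIntegrable f volume 0 Real.pi :=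
    fun h => h.intervalIntegrable _ _
  have hg10 : g1 0 = 0 := by simp [hg1]
  have hg1pi : g1 Real.pi = -(n / 2) * 0 ^ (n - 1) := by simp [hg1]
  have hg1pi' : g1 Real.pi ≤ 0 := by
    rw [hg1pi]
    have : (0 : ℝ) ≤ n / 2 * 0 ^ (n - 1) := by positivity
    linarith
  -- Only `n = 1` leaves a boundary term, since `0 ^ (n - 1)` is then `1`.
  have hg1pi'' : |g1 Real.pi| ≤ 1 / 2 := by
    rw [hg1pi]
    rcases Nat.lt_or_ge 1 n with h | h
    · rw [zero_pow (by omega)]; norm_num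
    · have : n = 1 := by omega
      subst this; norm_num [abs_of_neg]
  have hI1 : ∫ δ in (0 : ℝ)..Real.pi, (g2a δ - g2b δ) = g1 Real.pi := by
    rw [intervalIntegral.integral_eq_sub_of_hasDerivAt (fun δ _ => hd1 δ) (hII (by fun_prop)),
      hg10, sub_zero]
  have hI2 : ∫ δ in (0 : ℝ)..Real.pi, (Real.cos (j * δ) * Real.cos (δ / 2) ^ n
      + Real.cos (j * δ) / j ^ 2 * (g2a δ - g2b δ)) = Real.cos (j * Real.pi) / j ^ 2 * g1 Real.pi := by
    have hd : ∀ δ : ℝ, HasDerivAt (fun δ => Real.sin (j * δ) / j * Real.cos (δ / 2) ^ n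
        + Real.cos (j * δ) / j ^ 2 * g1 δ) (Real.cos (j * δ) * Real.cos (δ / 2) ^ n
      + Real.cos (j * δ) / j ^ 2 * (g2a δ - g2b δ)) δ := by
      intro δ
      refine ((((hsj δ).div_const j).mul (hd0 δ)).add
        (((hcj δ).div_const (j ^ 2)).mul (hd1 δ))).congr_deriv ?_
      field_simp
      ring
    rw [intervalIntegral.integral_eq_sub_of_hasDerivAt (fun δ _ => hd δ) (hII (by fun_prop)), hg10]
    have : (0 : ℝ) ^ n = 0 := zero_pow (by omega)
    simp [this]
  rw [intervalIntegral.integral_add (hII (by fun_prop)) (hII (by fun_prop))] at hI2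
  -- `|g2a - g2b| ≤ g2a + g2b = (g2a - g2b) + 2 g2b`: the bracket integrates to `g1 π ≤ 0`, and `2
  -- g2b` is `(n/2) cos(δ/2)^n`.
  have hI3 : |∫ δ in (0 : ℝ)..Real.pi, Real.cos (j * δ) / j ^ 2 * (g2a δ - g2b δ)|
      ≤ (n / 2 * ∫ δ in (0 : ℝ)..Real.pi, Real.cos (δ / 2) ^ n) / j ^ 2 := by
    have hj2 : 0 < j ^ 2 := by positivity
    calc |∫ δ in (0 : ℝ)..Real.pi, Real.cos (j * δ) / j ^ 2 * (g2a δ - g2b δ)|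
        ≤ ∫ δ in (0 : ℝ)..Real.pi, ((g2a δ - g2b δ) + n / 2 * Real.cos (δ / 2) ^ n) / j ^ 2 := by
          rw [← Real.norm_eq_abs]
          apply intervalIntegral.norm_integral_le_of_norm_le Real.pi_pos.le _ (hII (by fun_prop))
          refine Eventually.of_forall fun δ hδ => ?_
          have hc : 0 ≤ Real.cos (δ / 2) := Real.cos_nonneg_of_mem_Icc
            ⟨by linarith [hδ.1, Real.pi_pos], by linarith [hδ.2]⟩
          have ha : 0 ≤ g2a δ := by simp only [hg2a]; positivity
          have hb : 0 ≤ g2b δ := by simp only [hg2b]; positivity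
          rw [Real.norm_eq_abs, div_mul_eq_mul_div, abs_div, abs_of_pos hj2, abs_mul]
          gcongr
          have hcos := Real.abs_cos_le_one (j * δ)
          have hb' : n / 2 * Real.cos (δ / 2) ^ n = 2 * g2b δ := by simp only [hg2b]; ring
          rw [hb']
          have : |g2a δ - g2b δ| ≤ g2a δ + g2b δ := by
            rw [abs_le]; constructor <;> linarith
          calc _ ≤ 1 * |g2a δ - g2b δ| := by gcongr
            _ ≤ _ := by linarith
      _ = (g1 Real.pi + n / 2 * ∫ δ in (0 : ℝ)..Real.pi, Real.cos (δ / 2) ^ n) / j ^ 2 := by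
          rw [intervalIntegral.integral_div, intervalIntegral.integral_add (hII (by fun_prop))
            (hII (by fun_prop)), hI1, intervalIntegral.integral_const_mul]
      _ ≤ _ := by gcongr; linarith
  have hI4 : |Real.cos (j * Real.pi) / j ^ 2 * g1 Real.pi| ≤ 1 / 2 / j ^ 2 := by
    have hj2 : 0 < j ^ 2 := by positivity
    rw [div_mul_eq_mul_div, abs_div, abs_of_pos hj2, abs_mul]
    gcongr
    calc _ ≤ 1 * (1 / 2 : ℝ) := by
          gcongr
          exact Real.abs_cos_le_one _
      _ = _ := by norm_num
  rw [add_div]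
  have := abs_sub (Real.cos (j * Real.pi) / j ^ 2 * g1 Real.pi)
    (∫ δ in (0 : ℝ)..Real.pi, Real.cos (j * δ) / j ^ 2 * (g2a δ - g2b δ))
  rw [← hI2, add_sub_cancel_right] at this
  rw [hI2] at this
  linarith

/-- The Gaussian bound on the integral of `cos(δ/2)^n` improves the factor `n` to `√n`, which is
`o(L)` when `n = o(L²)`. -/
theorem abs_integral_cos_mul_cos_pow_le_sqrt {n : ℕ} (hn : 1 ≤ n) {j : ℝ} (hj : j ≠ 0) :
    |∫ δ in (0 : ℝ)..Real.pi, Real.cos (j * δ) * Real.cos (δ / 2) ^ n|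
      ≤ (1 / 2 + Real.sqrt (2 * Real.pi ^ 3) / 2 * Real.sqrt n) / j ^ 2 := by
  refine (abs_integral_cos_mul_cos_pow_le hn hj).trans ?_
  have hn0 : (0 : ℝ) < n := by exact_mod_cast hn
  have h1 := integral_cos_half_pow_le hn
  have h2 : (n : ℝ) / 2 * (Real.sqrt (2 * Real.pi ^ 3) / Real.sqrt n)
      = Real.sqrt (2 * Real.pi ^ 3) / 2 * Real.sqrt n := by
    have : (n : ℝ) = Real.sqrt n * Real.sqrt n := (Real.mul_self_sqrt hn0.le).symm
    have h3 : Real.sqrt n ≠ 0 := (Real.sqrt_pos.2 hn0).ne'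
    nth_rewrite 1 [this]
    field_simp
  rw [← h2]
  gcongr

theorem integral_cos_mul_exp_neg {b : ℝ} (hb : 0 < b) (j : ℝ) :
    ∫ y in Ioi (0 : ℝ), Real.cos (j * y) * Real.exp (-b * y ^ 2)
      = Real.sqrt (Real.pi / b) / 2 * Real.exp (-j ^ 2 / (4 * b)) := by
  have h1 := fourierIntegral_gaussian (b := (b : ℂ)) (by simpa using hb) (j : ℂ)
  have hint : Integrable fun x : ℝ => Complex.exp (Complex.I * j * x) * Complex.exp (-b * x ^ 2) := by
    have := integrable_cexp_quadratic (b := (b : ℂ)) (by simpa using hb) (Complex.I * j) 0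
    refine this.congr (Eventually.of_forall fun x => ?_)
    simp only
    rw [← Complex.exp_add]; congr 1; ring
  have h2 := congrArg Complex.re h1
  rw [← Complex.reCLM_apply, ← ContinuousLinearMap.integral_comp_comm _ hint] at h2
  -- Written in `|x|`, the even real part of the Fourier integrand allows passage from the full line
  -- to the half-line.
  have h3 : ∀ x : ℝ, Complex.reCLM (Complex.exp (Complex.I * j * x) * Complex.exp (-b * x ^ 2))
      = Real.cos (j * |x|) * Real.exp (-b * |x| ^ 2) := by
    intro x
    have e1 : Complex.exp (-b * x ^ 2) = ((Real.exp (-b * x ^ 2) : ℝ) : ℂ) := by push_cast; rfl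
    have e2 : Complex.I * j * x = ((j * x : ℝ) : ℂ) * Complex.I := by push_cast; ring
    rw [e1, e2, Complex.exp_mul_I, Complex.reCLM_apply, Complex.re_mul_ofReal,
      ← Complex.ofReal_cos, ← Complex.ofReal_sin, sq_abs]
    have e3 : Real.cos (j * |x|) = Real.cos (j * x) := by
      rcases abs_choice x with h | h <;> rw [h]
      rw [mul_neg, Real.cos_neg]
    rw [e3]
    simp [-Complex.ofReal_cos, -Complex.ofReal_sin]
  simp_rw [h3] at h2
  rw [integral_comp_abs (f := fun x => Real.cos (j * x) * Real.exp (-b * x ^ 2))] at h2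
  have h4 : ((Real.pi : ℂ) / b) ^ (1 / 2 : ℂ) * Complex.exp (-(j : ℂ) ^ 2 / (4 * b))
      = ((Real.sqrt (Real.pi / b) * Real.exp (-j ^ 2 / (4 * b)) : ℝ) : ℂ) := by
    rw [Real.sqrt_eq_rpow]
    push_cast
    rw [Complex.ofReal_cpow (by positivity)]
    push_cast
    rfl
  rw [h4, Complex.ofReal_re] at h2
  linarith

theorem integral_sin_mul_sin_mul_exp_neg {h : ℝ} (hh : 0 < h) (ν₁ ν₂ : ℝ) :
    2 / Real.pi * ∫ y in Ioi (0 : ℝ), Real.sin (ν₁ * y) * Real.sin (ν₂ * y) *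
        Real.exp (-(h / 4) * y ^ 2)
      = 1 / Real.sqrt (Real.pi * h) *
        (Real.exp (-(ν₁ - ν₂) ^ 2 / h) - Real.exp (-(ν₁ + ν₂) ^ 2 / h)) := by
  have hb : 0 < h / 4 := by positivity
  have hint : ∀ j : ℝ, Integrable fun y : ℝ => Real.cos (j * y) * Real.exp (-(h / 4) * y ^ 2) := by
    intro j
    refine (integrable_exp_neg_mul_sq hb).bdd_mul (c := 1) (by fun_prop) ?_
    exact Eventually.of_forall fun y => by rw [Real.norm_eq_abs]; exact Real.abs_cos_le_one _
  have h1 : ∀ y : ℝ, Real.sin (ν₁ * y) * Real.sin (ν₂ * y) * Real.exp (-(h / 4) * y ^ 2)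
      = (Real.cos ((ν₁ - ν₂) * y) * Real.exp (-(h / 4) * y ^ 2)
        - Real.cos ((ν₁ + ν₂) * y) * Real.exp (-(h / 4) * y ^ 2)) / 2 := by
    intro y
    rw [sin_mul_sin_eq, ← sub_mul ν₁, ← add_mul]; ring
  simp_rw [h1]
  rw [integral_div, integral_sub (hint _).integrableOn (hint _).integrableOn,
    integral_cos_mul_exp_neg hb, integral_cos_mul_exp_neg hb]
  have e1 : Real.sqrt (Real.pi / (h / 4)) = 2 * Real.pi / Real.sqrt (Real.pi * h) := by
    rw [eq_div_iff (by positivity), ← Real.sqrt_mul (by positivity),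
      show Real.pi / (h / 4) * (Real.pi * h) = (2 * Real.pi) ^ 2 by field_simp; norm_num,
      Real.sqrt_sq (by positivity)]
  rw [e1, mul_div_cancel₀ h (four_ne_zero)]
  have := Real.pi_ne_zero
  have : Real.sqrt (Real.pi * h) ≠ 0 := by positivity
  field_simp

theorem tendsto_div_of_hasDerivAt {f : ℝ → ℝ} (hf : HasDerivAt f 1 0) (hf0 : f 0 = 0)
    {ι : Type*} {l : Filter ι} {b : ι → ℝ} (hb : Tendsto b l (𝓝 0)) (hbne : ∀ᶠ i in l, b i ≠ 0) :
    Tendsto (fun i => f (b i) / b i) l (𝓝 1) := by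
  have h1 := hasDerivAt_iff_tendsto_slope.1 hf
  have h2 : Tendsto b l (𝓝[≠] 0) := tendsto_nhdsWithin_iff.2 ⟨hb, hbne⟩
  refine (h1.comp h2).congr ?_
  intro i
  simp [slope_def_field, hf0]

theorem tendsto_cos_half_pow {ι : Type*} {l : Filter ι} {L : ι → ℝ} {n : ι → ℕ} {m y : ℝ}
    (hy : 0 < y) (hL : Tendsto L l atTop)
    (hn : Tendsto (fun i => (n i : ℝ) / L i ^ 2) l (𝓝 m)) :
    Tendsto (fun i => Real.cos (y / L i / 2) ^ n i) l (𝓝 (Real.exp (-(m / 8) * y ^ 2))) := by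
  have hLpos : ∀ᶠ i in l, 0 < L i := hL.eventually_gt_atTop 0
  have hLinv := tendsto_inv_atTop_zero.comp hL
  have hz : Tendsto (fun i => y / L i / 2 / 2) l (𝓝 0) := by
    have := hLinv.const_mul (y / 4)
    rw [mul_zero] at this
    refine this.congr fun i => ?_
    simp only [Function.comp]; ring
  have hzne : ∀ᶠ i in l, y / L i / 2 / 2 ≠ 0 := by
    filter_upwards [hLpos] with i hi; positivity
  have hs := tendsto_div_of_hasDerivAt (by simpa using Real.hasDerivAt_sin 0) Real.sin_zero hz hzne
  -- `cos(y/2L) - 1 = -2 sin²(y/4L)`; after `log(1+w) ~ w` this is the whole exponent.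
  have hw : Tendsto (fun i => L i ^ 2 * (Real.cos (y / L i / 2) - 1)) l (𝓝 (-(y ^ 2 / 8))) := by
    have := (hs.pow 2).const_mul (-(y ^ 2 / 8))
    rw [one_pow, mul_one] at this
    refine this.congr' ?_
    filter_upwards [hLpos] with i hi
    have e : Real.cos (y / L i / 2) = 1 - 2 * Real.sin (y / L i / 2 / 2) ^ 2 := by
      have := Real.cos_two_mul (y / L i / 2 / 2)
      rw [mul_div_cancel₀ _ two_ne_zero] at this
      rw [this, Real.sin_sq]; ring
    rw [e]
    field_simp
    ring
  have hwne : ∀ᶠ i in l, Real.cos (y / L i / 2) - 1 ≠ 0 := by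
    have : -(y ^ 2 / 8) ≠ 0 := by
      have : 0 < y ^ 2 / 8 := by positivity
      linarith
    filter_upwards [hw.eventually_ne this] with i hi h
    exact hi (by rw [h, mul_zero])
  have hw0 : Tendsto (fun i => Real.cos (y / L i / 2) - 1) l (𝓝 0) := by
    have := (hLinv.pow 2).mul hw
    rw [zero_pow two_ne_zero, zero_mul] at this
    refine this.congr' ?_
    filter_upwards [hLpos] with i hi
    simp only [Function.comp]
    field_simp
  have hlog : HasDerivAt (fun w : ℝ => Real.log (1 + w)) 1 0 := by
    have := ((hasDerivAt_id' (0 : ℝ)).const_add 1).log (by norm_num)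
    simpa using this
  have hl := tendsto_div_of_hasDerivAt hlog (by simp) hw0 hwne
  have hfin := (Real.continuous_exp.tendsto _).comp ((hn.mul hw).mul hl)
  have e : m * -(y ^ 2 / 8) * 1 = -(m / 8) * y ^ 2 := by ring
  rw [e] at hfin
  refine hfin.congr' ?_
  have hpos : ∀ᶠ i in l, 0 < 1 + (Real.cos (y / L i / 2) - 1) := by
    have : Tendsto (fun i => 1 + (Real.cos (y / L i / 2) - 1)) l (𝓝 (1 + 0)) := hw0.const_add 1
    exact this.eventually_const_lt (by norm_num)
  filter_upwards [hLpos, hwne, hpos] with i hi h1 h2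
  simp only [Function.comp]
  have e2 : (n i : ℝ) / L i ^ 2 * (L i ^ 2 * (Real.cos (y / L i / 2) - 1)) *
      (Real.log (1 + (Real.cos (y / L i / 2) - 1)) / (Real.cos (y / L i / 2) - 1))
      = n i * Real.log (1 + (Real.cos (y / L i / 2) - 1)) := by
    generalize Real.cos (y / L i / 2) - 1 = c at *
    field_simp
  rw [e2, Real.exp_nat_mul, Real.exp_log h2]
  ring_nf

/-- Laplace asymptotics of the trigonometric integral. -/
theorem tendsto_trig_integral_gaussian {L A B : ℕ → ℝ} {n : ℕ → ℕ} {ν₁ ν₂ h : ℝ} (hh : 0 < h)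
    (hL : Tendsto L atTop atTop)
    (hA : Tendsto (fun i => A i / L i) atTop (𝓝 ν₁))
    (hB : Tendsto (fun i => B i / L i) atTop (𝓝 ν₂))
    (hn : Tendsto (fun i => (n i : ℝ) / L i ^ 2) atTop (𝓝 (2 * h))) :
    Tendsto (fun i => L i * (2 / Real.pi * ∫ δ in (0 : ℝ)..Real.pi, Real.sin (A i * δ) *
        Real.sin (B i * δ) * Real.cos (δ / 2) ^ n i)) atTop
      (𝓝 (1 / Real.sqrt (Real.pi * h) *
        (Real.exp (-(ν₁ - ν₂) ^ 2 / h) - Real.exp (-(ν₁ + ν₂) ^ 2 / h)))) := by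
  have hLpos : ∀ᶠ i in atTop, 0 < L i := hL.eventually_gt_atTop 0
  rw [← integral_sin_mul_sin_mul_exp_neg hh]
  -- The substitution `δ = y/L`, with the range `[0, πL]` extended by zero to a fixed half-line.
  set F : ℕ → ℝ → ℝ := fun i => (Iic (Real.pi * L i)).indicator fun y =>
    Real.sin (A i * (y / L i)) * Real.sin (B i * (y / L i)) * Real.cos (y / L i / 2) ^ n i with hF
  have hrep : ∀ᶠ i in atTop, 2 / Real.pi * ∫ y in Ioi (0 : ℝ), F i y
      = L i * (2 / Real.pi * ∫ δ in (0 : ℝ)..Real.pi, Real.sin (A i * δ) *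
        Real.sin (B i * δ) * Real.cos (δ / 2) ^ n i) := by
    filter_upwards [hLpos] with i hi
    have h1 := intervalIntegral.integral_comp_div (a := 0) (b := Real.pi * L i)
      (fun δ => Real.sin (A i * δ) * Real.sin (B i * δ) * Real.cos (δ / 2) ^ n i) hi.ne'
    rw [zero_div, mul_div_cancel_right₀ _ hi.ne', smul_eq_mul] at h1
    rw [mul_left_comm, ← h1, intervalIntegral.integral_of_le (by positivity),
      hF, setIntegral_indicator measurableSet_Iic, Ioi_inter_Iic]
  refine Tendsto.congr' hrep (Tendsto.const_mul _ ?_)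
  have hb : 0 < h / (2 * Real.pi ^ 2) := by positivity
  apply tendsto_integral_filter_of_dominated_convergence
    (fun y => Real.exp (-(h / (2 * Real.pi ^ 2)) * y ^ 2))
  · refine Eventually.of_forall fun i => ?_
    exact ((Measurable.indicator (by fun_prop) measurableSet_Iic)).aestronglyMeasurable
  · have hnh : ∀ᶠ i in atTop, h < (n i : ℝ) / L i ^ 2 := hn.eventually_const_lt (by linarith)
    filter_upwards [hLpos, hnh] with i hi h2
    refine (ae_restrict_iff' measurableSet_Ioi).2 (Eventually.of_forall fun y hy => ?_)
    have hy0 : 0 < y := hy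
    simp only [hF]
    rw [indicator]
    split_ifs with hyL
    · have hyL' : y / L i ≤ Real.pi := (div_le_iff₀ hi).2 hyL
      have hδ0 : 0 ≤ y / L i := by positivity
      have hc : 0 ≤ Real.cos (y / L i / 2) :=
        Real.cos_nonneg_of_mem_Icc ⟨by linarith [Real.pi_pos], by linarith⟩
      rw [norm_mul, norm_mul, Real.norm_eq_abs, Real.norm_eq_abs, Real.norm_eq_abs,
        abs_of_nonneg (pow_nonneg hc _)]
      calc _ ≤ 1 * 1 * Real.exp (-(n i / (2 * Real.pi ^ 2)) * (y / L i) ^ 2) := by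
            gcongr
            · exact Real.abs_sin_le_one _
            · exact Real.abs_sin_le_one _
            · exact cos_half_pow_le hδ0 hyL' _
        _ ≤ _ := by
            rw [one_mul, one_mul]
            apply Real.exp_le_exp.2
            have : -((n i : ℝ) / (2 * Real.pi ^ 2)) * (y / L i) ^ 2
              = -((n i : ℝ) / L i ^ 2 * (y ^ 2 / (2 * Real.pi ^ 2))) := by
              field_simp
            rw [this]
            have : -(h / (2 * Real.pi ^ 2)) * y ^ 2 = -(h * (y ^ 2 / (2 * Real.pi ^ 2))) := by ring
            rw [this]
            gcongr
    · rw [norm_zero]; positivity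
  · exact (integrable_exp_neg_mul_sq hb).integrableOn
  · refine (ae_restrict_iff' measurableSet_Ioi).2 (Eventually.of_forall fun y hy => ?_)
    have hy0 : 0 < y := hy
    have h1 : Tendsto (fun i => Real.sin (A i * (y / L i))) atTop (𝓝 (Real.sin (ν₁ * y))) := by
      refine ((Real.continuous_sin.tendsto _).comp (hA.mul_const y)).congr fun i => ?_
      simp only [Function.comp]; congr 1; ring
    have h2 : Tendsto (fun i => Real.sin (B i * (y / L i))) atTop (𝓝 (Real.sin (ν₂ * y))) := by
      refine ((Real.continuous_sin.tendsto _).comp (hB.mul_const y)).congr fun i => ?_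
      simp only [Function.comp]; congr 1; ring
    have h3 := tendsto_cos_half_pow hy0 hL hn
    have e : 2 * h / 8 = h / 4 := by ring
    rw [e] at h3
    refine ((h1.mul h2).mul h3).congr' ?_
    have hev : ∀ᶠ i in atTop, y ≤ Real.pi * L i :=
      (hL.const_mul_atTop Real.pi_pos).eventually_ge_atTop y
    filter_upwards [hev] with i hi
    simp only [hF]
    rw [indicator_of_mem (by exact hi)]

theorem tendsto_sineFreq_div {L : ℕ → ℝ} {k s : ℕ → ℕ} {ν : ℝ} (hL : Tendsto L atTop atTop)
    (hs : Tendsto (fun i => (s i : ℝ) / L i) atTop (𝓝 ν)) :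
    Tendsto (fun i => sineFreq (k i) (s i) / L i) atTop (𝓝 ν) := by
  have hLinv := tendsto_inv_atTop_zero.comp hL
  classical
  have h1 := hs.add (hLinv.const_mul (1 / 2))
  have h2 := hs.add (hLinv.const_mul 1)
  rw [mul_zero, add_zero] at h1 h2
  refine (Tendsto.if' (p := fun i => Odd (k i)) h1 h2).congr fun i => ?_
  unfold sineFreq
  simp only [Function.comp]
  split_ifs <;> ring

/-- With `D` of order `L` and `√n = o(L)`, the oscillation bound survives multiplication by `L`. -/
theorem tendsto_sqrt_mul_div_sq {L D : ℕ → ℝ} {n : ℕ → ℕ} {d : ℝ} (hd : d ≠ 0)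
    (hL : Tendsto L atTop atTop) (hD : Tendsto (fun i => D i / L i) atTop (𝓝 d))
    (hn : Tendsto (fun i => (n i : ℝ) / L i ^ 2) atTop (𝓝 0)) (c : ℝ) :
    Tendsto (fun i => L i * ((1 / 2 + c * Real.sqrt (n i)) / D i ^ 2)) atTop (𝓝 0) := by
  have hLpos : ∀ᶠ i in atTop, 0 < L i := hL.eventually_gt_atTop 0
  have hLinv := tendsto_inv_atTop_zero.comp hL
  have h1 := (Real.continuous_sqrt.tendsto _).comp hn
  rw [Real.sqrt_zero] at h1
  have h2 := ((hLinv.const_mul (1 / 2)).add (h1.const_mul c)).div (hD.pow 2) (pow_ne_zero 2 hd)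
  rw [mul_zero, mul_zero, add_zero, zero_div] at h2
  refine h2.congr' ?_
  filter_upwards [hLpos, hD.eventually_ne hd] with i hi h3
  have : D i ≠ 0 := fun h => h3 (by rw [h, zero_div])
  simp only [Function.comp, Pi.div_apply]
  rw [Real.sqrt_div (by positivity), Real.sqrt_sq hi.le]
  field_simp

theorem abs_trig_integral_le {n : ℕ} (hn : 1 ≤ n) {A B : ℝ} (h1 : A - B ≠ 0) (h2 : A + B ≠ 0) :
    |2 / Real.pi * ∫ δ in (0 : ℝ)..Real.pi, Real.sin (A * δ) * Real.sin (B * δ) *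
        Real.cos (δ / 2) ^ n|
      ≤ (1 / 2 + Real.sqrt (2 * Real.pi ^ 3) / 2 * Real.sqrt n) / (A - B) ^ 2
        + (1 / 2 + Real.sqrt (2 * Real.pi ^ 3) / 2 * Real.sqrt n) / (A + B) ^ 2 := by
  have e : ∀ δ : ℝ, Real.sin (A * δ) * Real.sin (B * δ) * Real.cos (δ / 2) ^ n
      = (Real.cos ((A - B) * δ) * Real.cos (δ / 2) ^ n
        - Real.cos ((A + B) * δ) * Real.cos (δ / 2) ^ n) / 2 := by
    intro δ; rw [sin_mul_sin_eq, ← sub_mul A, ← add_mul]; ring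
  simp_rw [e]
  rw [intervalIntegral.integral_div, intervalIntegral.integral_sub
    (Continuous.intervalIntegrable (by fun_prop) _ _)
    (Continuous.intervalIntegrable (by fun_prop) _ _)]
  have i1 := abs_integral_cos_mul_cos_pow_le_sqrt hn h1
  have i2 := abs_integral_cos_mul_cos_pow_le_sqrt hn h2
  set I1 := ∫ δ in (0 : ℝ)..Real.pi, Real.cos ((A - B) * δ) * Real.cos (δ / 2) ^ n
  set I2 := ∫ δ in (0 : ℝ)..Real.pi, Real.cos ((A + B) * δ) * Real.cos (δ / 2) ^ n
  have i3 := abs_sub I1 I2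
  have i4 : 2 / Real.pi * ((I1 - I2) / 2) = (I1 - I2) / Real.pi := by
    field_simp
  rw [i4, abs_div, abs_of_pos Real.pi_pos]
  calc _ ≤ |I1 - I2| := div_le_self (abs_nonneg _) (by linarith [Real.pi_gt_three])
    _ ≤ _ := by linarith

/-! ### Limit of the single integral. -/

/-- The scaled single integral of the correlation kernel. -/
def staticTerm (L : ℝ) (k s m t : ℕ) : ℝ :=
  if m ≤ k then L * (2 / Real.pi * ∫ δ in (0 : ℝ)..Real.pi, Real.sin (sineFreq k s * δ) *
        Real.sin (sineFreq m t * δ) * Real.cos (δ / 2) ^ (k - m)) else 0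

/-- The Gaussian part of the Pearcey kernel. -/
def gaussTerm (ν₁ η₁ ν₂ η₂ : ℝ) : ℝ :=
  if η₂ < η₁ then 1 / Real.sqrt (Real.pi * (η₁ - η₂)) *
        (Real.exp ((ν₁ - ν₂) ^ 2 / (η₂ - η₁)) - Real.exp ((ν₁ + ν₂) ^ 2 / (η₂ - η₁))) else 0

theorem staticTerm_self (L : ℝ) (k s t : ℕ) :
    staticTerm L k s k t = if s = t then L else 0 := by
  unfold staticTerm
  rw [if_pos le_rfl, integral_sin_mul_sin_eq]
  split_ifs <;> simp

theorem tendsto_staticTerm {L : ℕ → ℝ} {k₁ k₂ s₁ s₂ : ℕ → ℕ} {ν₁ ν₂ η₁ η₂ : ℝ}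
    (hν₁ : 0 < ν₁) (hν₂ : 0 < ν₂) (hL : Tendsto L atTop atTop)
    (hs₁ : Tendsto (fun i => (s₁ i : ℝ) / L i) atTop (𝓝 ν₁))
    (hs₂ : Tendsto (fun i => (s₂ i : ℝ) / L i) atTop (𝓝 ν₂))
    (hk : Tendsto (fun i => ((k₁ i : ℝ) - k₂ i) / L i ^ 2) atTop (𝓝 (2 * (η₁ - η₂))))
    (hne : (ν₁, η₁) ≠ (ν₂, η₂) ∨
        (∀ᶠ i in atTop, k₁ i < k₂ i ∨ (k₁ i = k₂ i ∧ s₁ i ≠ s₂ i))) :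
    Tendsto (fun i => staticTerm (L i) (k₁ i) (s₁ i) (k₂ i) (s₂ i)) atTop
      (𝓝 (gaussTerm ν₁ η₁ ν₂ η₂)) := by
  have hLpos : ∀ᶠ i in atTop, 0 < L i := hL.eventually_gt_atTop 0
  have hA := tendsto_sineFreq_div (k := k₁) hL hs₁
  have hB := tendsto_sineFreq_div (k := k₂) hL hs₂
  rcases lt_trichotomy η₂ η₁ with hη | hη | hη
  · have hge : ∀ᶠ i in atTop, k₂ i ≤ k₁ i := by
      filter_upwards [hLpos, hk.eventually_const_lt (u := 0) (by linarith)] with i hi h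
      have h2 : 0 < (k₁ i : ℝ) - k₂ i := by
        by_contra hcon
        exact absurd h (not_lt.2 (div_nonpos_of_nonpos_of_nonneg (not_lt.1 hcon) (by positivity)))
      have h3 : (k₂ i : ℝ) < k₁ i := by linarith
      exact_mod_cast h3.le
    have hn : Tendsto (fun i => ((k₁ i - k₂ i : ℕ) : ℝ) / L i ^ 2) atTop (𝓝 (2 * (η₁ - η₂))) := by
      refine hk.congr' ?_
      filter_upwards [hge] with i hi
      rw [Nat.cast_sub hi]
    have hfin := tendsto_trig_integral_gaussian (sub_pos.2 hη) hL hA hB hn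
    have e : gaussTerm ν₁ η₁ ν₂ η₂ = 1 / Real.sqrt (Real.pi * (η₁ - η₂)) *
        (Real.exp (-(ν₁ - ν₂) ^ 2 / (η₁ - η₂)) - Real.exp (-(ν₁ + ν₂) ^ 2 / (η₁ - η₂))) := by
      unfold gaussTerm
      rw [if_pos hη, ← neg_sub η₁ η₂, div_neg, div_neg, neg_div, neg_div]
    rw [e]
    refine hfin.congr' ?_
    filter_upwards [hge] with i hi
    rw [staticTerm, if_pos hi]
  · subst hη
    have e : gaussTerm ν₁ η₂ ν₂ η₂ = 0 := by simp [gaussTerm]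
    rw [e]
    rcases hne with hne | hne
    · have hνν : ν₁ ≠ ν₂ := fun h => hne (by rw [h])
      have hs12 : ∀ᶠ i in atTop, s₁ i ≠ s₂ i := by
        have := (hs₁.sub hs₂).eventually_ne (sub_ne_zero.2 hνν)
        filter_upwards [this] with i hi h
        exact hi (by rw [h, sub_self])
      -- The order of the levels is undetermined when `η₁ = η₂`; the truncated difference is at most
      -- `|k₁ - k₂|` in every case.
      have hk0 : Tendsto (fun i => ((k₁ i - k₂ i : ℕ) : ℝ) / L i ^ 2) atTop (𝓝 0) := by
        rw [sub_self, mul_zero] at hk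
        have hk' := hk.norm
        rw [norm_zero] at hk'
        refine squeeze_zero (fun i => by positivity) (fun i => ?_) hk'
        rw [norm_div, Real.norm_eq_abs, Real.norm_of_nonneg (sq_nonneg (L i))]
        gcongr
        rcases le_total (k₂ i) (k₁ i) with h | h
        · rw [Nat.cast_sub h]; exact le_abs_self _
        · rw [Nat.sub_eq_zero_of_le h, Nat.cast_zero]; exact abs_nonneg _
      have hD1 := hA.sub hB
      have hD2 := hA.add hB
      have hd1 : ν₁ - ν₂ ≠ 0 := sub_ne_zero.2 hνν
      have hd2 : ν₁ + ν₂ ≠ 0 := by positivity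
      simp_rw [← sub_div] at hD1
      simp_rw [← add_div] at hD2
      have b1 := tendsto_sqrt_mul_div_sq hd1 hL hD1 hk0 (Real.sqrt (2 * Real.pi ^ 3) / 2)
      have b2 := tendsto_sqrt_mul_div_sq hd2 hL hD2 hk0 (Real.sqrt (2 * Real.pi ^ 3) / 2)
      have b3 := b1.add b2
      rw [add_zero] at b3
      refine squeeze_zero_norm' ?_ b3
      filter_upwards [hLpos, hs12, hD1.eventually_ne hd1, hD2.eventually_ne hd2] with i hi h1 h2 h3
      have h2' : sineFreq (k₁ i) (s₁ i) - sineFreq (k₂ i) (s₂ i) ≠ 0 :=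
        fun h => h2 (by rw [h, zero_div])
      have h3' : sineFreq (k₁ i) (s₁ i) + sineFreq (k₂ i) (s₂ i) ≠ 0 :=
        fun h => h3 (by rw [h, zero_div])
      have hnn : 0 ≤ L i * ((1 / 2 + Real.sqrt (2 * Real.pi ^ 3) / 2 * Real.sqrt ((k₁ i - k₂ i : ℕ) : ℝ)) /
          (sineFreq (k₁ i) (s₁ i) - sineFreq (k₂ i) (s₂ i)) ^ 2) +
          L i * ((1 / 2 + Real.sqrt (2 * Real.pi ^ 3) / 2 * Real.sqrt ((k₁ i - k₂ i : ℕ) : ℝ)) /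
          (sineFreq (k₁ i) (s₁ i) + sineFreq (k₂ i) (s₂ i)) ^ 2) := by positivity
      -- The oscillation bound needs exponent at least `1`; on equal levels orthogonality replaces
      -- it.
      rcases lt_trichotomy (k₁ i) (k₂ i) with hlt | heq | hgt
      · rw [staticTerm, if_neg (by omega), norm_zero]; exact hnn
      · have : staticTerm (L i) (k₁ i) (s₁ i) (k₂ i) (s₂ i) = 0 := by
          rw [← heq, staticTerm_self, if_neg h1]
        rw [this, norm_zero]; exact hnn
      · rw [staticTerm, if_pos hgt.le, norm_mul, Real.norm_of_nonneg hi.le, ← mul_add]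
        gcongr
        exact abs_trig_integral_le (by omega) h2' h3'
    · refine tendsto_const_nhds.congr' ?_
      filter_upwards [hne] with i hi
      rcases hi with hi | ⟨h1, h2⟩
      · rw [staticTerm, if_neg (by omega)]
      · rw [← h1, staticTerm_self, if_neg h2]
  · have e : gaussTerm ν₁ η₁ ν₂ η₂ = 0 := by
      rw [gaussTerm, if_neg (by linarith)]
    rw [e]
    refine tendsto_const_nhds.congr' ?_
    filter_upwards [hLpos, hk.eventually_lt_const (u := 0) (by linarith)] with i hi h
    have h2 : (k₁ i : ℝ) - k₂ i < 0 := by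
      by_contra hcon
      exact absurd h (not_lt.2 (div_nonneg (not_lt.1 hcon) (by positivity)))
    have h3 : (k₁ i : ℝ) < k₂ i := by linarith
    have h4 : k₁ i < k₂ i := by exact_mod_cast h3
    rw [staticTerm, if_neg (by omega)]

/-! ### Pointwise limit of the rescaled double integrand. -/

/-- The point `e^{-iy/(2L²)}` of the unit circle. -/
def circlePt (L y : ℝ) : ℂ := Complex.exp (((-(y / (2 * L ^ 2)) : ℝ) : ℂ) * Complex.I)

/-- The integrand of the double integral in the variables of the edge scaling. -/
def scaledIntegrand (κ L : ℝ) (T k s m t : ℕ) (X y : ℝ) : ℂ :=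
  circlePt L y *
    (((1 - X / (2 * L ^ 2)) ^ ((rIdx k : ℝ) + aIdx k) / (1 - κ * (X / (2 * L ^ 2))) ^ T : ℝ) : ℂ) *
    ((1 + (κ : ℂ) * (circlePt L y - 1)) ^ T / circlePt L y ^ rIdx m) *
    (jacobiScaled k s (-1 + ((X / L ^ 2 : ℝ) : ℂ)) / (L : ℂ)) *
    (jacobiScaled m t (-1 + 2 * (1 - circlePt L y)) / (L : ℂ)) *
    ((Real.sqrt X : ℂ) / ((L : ℂ) ^ 2 * (2 * (1 - circlePt L y) - ((X / L ^ 2 : ℝ) : ℂ))))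

/-- The integrand of the Pearcey kernel. -/
def pearceyIntegrand (ν₁ η₁ ν₂ η₂ X y : ℝ) : ℂ :=
  Complex.exp (((Complex.I * y) ^ 2 - (X : ℂ) ^ 2) / 8
            + ((η₂ : ℂ) * (Complex.I * y) - (η₁ : ℂ) * X) / 2) *
          Complex.sin ((ν₁ : ℂ) * (Real.sqrt (2 * X) : ℂ)) *
          Complex.sin ((ν₂ : ℂ) * ((Real.sqrt 2 : ℂ) * (Complex.I * y) ^ (1 / 2 : ℂ))) /
          ((Complex.I * y) ^ (1 / 2 : ℂ) * (Complex.I * y - X))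

theorem abs_aIdx_le (k : ℕ) : |aIdx k| ≤ 1 / 2 := by
  unfold aIdx; split_ifs
  · rw [abs_le]; norm_num
  · rw [abs_le]; norm_num

theorem circlePt_ne_zero (L y : ℝ) : circlePt L y ≠ 0 := Complex.exp_ne_zero _

theorem norm_circlePt (L y : ℝ) : ‖circlePt L y‖ = 1 := Complex.norm_exp_ofReal_mul_I _

theorem tendsto_circlePt {L : ℕ → ℝ} (hL : Tendsto L atTop atTop) (y : ℝ) :
    Tendsto (fun i => (L i : ℂ) ^ 2 * (circlePt (L i) y - 1)) atTop (𝓝 (-(Complex.I * y / 2))) := by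
  have hLpos : ∀ᶠ i in atTop, 0 < L i := hL.eventually_gt_atTop 0
  by_cases hy : y = 0
  · subst hy; simp [circlePt]
  have hLinv : Tendsto (fun i => ((L i : ℂ) ^ 2)⁻¹) atTop (𝓝 0) := by
    have := (Complex.continuous_ofReal.tendsto 0).comp (tendsto_inv_atTop_zero.comp hL)
    have := this.pow 2
    simpa [Function.comp_def] using this
  have hb : Tendsto (fun i => ((-(y / (2 * L i ^ 2)) : ℝ) : ℂ) * Complex.I) atTop (𝓝 0) := by
    have := hLinv.const_mul (-(y / 2 : ℂ) * Complex.I)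
    rw [mul_zero] at this
    refine this.congr fun i => ?_
    push_cast
    ring
  have h1 := hasDerivAt_iff_tendsto_slope.1 (Complex.hasDerivAt_exp 0)
  have hne : ∀ᶠ i in atTop, ((-(y / (2 * L i ^ 2)) : ℝ) : ℂ) * Complex.I ∈ ({0}ᶜ : Set ℂ) := by
    filter_upwards [hLpos] with i hi
    have : (-(y / (2 * L i ^ 2)) : ℝ) ≠ 0 := neg_ne_zero.2 (div_ne_zero hy (by positivity))
    exact mul_ne_zero (by exact_mod_cast this) Complex.I_ne_zero
  have h2 := h1.comp (tendsto_nhdsWithin_iff.2 ⟨hb, hne⟩)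
  have h3 := h2.const_mul (-(Complex.I * y / 2))
  rw [Complex.exp_zero, mul_one] at h3
  refine h3.congr' ?_
  filter_upwards [hLpos] with i hi
  have hLi : (L i : ℂ) ≠ 0 := by exact_mod_cast hi.ne'
  have hyC : (y : ℂ) ≠ 0 := by exact_mod_cast hy
  simp only [Function.comp, slope_def_field, Complex.exp_zero, sub_zero]
  unfold circlePt
  generalize Complex.exp (((-(y / (2 * L i ^ 2)) : ℝ) : ℂ) * Complex.I) = E
  push_cast
  have := Complex.I_ne_zero
  field_simp

theorem tendsto_circlePt_one {L : ℕ → ℝ} (hL : Tendsto L atTop atTop) (y : ℝ) :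
    Tendsto (fun i => circlePt (L i) y) atTop (𝓝 1) := by
  have hLpos : ∀ᶠ i in atTop, 0 < L i := hL.eventually_gt_atTop 0
  have hLinv : Tendsto (fun i => ((L i : ℂ) ^ 2)⁻¹) atTop (𝓝 0) := by
    have := (Complex.continuous_ofReal.tendsto 0).comp (tendsto_inv_atTop_zero.comp hL)
    have := this.pow 2
    simpa [Function.comp_def] using this
  have h := (hLinv.mul (tendsto_circlePt hL y)).const_add 1
  rw [zero_mul, add_zero] at h
  refine h.congr' ?_
  filter_upwards [hLpos] with i hi
  have hLi : (L i : ℂ) ≠ 0 := by exact_mod_cast hi.ne'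
  field_simp
  ring

/-- The hypotheses of the edge scaling regime. -/
structure EdgeRegime (κ : ℝ) (L : ℕ → ℝ) (T k₁ s₁ k₂ s₂ : ℕ → ℕ) (ν₁ η₁ ν₂ η₂ : ℝ) : Prop where
  pos : 0 < κ
  lt_one : κ < 1
  tendsto_L : Tendsto L atTop atTop
  tendsto_T : Tendsto (fun i => κ * (1 - κ) * T i / L i ^ 4) atTop (𝓝 1)
  tendsto_s₁ : Tendsto (fun i => (s₁ i : ℝ) / L i) atTop (𝓝 ν₁)
  tendsto_s₂ : Tendsto (fun i => (s₂ i : ℝ) / L i) atTop (𝓝 ν₂)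
  tendsto_r₁ : Tendsto (fun i => ((rIdx (k₁ i) : ℝ) - κ * T i) / L i ^ 2) atTop (𝓝 η₁)
  tendsto_r₂ : Tendsto (fun i => ((rIdx (k₂ i) : ℝ) - κ * T i) / L i ^ 2) atTop (𝓝 η₂)

section

variable {κ : ℝ} {L : ℕ → ℝ} {T k₁ s₁ k₂ s₂ : ℕ → ℕ} {ν₁ η₁ ν₂ η₂ : ℝ}

theorem EdgeRegime.eventually_pos (h : EdgeRegime κ L T k₁ s₁ k₂ s₂ ν₁ η₁ ν₂ η₂) :
    ∀ᶠ i in atTop, 0 < L i := h.tendsto_L.eventually_gt_atTop 0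

theorem EdgeRegime.tendsto_ρ (h : EdgeRegime κ L T k₁ s₁ k₂ s₂ ν₁ η₁ ν₂ η₂) :
    Tendsto (fun i => ((rIdx (k₁ i) : ℝ) + aIdx (k₁ i) - κ * T i) / L i ^ 2) atTop (𝓝 η₁) := by
  have hLinv := (tendsto_inv_atTop_zero.comp h.tendsto_L).pow 2
  rw [zero_pow two_ne_zero] at hLinv
  have h1 : Tendsto (fun i => aIdx (k₁ i) / L i ^ 2) atTop (𝓝 0) := by
    refine squeeze_zero_norm (fun i => ?_) hLinv
    rw [norm_div, Real.norm_eq_abs, Real.norm_of_nonneg (sq_nonneg (L i))]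
    simp only [Function.comp]
    rw [inv_pow, inv_eq_one_div]
    gcongr
    linarith [abs_aIdx_le (k₁ i)]
  have h2 := h.tendsto_r₁.add h1
  rw [add_zero] at h2
  refine h2.congr fun i => ?_
  ring

/-- `tendsto_phase` with `z = -X/(2L²)`, hence `Z = -X/2`; the sign is reversed because the `x`
phase is the reciprocal of the `u` phase. -/
theorem EdgeRegime.tendsto_phase₁ (h : EdgeRegime κ L T k₁ s₁ k₂ s₂ ν₁ η₁ ν₂ η₂) {X : ℝ}
    (hX : 0 < X) :
    Tendsto (fun i => ((((1 - X / (2 * L i ^ 2)) ^ ((rIdx (k₁ i) : ℝ) + aIdx (k₁ i)) /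
      (1 - κ * (X / (2 * L i ^ 2))) ^ T i : ℝ)) : ℂ)) atTop
      (𝓝 (Complex.exp (-(X ^ 2 / 8 + η₁ * X / 2)))) := by
  have hκκ : κ * (1 - κ) ≠ 0 := mul_ne_zero h.pos.ne' (by linarith [h.lt_one])
  have hLinv := (tendsto_inv_atTop_zero.comp h.tendsto_L).pow 2
  rw [zero_pow two_ne_zero] at hLinv
  have hz : Tendsto (fun i => (L i : ℂ) ^ 2 * ((-(X / (2 * L i ^ 2)) : ℝ) : ℂ)) atTop
      (𝓝 (-(X / 2) : ℂ)) := by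
    refine tendsto_const_nhds.congr' ?_
    filter_upwards [h.eventually_pos] with i hi
    have hLi : (L i : ℂ) ≠ 0 := by exact_mod_cast hi.ne'
    push_cast
    field_simp
  have h1 := tendsto_phase hκκ h.tendsto_L h.tendsto_T h.tendsto_ρ hz
  have h2 := (Complex.continuous_exp.tendsto _).comp h1.neg
  have e : -((-(X / 2) : ℂ) ^ 2 / 2 - η₁ * -(X / 2)) = -(X ^ 2 / 8 + η₁ * X / 2) := by ring
  rw [e] at h2
  refine h2.congr' ?_
  have hp0 : Tendsto (fun i => X / (2 * L i ^ 2)) atTop (𝓝 0) := by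
    have := hLinv.const_mul (X / 2)
    rw [mul_zero] at this
    refine this.congr fun i => ?_
    simp only [Function.comp]
    ring
  have hp1 := hp0.eventually_lt_const (u := 1) (by norm_num)
  filter_upwards [h.eventually_pos, hp1] with i hi hp
  have hpp : 0 < X / (2 * L i ^ 2) := by positivity
  simp only [Function.comp]
  generalize X / (2 * L i ^ 2) = p at *
  have h3 : 0 < 1 - p := by linarith
  have h4 : 0 < 1 - κ * p := by nlinarith [h.lt_one, h.pos]
  have e1 : Complex.log (1 + ((-p : ℝ) : ℂ)) = ((Real.log (1 - p) : ℝ) : ℂ) := by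
    rw [Complex.ofReal_log h3.le]; push_cast; rfl
  have e2 : Complex.log (1 + (κ : ℂ) * ((-p : ℝ) : ℂ)) = ((Real.log (1 - κ * p) : ℝ) : ℂ) := by
    rw [Complex.ofReal_log h4.le]; push_cast; congr 1; ring
  rw [e1, e2]
  have e3 : (1 - p) ^ ((rIdx (k₁ i) : ℝ) + aIdx (k₁ i)) / (1 - κ * p) ^ T i
      = Real.exp (-((T i : ℝ) * Real.log (1 - κ * p)
        - ((rIdx (k₁ i) : ℝ) + aIdx (k₁ i)) * Real.log (1 - p))) := by
    rw [neg_sub, Real.exp_sub, Real.rpow_def_of_pos h3, mul_comm (Real.log _), ← Real.log_pow,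
      Real.exp_log (by positivity)]
  rw [e3]
  push_cast
  rfl

theorem EdgeRegime.tendsto_phase₂ (h : EdgeRegime κ L T k₁ s₁ k₂ s₂ ν₁ η₁ ν₂ η₂) (y : ℝ) :
    Tendsto (fun i => (1 + (κ : ℂ) * (circlePt (L i) y - 1)) ^ T i / circlePt (L i) y ^ rIdx (k₂ i))
      atTop (𝓝 (Complex.exp ((Complex.I * y) ^ 2 / 8 + η₂ * (Complex.I * y) / 2))) := by
  have hκκ : κ * (1 - κ) ≠ 0 := mul_ne_zero h.pos.ne' (by linarith [h.lt_one])
  have h1 := tendsto_phase hκκ h.tendsto_L h.tendsto_T h.tendsto_r₂ (tendsto_circlePt h.tendsto_L y)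
  have h2 := (Complex.continuous_exp.tendsto _).comp h1
  have e : (-(Complex.I * y / 2)) ^ 2 / 2 - (η₂ : ℂ) * -(Complex.I * y / 2)
      = (Complex.I * y) ^ 2 / 8 + η₂ * (Complex.I * y) / 2 := by ring
  rw [e] at h2
  refine h2.congr' ?_
  have h3 : Tendsto (fun i => 1 + (κ : ℂ) * (circlePt (L i) y - 1)) atTop (𝓝 1) := by
    have := (((tendsto_circlePt_one h.tendsto_L y).sub_const 1).const_mul (κ : ℂ)).const_add 1
    simpa using this
  filter_upwards [h3.eventually_ne one_ne_zero] with i hi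
  simp only [Function.comp]
  rw [Complex.exp_sub]
  have e1 : ((T i : ℝ) : ℂ) = (T i : ℂ) := by push_cast; rfl
  have e2 : ((rIdx (k₂ i) : ℝ) : ℂ) = (rIdx (k₂ i) : ℂ) := by push_cast; rfl
  rw [e1, e2, Complex.exp_nat_mul, Complex.exp_nat_mul, Complex.exp_log hi, add_sub_cancel,
    Complex.exp_log (circlePt_ne_zero _ _)]

/-- The factors converge one by one. `y ≠ 0` keeps the limiting denominator `iy - X` and the root
`w` of `iy` away from zero. -/
theorem EdgeRegime.tendsto_scaledIntegrand (h : EdgeRegime κ L T k₁ s₁ k₂ s₂ ν₁ η₁ ν₂ η₂)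
    {X y : ℝ} (hX : 0 < X) (hy : y ≠ 0) :
    Tendsto (fun i => scaledIntegrand κ (L i) (T i) (k₁ i) (s₁ i) (k₂ i) (s₂ i) X y) atTop
      (𝓝 (pearceyIntegrand ν₁ η₁ ν₂ η₂ X y)) := by
  have hyC : (Complex.I * y : ℂ) ≠ 0 := mul_ne_zero Complex.I_ne_zero (by exact_mod_cast hy)
  set w : ℂ := (Complex.I * y) ^ (1 / 2 : ℂ) with hw
  have hw2 : w ^ 2 = Complex.I * y := by
    rw [hw, ← Complex.cpow_nat_mul]; simp
  have hw0 : w ≠ 0 := by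
    intro h0; rw [h0] at hw2; apply hyC; rw [← hw2]; simp
  have hX2 : ((Real.sqrt X : ℝ) : ℂ) ^ 2 = X := by
    rw [← Complex.ofReal_pow, Real.sq_sqrt hX.le]
  have hX0 : ((Real.sqrt X : ℝ) : ℂ) ≠ 0 := by
    exact_mod_cast (Real.sqrt_pos.2 hX).ne'
  have c1 := tendsto_circlePt_one h.tendsto_L y
  have c2 := h.tendsto_phase₁ hX
  have c3 := h.tendsto_phase₂ y
  have z1 : Tendsto (fun i => (L i : ℂ) ^ 2 * ((X / L i ^ 2 : ℝ) : ℂ)) atTop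
      (𝓝 (((Real.sqrt X : ℝ) : ℂ) ^ 2)) := by
    rw [hX2]
    refine tendsto_const_nhds.congr' ?_
    filter_upwards [h.eventually_pos] with i hi
    have hLi : (L i : ℂ) ≠ 0 := by exact_mod_cast hi.ne'
    push_cast
    field_simp
  have z2 : Tendsto (fun i => (L i : ℂ) ^ 2 * (2 * (1 - circlePt (L i) y))) atTop (𝓝 (w ^ 2)) := by
    rw [hw2]
    have := (tendsto_circlePt h.tendsto_L y).const_mul (-2)
    rw [show (-2 : ℂ) * -(Complex.I * y / 2) = Complex.I * y by ring] at this
    refine this.congr fun i => ?_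
    ring
  have c4 := tendsto_jacobiScaled_edge (k := k₁) hX0 h.tendsto_L h.tendsto_s₁ z1
  have c5 := tendsto_jacobiScaled_edge (k := k₂) hw0 h.tendsto_L h.tendsto_s₂ z2
  have hden : Complex.I * y - X ≠ 0 := by
    intro h0
    have := congrArg Complex.im h0
    simp at this
    exact hy this
  have c6 : Tendsto (fun i => (Real.sqrt X : ℂ) / ((L i : ℂ) ^ 2 * (2 * (1 - circlePt (L i) y)
      - ((X / L i ^ 2 : ℝ) : ℂ)))) atTop (𝓝 ((Real.sqrt X : ℂ) / (Complex.I * y - X))) := by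
    have := z2.sub z1
    rw [hw2, hX2] at this
    refine Tendsto.div tendsto_const_nhds (this.congr fun i => ?_) hden
    ring
  have hfin := ((((c1.mul c2).mul c3).mul c4).mul c5).mul c6
  refine (hfin.congr fun i => rfl).trans (le_of_eq (congrArg 𝓝 ?_))
  unfold pearceyIntegrand
  rw [Real.sqrt_mul (by norm_num), ← hw, one_mul]
  have e : ((Complex.I * y) ^ 2 - (X : ℂ) ^ 2) / 8
            + ((η₂ : ℂ) * (Complex.I * y) - (η₁ : ℂ) * X) / 2
      = -(X ^ 2 / 8 + η₁ * X / 2) + ((Complex.I * y) ^ 2 / 8 + η₂ * (Complex.I * y) / 2) := by ring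
  rw [e, Complex.exp_add (-((X : ℂ) ^ 2 / 8 + η₁ * X / 2))]
  generalize Complex.exp (-((X : ℂ) ^ 2 / 8 + η₁ * X / 2)) = E₁
  generalize Complex.exp ((Complex.I * y) ^ 2 / 8 + η₂ * (Complex.I * y) / 2) = E₂
  push_cast
  field_simp

end

/-! ### Domination and convergence of the double integral. -/

theorem continuous_jacobiScaled (k t : ℕ) : Continuous (jacobiScaled k t) := by
  unfold jacobiScaled
  fun_prop

theorem continuous_circlePt (L : ℝ) : Continuous (circlePt L) := by
  unfold circlePt
  fun_prop

theorem measurable_scaledIntegrand (κ L : ℝ) (T k s m t : ℕ) :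
    Measurable fun z : ℝ × ℝ => scaledIntegrand κ L T k s m t z.1 z.2 := by
  have h1 : Measurable fun z : ℝ × ℝ => circlePt L z.2 :=
    ((continuous_circlePt L).comp continuous_snd).measurable
  have h2 : Measurable fun z : ℝ × ℝ => jacobiScaled k s (-1 + ((z.1 / L ^ 2 : ℝ) : ℂ)) :=
    ((continuous_jacobiScaled k s).comp (by fun_prop)).measurable
  have h3 : Measurable fun z : ℝ × ℝ => jacobiScaled m t (-1 + 2 * (1 - circlePt L z.2)) :=
    (continuous_jacobiScaled m t).measurable.comp (by fun_prop)
  unfold scaledIntegrand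
  fun_prop

theorem norm_jacobiScaled_div_le {L M Y : ℝ} {k t : ℕ} {ζ : ℂ} (hL : 0 < L)
    (hM : ((t : ℝ) + 1) / L ≤ M) (hY : ‖ζ‖ ≤ Y / L ^ 2) :
    ‖jacobiScaled k t (-1 + ζ) / (L : ℂ)‖ ≤ 4 * M * Real.exp (M * Real.sqrt (2 * Y)) := by
  have hM0 : 0 ≤ M := le_trans (by positivity) hM
  have hMt : (t : ℝ) / L ≤ M := le_trans (by gcongr; linarith) hM
  rw [norm_div, Complex.norm_real, Real.norm_of_nonneg hL.le]
  have h1 : t * Real.sqrt (2 * ‖ζ‖) ≤ M * Real.sqrt (2 * Y) := by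
    calc t * Real.sqrt (2 * ‖ζ‖) ≤ t * Real.sqrt (2 * (Y / L ^ 2)) := by gcongr
      _ = t / L * Real.sqrt (2 * Y) := by
        rw [← mul_div_assoc, Real.sqrt_div' _ (by positivity), Real.sqrt_sq hL.le]
        ring
      _ ≤ _ := by gcongr
  calc ‖jacobiScaled k t (-1 + ζ)‖ / L
      ≤ (4 * (t + 1) * Real.exp (t * Real.sqrt (2 * ‖ζ‖))) / L := by
        gcongr
        exact norm_jacobiScaled_le k t ζ
    _ = 4 * ((t + 1) / L) * Real.exp (t * Real.sqrt (2 * ‖ζ‖)) := by ring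
    _ ≤ _ := by gcongr

theorem norm_one_sub_circlePt_le (L y : ℝ) : ‖2 * (1 - circlePt L y)‖ ≤ |y| / L ^ 2 := by
  rw [norm_mul, Complex.norm_ofNat, norm_sub_rev]
  have h := Real.norm_exp_I_mul_ofReal_sub_one_le (x := -(y / (2 * L ^ 2)))
  have e : circlePt L y = Complex.exp (Complex.I * ((-(y / (2 * L ^ 2)) : ℝ) : ℂ)) := by
    rw [circlePt, mul_comm]
  rw [e]
  rw [norm_neg, Real.norm_eq_abs, abs_div, abs_of_nonneg (by positivity : 0 ≤ 2 * L ^ 2)] at h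
  calc _ ≤ 2 * (|y| / (2 * L ^ 2)) := by gcongr
    _ = _ := by
      rw [← mul_div_assoc, mul_div_mul_left _ _ two_ne_zero]

/-- The factor `√X` from the weight cancels the one in the distance bound `sqrt_le_norm_exp_sub`,
leaving `|y|^{-1/2}`, which is integrable at `0`. -/
theorem norm_sqrt_div_le {L X y : ℝ} (hL : 0 < L) (hX0 : 0 < X) (hX1 : X < 2 * L ^ 2)
    (hy0 : y ≠ 0) (hy : |y| ≤ 2 * Real.pi * L ^ 2) :
    ‖(Real.sqrt X : ℂ) / ((L : ℂ) ^ 2 * (2 * (1 - circlePt L y) - ((X / L ^ 2 : ℝ) : ℂ)))‖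
      ≤ 3 * |y| ^ (-1 / 2 : ℝ) := by
  have hL2 : 0 < 2 * L ^ 2 := by positivity
  have hya : 0 < |y| := abs_pos.2 hy0
  have h1 := sqrt_le_norm_exp_sub (p := X / (2 * L ^ 2)) (ψ := -(y / (2 * L ^ 2))) (by positivity)
    ((div_le_one hL2).2 hX1.le) (by
      rw [abs_neg, abs_div, abs_of_pos hL2, div_le_iff₀ hL2]; linarith)
  change _ ≤ ‖circlePt L y - (1 - ((X / (2 * L ^ 2) : ℝ) : ℂ))‖ at h1
  have e1 : 2 * (1 - circlePt L y) - ((X / L ^ 2 : ℝ) : ℂ)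
      = -2 * (circlePt L y - (1 - ((X / (2 * L ^ 2) : ℝ) : ℂ))) := by
    push_cast
    have : (L : ℂ) ≠ 0 := by exact_mod_cast hL.ne'
    field_simp
    ring
  rw [e1, norm_div, norm_mul, norm_mul, norm_neg, Complex.norm_ofNat, norm_pow, Complex.norm_real,
    Complex.norm_real, Real.norm_of_nonneg (Real.sqrt_nonneg _), Real.norm_of_nonneg hL.le]
  have e2 : Real.sqrt (X / (2 * L ^ 2) * |(-(y / (2 * L ^ 2)))| / 8)
      = Real.sqrt X * Real.sqrt |y| / (Real.sqrt 32 * L ^ 2) := by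
    rw [abs_neg, abs_div, abs_of_pos hL2, ← Real.sqrt_mul hX0.le]
    rw [eq_div_iff (by positivity)]
    have : L ^ 2 = Real.sqrt ((L ^ 2) ^ 2) := (Real.sqrt_sq (by positivity)).symm
    nth_rewrite 3 [this]
    rw [← Real.sqrt_mul (by norm_num), ← Real.sqrt_mul (by positivity)]
    congr 1
    field_simp
    norm_num
  rw [e2] at h1
  have hs32 : Real.sqrt 32 ≤ 6 := by
    rw [Real.sqrt_le_left (by norm_num)]; norm_num
  have hsX : 0 < Real.sqrt X := Real.sqrt_pos.2 hX0
  have hsy : 0 < Real.sqrt |y| := Real.sqrt_pos.2 hya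
  have e3 : |y| ^ (-1 / 2 : ℝ) = (Real.sqrt |y|)⁻¹ := by
    rw [Real.sqrt_eq_rpow, ← Real.rpow_neg hya.le]; norm_num
  rw [e3]
  calc Real.sqrt X / (L ^ 2 * (2 * ‖circlePt L y - (1 - ((X / (2 * L ^ 2) : ℝ) : ℂ))‖))
      ≤ Real.sqrt X / (L ^ 2 * (2 * (Real.sqrt X * Real.sqrt |y| / (Real.sqrt 32 * L ^ 2)))) := by
        gcongr
    _ = Real.sqrt 32 / 2 * (Real.sqrt |y|)⁻¹ := by
        field_simp
    _ ≤ _ := by gcongr; linarith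

theorem sqrt_two_mul_le {X : ℝ} (hX : 0 ≤ X) : Real.sqrt (2 * X) ≤ 1 + X := by
  rw [Real.sqrt_le_left (by positivity)]
  nlinarith

/-- The dominating function. -/
def dominant (C : ℝ) (z : ℝ × ℝ) : ℝ :=
  C * (Real.exp (-(1 / 32) * z.1 ^ 2) *
    (|z.2| ^ (-1 / 2 : ℝ) * Real.exp (-(1 / (8 * Real.pi ^ 2)) * z.2 ^ 2)))

theorem integrable_dominant (C : ℝ) :
    Integrable (dominant C) ((volume.restrict (Ioi (0 : ℝ))).prod volume) := by
  have h1 : Integrable (fun X : ℝ => Real.exp (-(1 / 32) * X ^ 2)) (volume.restrict (Ioi (0 : ℝ))) :=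
    (integrable_exp_neg_mul_sq (by norm_num)).integrableOn
  have h2 := integrable_abs_rpow_mul_exp (δ := 1 / (8 * Real.pi ^ 2)) (by positivity)
  exact (h1.mul_prod h2).const_mul C

section

variable {κ : ℝ} {L : ℕ → ℝ} {T k₁ s₁ k₂ s₂ : ℕ → ℕ} {ν₁ η₁ ν₂ η₂ : ℝ}

theorem eventually_succ_div_le {s : ℕ → ℕ} {ν : ℝ} (hL : Tendsto L atTop atTop)
    (hs : Tendsto (fun i => (s i : ℝ) / L i) atTop (𝓝 ν)) :
    ∀ᶠ i in atTop, ((s i : ℝ) + 1) / L i ≤ |ν| + 1 := by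
  have h := hs.add (tendsto_inv_atTop_zero.comp hL)
  rw [add_zero] at h
  have h1 := h.eventually_lt_const (u := |ν| + 1) (by linarith [le_abs_self ν])
  filter_upwards [h1] with i hi
  simp only [Function.comp] at hi
  rw [add_div, one_div]
  exact hi.le

/-- Domination of the scaled integrand by a fixed integrable function. -/
theorem EdgeRegime.exists_dominant (h : EdgeRegime κ L T k₁ s₁ k₂ s₂ ν₁ η₁ ν₂ η₂) :
    ∃ C : ℝ, 0 ≤ C ∧ ∀ᶠ i in atTop, ∀ X y : ℝ, 0 < X → X < 2 * L i ^ 2 → y ≠ 0 →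
      |y| ≤ 2 * Real.pi * L i ^ 2 →
      ‖scaledIntegrand κ (L i) (T i) (k₁ i) (s₁ i) (k₂ i) (s₂ i) X y‖ ≤ dominant C (X, y) := by
  have hκ1 : 0 < 1 - κ := by linarith [h.lt_one]
  set M : ℝ := |ν₁| + |ν₂| + 1 with hM
  have hM0 : 0 ≤ M := by positivity
  set M' : ℝ := (|η₁| + 1) / (2 * (1 - κ)) with hM'
  have hM'0 : 0 ≤ M' := by positivity
  -- eventual bounds on the parameters
  have hTe : ∀ᶠ i in atTop, 1 / 2 < κ * (1 - κ) * T i / L i ^ 4 :=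
    h.tendsto_T.eventually_const_lt (by norm_num)
  have hρ1 : ∀ᶠ i in atTop, |(rIdx (k₁ i) : ℝ) + aIdx (k₁ i) - κ * T i| ≤ (|η₁| + 1) * L i ^ 2 := by
    have := h.tendsto_ρ.abs.eventually_lt_const (u := |η₁| + 1) (by linarith)
    filter_upwards [this, h.eventually_pos] with i h1 h2
    rw [abs_div, abs_of_nonneg (sq_nonneg (L i)), div_lt_iff₀ (by positivity)] at h1
    exact h1.le
  -- To leading order `ρ` is `κT`, so `(1-κ)ρ/L⁴` has the limit `1` of `κ(1-κ)T/L⁴`.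
  have hρ2 : ∀ᶠ i in atTop, 1 / 2 < (1 - κ) * ((rIdx (k₁ i) : ℝ) + aIdx (k₁ i)) / L i ^ 4 := by
    have hLinv := (tendsto_inv_atTop_zero.comp h.tendsto_L).pow 2
    rw [zero_pow two_ne_zero] at hLinv
    have h1 := ((h.tendsto_ρ.mul hLinv).const_mul (1 - κ)).add h.tendsto_T
    rw [mul_zero, mul_zero, zero_add] at h1
    have h2 : Tendsto (fun i => (1 - κ) * ((rIdx (k₁ i) : ℝ) + aIdx (k₁ i)) / L i ^ 4) atTop (𝓝 1) := by
      refine h1.congr' ?_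
      filter_upwards [h.eventually_pos] with i hi
      simp only [Function.comp]
      field_simp
      ring
    exact h2.eventually_const_lt (by norm_num)
  -- `48 = 4·4·3` from the two polynomials and the pole; `e^{2M}` from using `√(2X) ≤ 1 + X` for `X`
  -- and for `|y|`; the other exponentials from completing squares, which spends half of each
  -- Gaussian rate `1/16` and `1/(4π²)`.
  refine ⟨48 * M ^ 2 * Real.exp (2 * M) * Real.exp ((M' + M) ^ 2 / (2 * (1 / 16))) *
    Real.exp (M ^ 2 / (2 * (1 / (4 * Real.pi ^ 2)))), by positivity, ?_⟩
  filter_upwards [hTe, hρ1, hρ2, h.eventually_pos, eventually_succ_div_le h.tendsto_L h.tendsto_s₁,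
    eventually_succ_div_le h.tendsto_L h.tendsto_s₂] with i hT hρ hρ' hi hs1 hs2 X y hX0 hX1 hy0 hy
  have hL2 : 0 < 2 * L i ^ 2 := by positivity
  have hp1 : X / (2 * L i ^ 2) < 1 := (div_lt_one hL2).2 hX1
  have hρ0 : 0 ≤ (rIdx (k₁ i) : ℝ) + aIdx (k₁ i) := by
    by_contra hneg
    have : (1 - κ) * ((rIdx (k₁ i) : ℝ) + aIdx (k₁ i)) / L i ^ 4 ≤ 0 :=
      div_nonpos_of_nonpos_of_nonneg (mul_nonpos_of_nonneg_of_nonpos hκ1.le (not_le.1 hneg).le)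
        (by positivity)
    linarith
  -- the factors
  have b2 : ‖(((1 - X / (2 * L i ^ 2)) ^ ((rIdx (k₁ i) : ℝ) + aIdx (k₁ i)) /
      (1 - κ * (X / (2 * L i ^ 2))) ^ T i : ℝ) : ℂ)‖ ≤ Real.exp (-(1 / 16 * X ^ 2) + M' * X) := by
    have hκp : κ * (X / (2 * L i ^ 2)) < 1 := by
      have : 0 < X / (2 * L i ^ 2) := by positivity
      nlinarith [h.pos, h.lt_one]
    rw [Complex.norm_real, Real.norm_of_nonneg (div_nonneg (Real.rpow_nonneg (by linarith) _)
      (pow_nonneg (by linarith) _))]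
    refine (rpow_mul_inv_pow_le h.pos h.lt_one (by positivity) hp1 hρ0 (T i)).trans ?_
    apply Real.exp_le_exp.2
    apply add_le_add
    · have e : ((rIdx (k₁ i) : ℝ) + aIdx (k₁ i)) * (1 - κ) * (X / (2 * L i ^ 2)) ^ 2 / 2
        = (1 - κ) * ((rIdx (k₁ i) : ℝ) + aIdx (k₁ i)) / L i ^ 4 * (X ^ 2 / 8) := by
        field_simp
        norm_num
      rw [e]
      have : 1 / 2 * (X ^ 2 / 8) ≤ (1 - κ) * ((rIdx (k₁ i) : ℝ) + aIdx (k₁ i)) / L i ^ 4 * (X ^ 2 / 8) := by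
        gcongr
      linarith
    · calc _ ≤ (|η₁| + 1) * L i ^ 2 * (X / (2 * L i ^ 2)) / (1 - κ) := by gcongr
        _ = _ := by rw [hM']; field_simp
  have b3 : ‖(1 + (κ : ℂ) * (circlePt (L i) y - 1)) ^ T i / circlePt (L i) y ^ rIdx (k₂ i)‖
      ≤ Real.exp (-(1 / (4 * Real.pi ^ 2) * y ^ 2)) := by
    rw [norm_div, norm_pow (circlePt (L i) y), norm_circlePt, one_pow, div_one]
    refine (norm_one_add_mul_exp_sub_one_pow_le h.pos.le h.lt_one.le (ψ := -(y / (2 * L i ^ 2))) (by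
      rw [abs_neg, abs_div, abs_of_pos hL2, div_le_iff₀ hL2]; linarith) (T i)).trans ?_
    apply Real.exp_le_exp.2
    apply neg_le_neg
    have e : 2 * κ * (1 - κ) * T i * (-(y / (2 * L i ^ 2))) ^ 2 / Real.pi ^ 2
        = κ * (1 - κ) * T i / L i ^ 4 * (y ^ 2 / (2 * Real.pi ^ 2)) := by
      field_simp
    rw [e]
    calc 1 / (4 * Real.pi ^ 2) * y ^ 2 = 1 / 2 * (y ^ 2 / (2 * Real.pi ^ 2)) := by
          field_simp; norm_num
      _ ≤ _ := by gcongr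
  have b4 : ‖jacobiScaled (k₁ i) (s₁ i) (-1 + ((X / L i ^ 2 : ℝ) : ℂ)) / (L i : ℂ)‖
      ≤ 4 * M * Real.exp (M * Real.sqrt (2 * X)) := by
    apply norm_jacobiScaled_div_le hi
    · exact hs1.trans (by rw [hM]; linarith [abs_nonneg ν₂])
    · rw [Complex.norm_real, Real.norm_of_nonneg (by positivity)]
  have b5 : ‖jacobiScaled (k₂ i) (s₂ i) (-1 + 2 * (1 - circlePt (L i) y)) / (L i : ℂ)‖
      ≤ 4 * M * Real.exp (M * Real.sqrt (2 * |y|)) := by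
    apply norm_jacobiScaled_div_le hi
    · exact hs2.trans (by rw [hM]; linarith [abs_nonneg ν₁])
    · exact norm_one_sub_circlePt_le _ _
  have b6 := norm_sqrt_div_le hi hX0 hX1 hy0 hy
  unfold scaledIntegrand
  rw [norm_mul, norm_mul, norm_mul, norm_mul, norm_mul, norm_circlePt, one_mul]
  have q1 : -(1 / 16 * X ^ 2) + M' * X + M * Real.sqrt (2 * X)
      ≤ -(1 / 32) * X ^ 2 + (M' + M) ^ 2 / (2 * (1 / 16)) + M := by
    have := neg_mul_sq_add_mul_le (δ := 1 / 16) (M := M' + M) (by norm_num) X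
    have h2 : M * Real.sqrt (2 * X) ≤ M * (1 + X) := by
      gcongr; exact sqrt_two_mul_le hX0.le
    linarith
  have q2 : -(1 / (4 * Real.pi ^ 2) * y ^ 2) + M * Real.sqrt (2 * |y|)
      ≤ -(1 / (8 * Real.pi ^ 2)) * y ^ 2 + M ^ 2 / (2 * (1 / (4 * Real.pi ^ 2))) + M := by
    have := neg_mul_sq_add_mul_le (δ := 1 / (4 * Real.pi ^ 2)) (M := M) (by positivity) |y|
    rw [sq_abs] at this
    have h2 : M * Real.sqrt (2 * |y|) ≤ M * (1 + |y|) := by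
      gcongr; exact sqrt_two_mul_le (abs_nonneg y)
    have h3 : 1 / (4 * Real.pi ^ 2) / 2 * y ^ 2 = 1 / (8 * Real.pi ^ 2) * y ^ 2 := by
      rw [div_div]; ring_nf
    linarith
  calc _ ≤ Real.exp (-(1 / 16 * X ^ 2) + M' * X) * Real.exp (-(1 / (4 * Real.pi ^ 2) * y ^ 2)) *
        (4 * M * Real.exp (M * Real.sqrt (2 * X))) * (4 * M * Real.exp (M * Real.sqrt (2 * |y|))) *
        (3 * |y| ^ (-1 / 2 : ℝ)) := by
        gcongr
    _ = 48 * M ^ 2 * (Real.exp (-(1 / 16 * X ^ 2) + M' * X + M * Real.sqrt (2 * X)) *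
        (|y| ^ (-1 / 2 : ℝ) * Real.exp (-(1 / (4 * Real.pi ^ 2) * y ^ 2) + M * Real.sqrt (2 * |y|)))) := by
        rw [Real.exp_add (_ + _), Real.exp_add (-(1 / (4 * Real.pi ^ 2) * y ^ 2))]
        ring
    _ ≤ 48 * M ^ 2 * (Real.exp (-(1 / 32) * X ^ 2 + (M' + M) ^ 2 / (2 * (1 / 16)) + M) *
        (|y| ^ (-1 / 2 : ℝ) * Real.exp (-(1 / (8 * Real.pi ^ 2)) * y ^ 2
          + M ^ 2 / (2 * (1 / (4 * Real.pi ^ 2))) + M))) := by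
        gcongr
    _ = _ := by
        unfold dominant
        simp only [Real.exp_add, two_mul M]
        ring

/-- The region of integration before the limit. -/
def region (L : ℝ) : Set (ℝ × ℝ) := Iio (2 * L ^ 2) ×ˢ Ioc (-(2 * Real.pi * L ^ 2)) (2 * Real.pi * L ^ 2)

theorem measurableSet_region (L : ℝ) : MeasurableSet (region L) :=
  measurableSet_Iio.prod measurableSet_Ioc

theorem ae_pos_ne_zero : ∀ᵐ z : ℝ × ℝ ∂((volume.restrict (Ioi (0 : ℝ))).prod volume),
    0 < z.1 ∧ z.2 ≠ 0 := by
  have h1 : ∀ᵐ x : ℝ ∂(volume.restrict (Ioi (0 : ℝ))), 0 < x :=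
    ae_restrict_mem measurableSet_Ioi
  have h2 : ∀ᵐ y : ℝ, y ≠ 0 := Measure.ae_ne volume 0
  exact (Measure.quasiMeasurePreserving_fst.ae h1).and (Measure.quasiMeasurePreserving_snd.ae h2)

/-- Convergence of the double integrals. -/
theorem EdgeRegime.tendsto_integral (h : EdgeRegime κ L T k₁ s₁ k₂ s₂ ν₁ η₁ ν₂ η₂) :
    Tendsto (fun i => ∫ X in (0 : ℝ)..2 * L i ^ 2,
      ∫ y in -(2 * Real.pi * L i ^ 2)..2 * Real.pi * L i ^ 2,
        scaledIntegrand κ (L i) (T i) (k₁ i) (s₁ i) (k₂ i) (s₂ i) X y) atTop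
      (𝓝 (∫ y : ℝ, ∫ X in Ioi (0 : ℝ), pearceyIntegrand ν₁ η₁ ν₂ η₂ X y)) := by
  obtain ⟨C, hC, hdom⟩ := h.exists_dominant
  set μ := (volume.restrict (Ioi (0 : ℝ))).prod (volume : Measure ℝ) with hμ
  set F : ℕ → ℝ × ℝ → ℂ := fun i => (region (L i)).indicator fun z =>
    scaledIntegrand κ (L i) (T i) (k₁ i) (s₁ i) (k₂ i) (s₂ i) z.1 z.2 with hF
  have hmeas : ∀ i, AEStronglyMeasurable (F i) μ := fun i =>
    ((measurable_scaledIntegrand _ _ _ _ _ _ _).indicator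
      (measurableSet_region _)).aestronglyMeasurable
  have hbound : ∀ᶠ i in atTop, ∀ᵐ z ∂μ, ‖F i z‖ ≤ dominant C z := by
    filter_upwards [hdom] with i hi
    filter_upwards [ae_pos_ne_zero] with z hz
    simp only [hF]
    rw [indicator]
    split_ifs with hmem
    · refine hi z.1 z.2 hz.1 hmem.1 hz.2 (abs_le.2 ⟨hmem.2.1.le, hmem.2.2⟩)
    · rw [norm_zero, dominant]; positivity
  have hlim : ∀ᵐ z ∂μ, Tendsto (fun i => F i z) atTop (𝓝 (pearceyIntegrand ν₁ η₁ ν₂ η₂ z.1 z.2)) := by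
    filter_upwards [ae_pos_ne_zero] with z hz
    refine (h.tendsto_scaledIntegrand hz.1 hz.2).congr' ?_
    have hL2 : Tendsto (fun i => L i ^ 2) atTop atTop :=
      (tendsto_pow_atTop two_ne_zero).comp h.tendsto_L
    have e1 := (hL2.const_mul_atTop (two_pos : (0 : ℝ) < 2)).eventually_gt_atTop z.1
    have e2 := (hL2.const_mul_atTop (by positivity : (0 : ℝ) < 2 * Real.pi)).eventually_gt_atTop |z.2|
    filter_upwards [e1, e2] with i h1 h2
    simp only [hF]
    rw [indicator_of_mem]
    exact ⟨h1, (abs_lt.1 h2).1, (abs_lt.1 h2).2.le⟩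
  have hmain := tendsto_integral_filter_of_dominated_convergence (dominant C)
    (Eventually.of_forall hmeas) hbound (integrable_dominant C) hlim
  -- The limit inherits the majorant. Joint integrability is needed because the Pearcey kernel
  -- integrates over `x` inside, the correlation kernel over `u` inside; Fubini exchanges them.
  have hlimint : Integrable (fun z : ℝ × ℝ => pearceyIntegrand ν₁ η₁ ν₂ η₂ z.1 z.2) μ := by
    refine (integrable_dominant C).mono' (aestronglyMeasurable_of_tendsto_ae atTop hmeas hlim) ?_
    have hb2 : ∀ᵐ z ∂μ, ∀ᶠ i in atTop, ‖F i z‖ ≤ dominant C z := by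
      filter_upwards [ae_pos_ne_zero] with z hz
      filter_upwards [hdom] with i hi
      simp only [hF]
      rw [indicator]
      split_ifs with hmem
      · refine hi z.1 z.2 hz.1 hmem.1 hz.2 (abs_le.2 ⟨hmem.2.1.le, hmem.2.2⟩)
      · rw [norm_zero, dominant]; positivity
    filter_upwards [hlim, hb2] with z h1 h2
    exact le_of_tendsto h1.norm h2
  rw [integral_prod_symm _ hlimint] at hmain
  refine hmain.congr' ?_
  filter_upwards [hbound, h.eventually_pos] with i hi hLi
  have hint : Integrable (F i) μ := (integrable_dominant C).mono' (hmeas i) hi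
  rw [integral_prod _ hint, intervalIntegral.integral_of_le (by positivity),
    integral_Ioc_eq_integral_Ioo, ← Ioi_inter_Iio, ← setIntegral_indicator measurableSet_Iio]
  refine integral_congr_ae (Eventually.of_forall fun X => ?_)
  simp only [hF, indicator]
  have hneg : -(2 * Real.pi * L i ^ 2) ≤ 2 * Real.pi * L i ^ 2 := by
    have : 0 ≤ 2 * Real.pi * L i ^ 2 := by positivity
    linarith
  split_ifs with hX
  · rw [intervalIntegral.integral_of_le hneg, ← integral_indicator measurableSet_Ioc]
    refine integral_congr_ae (Eventually.of_forall fun y => ?_)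
    simp only [indicator, region, mem_prod]
    have : (X, y).1 ∈ Iio (2 * L i ^ 2) := hX
    simp only [this, true_and]
    split_ifs <;> rfl
  · have : ∀ y : ℝ, (X, y) ∉ region (L i) := fun y hm => hX hm.1
    simp [this]

end

/-! ### Exact reduction: contour deformation and change of variables. -/

/-- The integrand of the double contour integral of the correlation kernel. -/
def kernelIntegrand (q : ℝ) (T s k t m : ℕ) (x : ℝ) (u : ℂ) : ℂ :=
  phi q (x : ℂ) ^ T / phi q u ^ T *
          (jacobiJ s k).eval (x : ℂ) * (jacobiJ t m).eval u *
          ((1 - (x : ℂ)) ^ rIdx k / (1 - u) ^ rIdx m) *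
          ((((1 - x) ^ aIdx k * (1 + x) ^ (1 / 2 : ℝ) : ℝ) : ℂ) / ((x : ℂ) - u))

/-- Since `1/φ` is a polynomial, only `u = 1` and `u = x` can be singular. -/
theorem differentiableAt_kernelIntegrand (q : ℝ) (T s k t m : ℕ) (x : ℝ) {u : ℂ} (h1 : u ≠ 1)
    (hx : u ≠ x) : DifferentiableAt ℂ (kernelIntegrand q T s k t m x) u := by
  have e : kernelIntegrand q T s k t m x = fun u : ℂ => phi q (x : ℂ) ^ T *
      (1 + (alpha q : ℂ) * (1 - u) + (alpha q : ℂ) ^ 2 / 2 * (1 - u)) ^ T *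
          (jacobiJ s k).eval (x : ℂ) * (jacobiJ t m).eval u *
          ((1 - (x : ℂ)) ^ rIdx k / (1 - u) ^ rIdx m) *
          ((((1 - x) ^ aIdx k * (1 + x) ^ (1 / 2 : ℝ) : ℝ) : ℂ) / ((x : ℂ) - u)) := by
    funext u
    have : phi q u ^ T = ((1 + (alpha q : ℂ) * (1 - u) + (alpha q : ℂ) ^ 2 / 2 * (1 - u)) ^ T)⁻¹ := by
      rw [phi, one_div, inv_pow]
    rw [kernelIntegrand, this, div_inv_eq_mul]
  rw [e]
  have h2 : (1 - u) ^ rIdx m ≠ 0 := pow_ne_zero _ (sub_ne_zero.2 h1.symm)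
  have h3 : (x : ℂ) - u ≠ 0 := sub_ne_zero.2 hx.symm
  have h4 : DifferentiableAt ℂ (fun u => (jacobiJ t m).eval u) u :=
    (jacobiJ t m).differentiable.differentiableAt
  fun_prop (disch := assumption)

/-- Deformation of the contour to the circle through the edge. -/
theorem circleIntegral_kernelIntegrand (q : ℝ) (T s k t m : ℕ) {x : ℝ} (hx : x ∈ Ioo (-1 : ℝ) 1) :
    (∮ u in C(1, 3), kernelIntegrand q T s k t m x u)
      = ∮ u in C(1, 2), kernelIntegrand q T s k t m x u := by
  have hd : ∀ u : ℂ, u ∉ Metric.ball (1 : ℂ) 2 →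
      DifferentiableAt ℂ (kernelIntegrand q T s k t m x) u := by
    intro u hu
    apply differentiableAt_kernelIntegrand
    · rintro rfl; exact hu (Metric.mem_ball_self (by norm_num))
    · rintro rfl
      apply hu
      rw [Metric.mem_ball, dist_eq_norm, ← Complex.ofReal_one, ← Complex.ofReal_sub,
        Complex.norm_real, Real.norm_eq_abs, abs_lt]
      exact ⟨by linarith [hx.1], by linarith [hx.2]⟩
  apply Complex.circleIntegral_eq_of_differentiable_on_annulus_off_countable (by norm_num)
    (by norm_num) countable_empty
  · intro u hu
    exact (hd u hu.2).continuousAt.continuousWithinAt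
  · intro u hu
    exact hd u fun h => hu.1.2 (Metric.ball_subset_closedBall h)

/-- The position `κ` of the critical level. -/
def kappa (q : ℝ) : ℝ := 1 - ((1 + alpha q) ^ 2)⁻¹

theorem phi_eq {q : ℝ} (hα : 1 + alpha q ≠ 0) {z u : ℂ} (hu : 1 - u = 2 * z) :
    phi q u = (((1 + alpha q) ^ 2 : ℝ) * (1 + (kappa q : ℂ) * (z - 1)))⁻¹ := by
  have h : (1 + (alpha q : ℂ)) ≠ 0 := by exact_mod_cast hα
  rw [phi, hu, one_div, kappa]
  push_cast
  congr 1
  field_simp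
  ring

theorem phi_pow_div_phi_pow {q : ℝ} (hα : 1 + alpha q ≠ 0) {z w u x : ℂ} (hu : 1 - u = 2 * z)
    (hx : 1 - x = 2 * w) (T : ℕ) :
    phi q x ^ T / phi q u ^ T
      = (1 + (kappa q : ℂ) * (z - 1)) ^ T / (1 + (kappa q : ℂ) * (w - 1)) ^ T := by
  have h : ((((1 + alpha q) ^ 2 : ℝ) : ℂ)) ^ T ≠ 0 := by
    apply pow_ne_zero
    exact_mod_cast pow_ne_zero 2 hα
  rw [phi_eq hα hu, phi_eq hα hx, inv_pow, inv_pow, inv_div_inv, mul_pow, mul_pow,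
    mul_div_mul_left _ _ h]

/-- Starting at angle `π` puts the critical point at `y = 0`. The angle decreases with `y`, so that
`u` moves upwards through `-1`; this reversal accounts for `x - u` turning into `u - x`. -/
theorem circleMap_eq (L y : ℝ) :
    circleMap 0 2 (Real.pi - y / (2 * L ^ 2)) = -(2 * circlePt L y) := by
  rw [circleMap, circlePt, zero_add]
  push_cast
  rw [sub_mul, Complex.exp_sub, Complex.exp_pi_mul_I, neg_mul (_ / _), Complex.exp_neg]
  ring

/-- An exact identity. The prefactor `L`, the Jacobians `L⁻²` and `(2L²)⁻¹`, and `(1+x)^{1/2} =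
√X/L` give `L⁻⁴`: one `L⁻¹` for each polynomial and `L⁻²` for the pole. The powers `2^{r₂-r₁}` are
absorbed by `1 - x = 2w`, `1 - u = 2z`. -/
theorem kernelIntegrand_eq_scaledIntegrand {q L X : ℝ} (hα : 1 + alpha q ≠ 0) (hL : 0 < L)
    (hX0 : 0 < X) (hX1 : X < 2 * L ^ 2) (T s k t m : ℕ) (y : ℝ) :
    (((2 : ℝ) ^ ((rIdx m : ℤ) - (rIdx k : ℤ)) * (-1 : ℝ) ^ ((s : ℤ) - (t : ℤ)) *
      (2 : ℝ) ^ (aIdx m - aIdx k) * L : ℝ) : ℂ) *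
      ((((2 : ℝ) ^ (aIdx k + 1 / 2) / Real.pi : ℝ) : ℂ) * (1 / (2 * (Real.pi : ℂ) * Complex.I))) *
      ((L ^ 2 : ℝ) : ℂ)⁻¹ * ((2 * L ^ 2 : ℝ) : ℂ)⁻¹ *
      (-(2 * circlePt L y) * Complex.I *
        kernelIntegrand q T s k t m (-1 + X / L ^ 2) (1 + -(2 * circlePt L y)))
    = (Real.sqrt 2 : ℂ) / (2 * (Real.pi : ℂ) ^ 2 * Complex.I) * Complex.I *
      scaledIntegrand (kappa q) L T k s m t X y := by
  have hp1 : 0 < 1 - X / (2 * L ^ 2) := by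
    rw [sub_pos, div_lt_one (by positivity)]; exact hX1
  have hLC : (L : ℂ) ≠ 0 := by exact_mod_cast hL.ne'
  have hu : 1 - (1 + -(2 * circlePt L y)) = 2 * circlePt L y := by ring
  have hxr : 1 - (-1 + X / L ^ 2) = 2 * (1 - X / (2 * L ^ 2)) := by field_simp; ring
  have hx : 1 - ((-1 + X / L ^ 2 : ℝ) : ℂ) = 2 * ((1 - X / (2 * L ^ 2) : ℝ) : ℂ) := by
    rw [← Complex.ofReal_one, ← Complex.ofReal_sub, hxr]; push_cast; rfl
  have hu2 : 1 + -(2 * circlePt L y) = -1 + 2 * (1 - circlePt L y) := by ring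
  have hx2 : ((-1 + X / L ^ 2 : ℝ) : ℂ) = -1 + ((X / L ^ 2 : ℝ) : ℂ) := by push_cast; rfl
  have hsgn : ((-1 : ℝ) ^ ((s : ℤ) - (t : ℤ))) = (-1) ^ s * (-1) ^ t := by
    rw [zpow_sub₀ (by norm_num), zpow_natCast, zpow_natCast, div_eq_mul_inv, ← inv_pow]
    norm_num
  have hw1 : (1 - (-1 + X / L ^ 2)) ^ aIdx k
      = (2 : ℝ) ^ aIdx k * (1 - X / (2 * L ^ 2)) ^ aIdx k := by
    rw [hxr, Real.mul_rpow (by norm_num) hp1.le]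
  have hw2 : (1 + (-1 + X / L ^ 2)) ^ (1 / 2 : ℝ) = Real.sqrt X / L := by
    rw [add_neg_cancel_left, ← Real.sqrt_eq_rpow, Real.sqrt_div hX0.le, Real.sqrt_sq hL.le]
  have hrpow : (1 - X / (2 * L ^ 2)) ^ ((rIdx k : ℝ) + aIdx k)
      = (1 - X / (2 * L ^ 2)) ^ rIdx k * (1 - X / (2 * L ^ 2)) ^ aIdx k := by
    rw [Real.rpow_add hp1, Real.rpow_natCast]
  have hbase : (1 + (kappa q : ℂ) * (((1 - X / (2 * L ^ 2) : ℝ) : ℂ) - 1))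
      = ((1 - kappa q * (X / (2 * L ^ 2)) : ℝ) : ℂ) := by push_cast; ring
  have e4 : (2 : ℝ) ^ ((rIdx m : ℤ) - (rIdx k : ℤ)) = (2 : ℝ) ^ rIdx m / (2 : ℝ) ^ rIdx k := by
    rw [zpow_sub₀ (by norm_num), zpow_natCast, zpow_natCast]
  have e5 : (2 : ℝ) ^ (aIdx m - aIdx k) * (2 : ℝ) ^ (aIdx k + 1 / 2)
      = (2 : ℝ) ^ aIdx m * Real.sqrt 2 := by
    rw [← Real.rpow_add (by norm_num), Real.sqrt_eq_rpow, ← Real.rpow_add (by norm_num)]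
    congr 1; ring
  unfold kernelIntegrand scaledIntegrand jacobiScaled
  rw [phi_pow_div_phi_pow hα hu hx, hu, hx, hbase, hw1, hw2, hrpow, hsgn, e4, hu2, hx2]
  have hD : (-1 + ((X / L ^ 2 : ℝ) : ℂ)) - (-1 + 2 * (1 - circlePt L y))
    = -(2 * (1 - circlePt L y) - ((X / L ^ 2 : ℝ) : ℂ)) := by ring
  rw [hD]
  have he : circlePt L y ^ rIdx m ≠ 0 := pow_ne_zero _ (circlePt_ne_zero _ _)
  generalize (jacobiJ s k).eval (-1 + ((X / L ^ 2 : ℝ) : ℂ)) = j₁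
  generalize (jacobiJ t m).eval (-1 + 2 * (1 - circlePt L y)) = j₂
  generalize 2 * (1 - circlePt L y) - ((X / L ^ 2 : ℝ) : ℂ) = D
  generalize 1 - kappa q * (X / (2 * L ^ 2)) = b
  generalize (1 + (kappa q : ℂ) * (circlePt L y - 1)) ^ T = c
  generalize (1 - X / (2 * L ^ 2)) ^ aIdx k = p₂
  generalize 1 - X / (2 * L ^ 2) = p₁
  have e5C : (((2 : ℝ) ^ (aIdx m - aIdx k) : ℝ) : ℂ) * (((2 : ℝ) ^ (aIdx k + 1 / 2) : ℝ) : ℂ)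
      = (((2 : ℝ) ^ aIdx m : ℝ) : ℂ) * (Real.sqrt 2 : ℂ) := by exact_mod_cast e5
  rw [mul_pow, mul_pow]
  simp only [Complex.ofReal_mul, Complex.ofReal_div, Complex.ofReal_pow, Complex.ofReal_neg,
    Complex.ofReal_one, Complex.ofReal_ofNat]
  generalize (((2 : ℝ) ^ (aIdx m - aIdx k) : ℝ) : ℂ) = d₁ at *
  generalize (((2 : ℝ) ^ (aIdx k + 1 / 2) : ℝ) : ℂ) = d₂ at *
  generalize (((2 : ℝ) ^ aIdx m : ℝ) : ℂ) = d₃ at *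
  generalize (((2 : ℝ) ^ aIdx k : ℝ) : ℂ) = d₄ at *
  generalize circlePt L y ^ rIdx m = E at *
  generalize (p₁ : ℂ) ^ rIdx k = P₁ at *
  generalize (b : ℂ) ^ T = B at *
  generalize ((-1 : ℂ)) ^ s = g₁ at *
  generalize ((-1 : ℂ)) ^ t = g₂ at *
  have hk2 : (2 : ℂ) ^ rIdx k ≠ 0 := pow_ne_zero _ two_ne_zero
  have hm2 : (2 : ℂ) ^ rIdx m ≠ 0 := pow_ne_zero _ two_ne_zero
  generalize (2 : ℂ) ^ rIdx k = R₁ at *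
  generalize (2 : ℂ) ^ rIdx m = R₂ at *
  generalize (Real.sqrt 2 : ℂ) = σ at *
  have hpi : (Real.pi : ℂ) ≠ 0 := by exact_mod_cast Real.pi_ne_zero
  have hI := Complex.I_ne_zero
  clear hw1 hw2 hrpow hbase e4 e5 hsgn hx hx2 hxr hu hu2 hD hp1
  rw [div_neg]
  set W : ℂ := circlePt L y * p₂ * P₁ * B⁻¹ * c * E⁻¹ * d₄ * g₁ * j₁ * g₂ * j₂ *
    (Real.sqrt X : ℂ) * D⁻¹ * ((Real.pi : ℂ) ^ 2)⁻¹ * ((L : ℂ) ^ 4)⁻¹ / 2 with hW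
  have h1 := mul_inv_cancel₀ hk2
  have h2 := mul_inv_cancel₀ hm2
  have h3 := mul_inv_cancel₀ hLC
  have h4 := mul_inv_cancel₀ hI
  calc _ = (d₁ * d₂) * W * ((R₁ * R₁⁻¹) * (R₂ * R₂⁻¹) * (L * (L : ℂ)⁻¹) *
        (Complex.I * Complex.I⁻¹)) := by
        rw [hW]; ring
    _ = (d₃ * σ) * W * (Complex.I * Complex.I⁻¹) := by
        rw [e5C, h1, h2, h3, h4]; ring
    _ = _ := by
        rw [hW]; ring

theorem scaled_double_integral {q L : ℝ} (hα : 1 + alpha q ≠ 0) (hL : 0 < L) (T s k t m : ℕ) :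
    (((2 : ℝ) ^ ((rIdx m : ℤ) - (rIdx k : ℤ)) * (-1 : ℝ) ^ ((s : ℤ) - (t : ℤ)) *
      (2 : ℝ) ^ (aIdx m - aIdx k) * L : ℝ) : ℂ) *
      ((((2 : ℝ) ^ (aIdx k + 1 / 2) / Real.pi : ℝ) : ℂ) * (1 / (2 * (Real.pi : ℂ) * Complex.I)) *
        ∫ x in (-1 : ℝ)..1, ∮ u in C(1, 3), kernelIntegrand q T s k t m x u)
    = (Real.sqrt 2 : ℂ) / (2 * (Real.pi : ℂ) ^ 2 * Complex.I) * Complex.I *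
      ∫ X in (0 : ℝ)..2 * L ^ 2, ∫ y in -(2 * Real.pi * L ^ 2)..2 * Real.pi * L ^ 2,
        scaledIntegrand (kappa q) L T k s m t X y := by
  have hL2 : L ^ 2 ≠ 0 := by positivity
  have h2L2 : 2 * L ^ 2 ≠ 0 := by positivity
  -- The endpoints are discarded as a null set: `x = -1` lies on the circle of radius `2`, so the
  -- deformation is available only for interior `x`.
  have hcont : (∫ x in (-1 : ℝ)..1, ∮ u in C(1, 3), kernelIntegrand q T s k t m x u)
      = ∫ x in (-1 : ℝ)..1, ∮ u in C(1, 2), kernelIntegrand q T s k t m x u := by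
    rw [intervalIntegral.integral_of_le (by norm_num), intervalIntegral.integral_of_le (by norm_num),
      integral_Ioc_eq_integral_Ioo, integral_Ioc_eq_integral_Ioo]
    exact setIntegral_congr_fun measurableSet_Ioo fun x hx =>
      circleIntegral_kernelIntegrand q T s k t m hx
  have hinner : ∀ x : ℝ, (∮ u in C(1, 2), kernelIntegrand q T s k t m x u)
      = ((2 * L ^ 2 : ℝ) : ℂ)⁻¹ * ∫ y in -(2 * Real.pi * L ^ 2)..2 * Real.pi * L ^ 2,
        -(2 * circlePt L y) * Complex.I *
          kernelIntegrand q T s k t m x (1 + -(2 * circlePt L y)) := by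
    intro x
    have h1 := intervalIntegral.integral_comp_sub_div (a := -(2 * Real.pi * L ^ 2))
      (b := 2 * Real.pi * L ^ 2) (fun θ => deriv (circleMap 1 2) θ •
        kernelIntegrand q T s k t m x (circleMap 1 2 θ)) h2L2 Real.pi
    have e1 : Real.pi - 2 * Real.pi * L ^ 2 / (2 * L ^ 2) = 0 := by field_simp; ring
    have e2 : Real.pi - -(2 * Real.pi * L ^ 2) / (2 * L ^ 2) = 2 * Real.pi := by field_simp; ring
    rw [e1, e2] at h1
    have h2 : ∀ y : ℝ, deriv (circleMap 1 2) (Real.pi - y / (2 * L ^ 2)) •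
        kernelIntegrand q T s k t m x (circleMap 1 2 (Real.pi - y / (2 * L ^ 2)))
        = -(2 * circlePt L y) * Complex.I *
          kernelIntegrand q T s k t m x (1 + -(2 * circlePt L y)) := by
      intro y
      have e3 : circleMap 1 2 (Real.pi - y / (2 * L ^ 2)) = 1 + -(2 * circlePt L y) := by
        rw [← circleMap_eq]; simp [circleMap]
      rw [deriv_circleMap, circleMap_eq, e3, smul_eq_mul]
    simp_rw [h2] at h1
    rw [h1, Complex.real_smul, inv_mul_cancel_left₀ (by exact_mod_cast h2L2)]
    rfl
  have houter := intervalIntegral.integral_comp_add_div (a := 0) (b := 2 * L ^ 2)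
    (fun x => ∮ u in C(1, 2), kernelIntegrand q T s k t m x u) hL2 (-1)
  have e1 : -1 + 2 * L ^ 2 / L ^ 2 = 1 := by field_simp; norm_num
  rw [zero_div, add_zero, e1, Complex.real_smul] at houter
  have houter' : (∫ x in (-1 : ℝ)..1, ∮ u in C(1, 2), kernelIntegrand q T s k t m x u)
      = ((L ^ 2 : ℝ) : ℂ)⁻¹ * ∫ X in (0 : ℝ)..2 * L ^ 2,
        ∮ u in C(1, 2), kernelIntegrand q T s k t m (-1 + X / L ^ 2) u := by
    rw [houter, inv_mul_cancel_left₀ (by exact_mod_cast hL2)]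
  rw [hcont, houter', ← mul_assoc, ← mul_assoc]
  rw [← intervalIntegral.integral_const_mul, ← intervalIntegral.integral_const_mul,
    intervalIntegral.integral_of_le (by positivity), intervalIntegral.integral_of_le (by positivity),
    integral_Ioc_eq_integral_Ioo, integral_Ioc_eq_integral_Ioo]
  refine setIntegral_congr_fun measurableSet_Ioo fun X hX => ?_
  rw [hinner, ← mul_assoc, ← intervalIntegral.integral_const_mul,
    ← intervalIntegral.integral_const_mul]
  refine intervalIntegral.integral_congr fun y _ => ?_
  exact kernelIntegrand_eq_scaledIntegrand hα hL hX.1 hX.2 T s k t m y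

/-! ### Matching the parameters and assembling the limit. -/

/-- The edge scale `L = N^{1/4} c_α^{1/2}`. -/
def edgeScale (q : ℝ) (N : ℕ) : ℝ := (N : ℝ) ^ (1 / 4 : ℝ) * cAlpha q ^ (1 / 2 : ℝ)

theorem alpha_pos {q : ℝ} (hq0 : 0 < q) (hq1 : q < 1) : 0 < alpha q :=
  div_pos (by linarith) (by linarith)

theorem cAlpha_pos {q : ℝ} (hα : 0 < alpha q) : 0 < cAlpha q := by
  unfold cAlpha; positivity

/-- This identity explains the choice of `c_α`: it gives `L⁴ = N κ(1-κ)`, so the quadratic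
coefficient of the phase tends to a universal constant. -/
theorem cAlpha_sq {q : ℝ} (hα : 0 < alpha q) : cAlpha q ^ 2 = kappa q * (1 - kappa q) := by
  unfold cAlpha kappa
  rw [mul_pow, Real.sq_sqrt (by positivity)]
  field_simp
  ring

theorem edgeScale_sq {q : ℝ} (hα : 0 < alpha q) (N : ℕ) :
    edgeScale q N ^ 2 = Real.sqrt N * cAlpha q := by
  have hc := cAlpha_pos hα
  unfold edgeScale
  rw [mul_pow, ← Real.rpow_natCast, ← Real.rpow_natCast, ← Real.rpow_mul (by positivity),
    ← Real.rpow_mul hc.le, Real.sqrt_eq_rpow]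
  norm_num

theorem edgeScale_pow_four {q : ℝ} (hα : 0 < alpha q) (N : ℕ) :
    edgeScale q N ^ 4 = N * (kappa q * (1 - kappa q)) := by
  rw [← cAlpha_sq hα, show edgeScale q N ^ 4 = (edgeScale q N ^ 2) ^ 2 by ring, edgeScale_sq hα,
    mul_pow, Real.sq_sqrt (by positivity)]

theorem tendsto_edgeScale {q : ℝ} (hα : 0 < alpha q) : Tendsto (edgeScale q) atTop atTop := by
  have h1 : Tendsto (fun N : ℕ => (N : ℝ) ^ (1 / 4 : ℝ)) atTop atTop :=
    (tendsto_rpow_atTop (by norm_num)).comp tendsto_natCast_atTop_atTop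
  exact h1.atTop_mul_const (Real.rpow_pos_of_pos (cAlpha_pos hα) _)

theorem kappa_pos {q : ℝ} (hα : 0 < alpha q) : 0 < kappa q := by
  unfold kappa
  rw [sub_pos]
  apply inv_lt_one_of_one_lt₀
  nlinarith

theorem kappa_lt_one {q : ℝ} (hα : 0 < alpha q) : kappa q < 1 := by
  have : 0 < ((1 + alpha q) ^ 2)⁻¹ := by positivity
  unfold kappa; linarith

theorem edgeRegime_of_tendsto {q : ℝ} (hα : 0 < alpha q) {ν₁ ν₂ η₁ η₂ : ℝ}
    {s₁ s₂ k₁ k₂ T : ℕ → ℕ}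
    (hs₁ : Tendsto (fun N : ℕ => (s₁ N : ℝ) / (N : ℝ) ^ (1 / 4 : ℝ)) atTop
      (𝓝 (ν₁ * cAlpha q ^ (1 / 2 : ℝ))))
    (hs₂ : Tendsto (fun N : ℕ => (s₂ N : ℝ) / (N : ℝ) ^ (1 / 4 : ℝ)) atTop
      (𝓝 (ν₂ * cAlpha q ^ (1 / 2 : ℝ))))
    (hT : Tendsto (fun N : ℕ => (T N : ℝ) / (N : ℝ)) atTop (𝓝 1))
    (hr₁ : Tendsto (fun N : ℕ => ((rIdx (k₁ N) : ℝ)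
        - (1 - ((1 + alpha q) ^ 2)⁻¹) * (T N : ℝ)) / Real.sqrt (N : ℝ)) atTop
      (𝓝 (cAlpha q * η₁)))
    (hr₂ : Tendsto (fun N : ℕ => ((rIdx (k₂ N) : ℝ)
        - (1 - ((1 + alpha q) ^ 2)⁻¹) * (T N : ℝ)) / Real.sqrt (N : ℝ)) atTop
      (𝓝 (cAlpha q * η₂))) :
    EdgeRegime (kappa q) (edgeScale q) T k₁ s₁ k₂ s₂ ν₁ η₁ ν₂ η₂ := by
  have hc := cAlpha_pos hα
  have hcs : cAlpha q ^ (1 / 2 : ℝ) ≠ 0 := (Real.rpow_pos_of_pos hc _).ne'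
  have hκκ : kappa q * (1 - kappa q) ≠ 0 := by
    rw [← cAlpha_sq hα]; positivity
  have hs : ∀ {s : ℕ → ℕ} {ν : ℝ}, Tendsto (fun N : ℕ => (s N : ℝ) / (N : ℝ) ^ (1 / 4 : ℝ)) atTop
      (𝓝 (ν * cAlpha q ^ (1 / 2 : ℝ))) →
      Tendsto (fun N => (s N : ℝ) / edgeScale q N) atTop (𝓝 ν) := by
    intro s ν h
    have := h.div_const (cAlpha q ^ (1 / 2 : ℝ))
    rw [mul_div_cancel_right₀ _ hcs] at this
    refine this.congr fun N => ?_
    rw [edgeScale, div_div]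
  have hr : ∀ {k : ℕ → ℕ} {η : ℝ}, Tendsto (fun N : ℕ => ((rIdx (k N) : ℝ)
        - (1 - ((1 + alpha q) ^ 2)⁻¹) * (T N : ℝ)) / Real.sqrt (N : ℝ)) atTop
      (𝓝 (cAlpha q * η)) →
      Tendsto (fun N => ((rIdx (k N) : ℝ) - kappa q * T N) / edgeScale q N ^ 2) atTop (𝓝 η) := by
    intro k η h
    have := h.div_const (cAlpha q)
    rw [mul_div_cancel_left₀ _ hc.ne'] at this
    refine this.congr fun N => ?_
    rw [edgeScale_sq hα, div_div, kappa]
  refine ⟨kappa_pos hα, kappa_lt_one hα, tendsto_edgeScale hα, ?_, hs hs₁, hs hs₂, hr hr₁, hr hr₂⟩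
  refine hT.congr fun N => ?_
  rw [edgeScale_pow_four hα, mul_comm (N : ℝ), mul_div_mul_left _ _ hκκ]

theorem EdgeRegime.tendsto_level_sub {κ : ℝ} {L : ℕ → ℝ} {T k₁ s₁ k₂ s₂ : ℕ → ℕ}
    {ν₁ η₁ ν₂ η₂ : ℝ} (h : EdgeRegime κ L T k₁ s₁ k₂ s₂ ν₁ η₁ ν₂ η₂) :
    Tendsto (fun i => ((k₁ i : ℝ) - k₂ i) / L i ^ 2) atTop (𝓝 (2 * (η₁ - η₂))) := by
  have hLinv := (tendsto_inv_atTop_zero.comp h.tendsto_L).pow 2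
  rw [zero_pow two_ne_zero] at hLinv
  have h1 : Tendsto (fun i => (aIdx (k₁ i) - aIdx (k₂ i)) / L i ^ 2) atTop (𝓝 0) := by
    refine squeeze_zero_norm (fun i => ?_) hLinv
    rw [norm_div, Real.norm_eq_abs, Real.norm_of_nonneg (sq_nonneg (L i))]
    simp only [Function.comp]
    rw [inv_pow, inv_eq_one_div]
    gcongr
    have := abs_sub (aIdx (k₁ i)) (aIdx (k₂ i))
    linarith [abs_aIdx_le (k₁ i), abs_aIdx_le (k₂ i)]
  have h2 := ((h.tendsto_r₁.sub h.tendsto_r₂).const_mul 2).add h1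
  rw [add_zero] at h2
  refine h2.congr fun i => ?_
  rw [level_eq (k₁ i), level_eq (k₂ i)]
  ring

/-- Decomposition of the scaled correlation kernel. -/
theorem scaling_mul_corrKernel {q : ℝ} (hα : 1 + alpha q ≠ 0) {N : ℕ} (hL : 0 < edgeScale q N)
    (T s k t m : ℕ) :
    (scaling q N s k t m : ℂ) * corrKernel q T s k t m
      = (Real.sqrt 2 : ℂ) / (2 * (Real.pi : ℂ) ^ 2 * Complex.I) * Complex.I *
        (∫ X in (0 : ℝ)..2 * edgeScale q N ^ 2,
          ∫ y in -(2 * Real.pi * edgeScale q N ^ 2)..2 * Real.pi * edgeScale q N ^ 2,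
            scaledIntegrand (kappa q) (edgeScale q N) T k s m t X y)
        + (staticTerm (edgeScale q N) k s m t : ℂ) := by
  have hscal : scaling q N s k t m = (2 : ℝ) ^ ((rIdx m : ℤ) - (rIdx k : ℤ)) *
      (-1 : ℝ) ^ ((s : ℤ) - (t : ℤ)) * (2 : ℝ) ^ (aIdx m - aIdx k) * edgeScale q N := by
    rw [scaling, edgeScale, ← mul_assoc]
  rw [← scaled_double_integral hα hL, ← hscal, corrKernel, mul_add]
  congr 1
  unfold staticTerm
  split_ifs with h
  · rw [Complex.ofReal_mul (edgeScale q N), ← integral_jacobi_eq_trig h, hscal,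
      Complex.ofReal_mul _ (edgeScale q N)]
    ring
  · simp

theorem pearceyKernel_eq (ν₁ η₁ ν₂ η₂ : ℝ) :
    pearceyKernel ν₁ η₁ ν₂ η₂
      = (Real.sqrt 2 : ℂ) / (2 * (Real.pi : ℂ) ^ 2 * Complex.I) * Complex.I *
        (∫ y : ℝ, ∫ X in Ioi (0 : ℝ), pearceyIntegrand ν₁ η₁ ν₂ η₂ X y)
        + (gaussTerm ν₁ η₁ ν₂ η₂ : ℂ) := by
  unfold pearceyKernel gaussTerm
  rw [integral_mul_const]
  congr 1
  · unfold pearceyIntegrand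
    ring
  · split_ifs
    · rfl
    · simp

end SympPearcey

end

theorem mainTheorem3 (q : ℝ) (hq0 : 0 < q) (hq1 : q < 1)
    (ν₁ ν₂ η₁ η₂ : ℝ) (hν₁ : 0 < ν₁) (hν₂ : 0 < ν₂)
    (s₁ s₂ k₁ k₂ T : ℕ → ℕ)
    (hs₁ : Tendsto (fun N : ℕ => (s₁ N : ℝ) / (N : ℝ) ^ (1 / 4 : ℝ)) atTop
      (𝓝 (ν₁ * SympPearcey.cAlpha q ^ (1 / 2 : ℝ))))
    (hs₂ : Tendsto (fun N : ℕ => (s₂ N : ℝ) / (N : ℝ) ^ (1 / 4 : ℝ)) atTop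
      (𝓝 (ν₂ * SympPearcey.cAlpha q ^ (1 / 2 : ℝ))))
    (hT : Tendsto (fun N : ℕ => (T N : ℝ) / (N : ℝ)) atTop (𝓝 1))
    (hr₁ : Tendsto (fun N : ℕ => ((SympPearcey.rIdx (k₁ N) : ℝ)
        - (1 - ((1 + SympPearcey.alpha q) ^ 2)⁻¹) * (T N : ℝ)) / Real.sqrt (N : ℝ)) atTop
      (𝓝 (SympPearcey.cAlpha q * η₁)))
    (hr₂ : Tendsto (fun N : ℕ => ((SympPearcey.rIdx (k₂ N) : ℝ)
        - (1 - ((1 + SympPearcey.alpha q) ^ 2)⁻¹) * (T N : ℝ)) / Real.sqrt (N : ℝ)) atTop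
      (𝓝 (SympPearcey.cAlpha q * η₂))) :
    (((ν₁, η₁) ≠ (ν₂, η₂) ∨
        (∀ᶠ N : ℕ in atTop, k₁ N < k₂ N ∨ (k₁ N = k₂ N ∧ s₁ N ≠ s₂ N))) →
      Tendsto (fun N : ℕ => (SympPearcey.scaling q N (s₁ N) (k₁ N) (s₂ N) (k₂ N) : ℂ) *
          SympPearcey.corrKernel q (T N) (s₁ N) (k₁ N) (s₂ N) (k₂ N)) atTop
        (𝓝 (SympPearcey.pearceyKernel ν₁ η₁ ν₂ η₂))) ∧
    ((∀ᶠ N : ℕ in atTop, k₁ N = k₂ N ∧ s₁ N = s₂ N) →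
      Tendsto (fun N : ℕ => (SympPearcey.scaling q N (s₁ N) (k₁ N) (s₂ N) (k₂ N) : ℂ) *
          (SympPearcey.corrKernel q (T N) (s₁ N) (k₁ N) (s₂ N) (k₂ N) - 1)) atTop
        (𝓝 (SympPearcey.pearceyKernel ν₁ η₁ ν₂ η₂))) := by
  have hα := SympPearcey.alpha_pos hq0 hq1
  have hα1 : 1 + SympPearcey.alpha q ≠ 0 := by positivity
  have h := SympPearcey.edgeRegime_of_tendsto hα hs₁ hs₂ hT hr₁ hr₂
  have hdbl := h.tendsto_integral.const_mul
    ((Real.sqrt 2 : ℂ) / (2 * (Real.pi : ℂ) ^ 2 * Complex.I) * Complex.I)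
  rw [SympPearcey.pearceyKernel_eq]
  constructor
  · intro hne
    have hst := SympPearcey.tendsto_staticTerm hν₁ hν₂ h.tendsto_L h.tendsto_s₁ h.tendsto_s₂
      h.tendsto_level_sub hne
    have hstC := (Complex.continuous_ofReal.tendsto _).comp hst
    refine (hdbl.add hstC).congr' ?_
    filter_upwards [h.eventually_pos] with N hN
    rw [SympPearcey.scaling_mul_corrKernel hα1 hN]
    rfl
  · intro heq
    -- Equal levels have equal `r`, so the two limits coincide and the Gaussian term is absent.
    have hη : η₁ = η₂ := by
      have h1 : Tendsto (fun N => ((SympPearcey.rIdx (k₂ N) : ℝ) - SympPearcey.kappa q * T N)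
          / SympPearcey.edgeScale q N ^ 2) atTop (𝓝 η₁) := by
        refine h.tendsto_r₁.congr' ?_
        filter_upwards [heq] with N hN
        rw [hN.1]
      exact tendsto_nhds_unique h1 h.tendsto_r₂
    have hg : SympPearcey.gaussTerm ν₁ η₁ ν₂ η₂ = 0 := by
      rw [SympPearcey.gaussTerm, if_neg (by rw [hη]; exact lt_irrefl _)]
    rw [hg, Complex.ofReal_zero, add_zero]
    refine hdbl.congr' ?_
    filter_upwards [h.eventually_pos, heq] with N hN hk
    -- By orthonormality the single integral contributes exactly `L`. For coinciding points the
    -- scaling factor is also `L`, so subtracting `1` from the kernel removes that contribution.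
    rw [mul_sub, SympPearcey.scaling_mul_corrKernel hα1 hN, ← hk.1, ← hk.2,
      SympPearcey.staticTerm_self, if_pos rfl]
    have : SympPearcey.scaling q N (s₁ N) (k₁ N) (s₁ N) (k₁ N) = SympPearcey.edgeScale q N := by
      simp [SympPearcey.scaling, SympPearcey.edgeScale]
    rw [this]
    ring
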